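/- **Setting.** For $k\ge 1$ let $B(z)=\begin{pmatrix} z&-1\\1&0\end{pmatrix}$ and let $$X(\sigma^k)=\Big\{(z_1,\dots,z_k)\in\mathbb C^k:\ \begin{pmatrix}0&-1\\1&0\end{pmatrix}B(z_1)\cdots B(z_k)\ \text{is upper triangular}\Big\}$$ be the two-strand braid variety. Attach to $z\in X(\sigma^k)$ the vectors $v_m=B(z_1)\cdots B(z_{m-1})(1,0)^T$, $1\le m\le k+1$, placed clockwise at the vertices $1,\dots,k+1$ of a polygon, and put $\Delta_{pq}=\det(v_p,v_q)$. One has $\Delta_{m,m+1}=1$ and $\Delta_{1,k+1}\ne 0$, and $z\mapsto(v_1\,\dots\,v_{k+1})$ identifies $X(\sigma^k)$ with the space of $2\times(k+1)$ matrices with these properties modulo row operations of determinant one. Every triangulation of the $(k+1)$-gon gives a seed: the mutable variables are the $\Delta_{pq}$ of its diagonals, the only frozen variable is $\Delta_{1,k+1}$, the sides with $\Delta_{m,m+1}=1$ are omitted, and the quiver joins the edges of each triangle in clockwise order. A seed $s$ in $\mathbb C(V)$ (variables, a subset of which are frozen, and a skew-symmetric exchange matrix $\varepsilon$) defines a cluster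 structure on an irreducible affine variety $V$ if, for each seed obtained from $s$ by mutations at mutable variables, the variables are algebraically independent, generate the field $\mathbb C(V)$, are regular on $V$, and are torus coordinates on the open set where none of them vanishes; the frozen variables vanish nowhere on $V$; and $\mathbb C[V]$ is generated by all cluster variables and the inverses of the frozen ones. Two seeds in $\mathbb C(V)$, with the same index set and the same mutable indices, are quasi-equivalent if the groups $\mathbf P$ of Laurent monomials in the frozen variables coincide, corresponding mutable variables differ by factors in $\mathbf P$, and the exchange ratios $\hat y_k=\prod_i A_i^{\varepsilon_{ki}}$ coincide for all mutable $k$. **The cut.** Let $a,b\ge 2$, $1\le i\le b$ and $j=i+a$, so that $D_{ij}$ is a diagonal of the $(a+b)$-gon. It cuts off an $(a+1)$-gon with vertices $i,\dots,j$ and a $(b+1)$-gon with vertices $1,\dots,i,j,\dots,a+b$. For $z\in X(\sigma^{a+b-1})$ with $\Delta_{ij}\neq0$ consider the matrices $V_1=(v_i\,\dots\,v_j)$ and $V_2=(v_1\,\dots\,v_i\,v_j\,\dots\,v_{a+b})$. Bring each of them by a row operation to the form $\begin{pmatrix}1&*&\cdots&0\\0&1&\cdots&*\end{pmatrix}$,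 and rescale its columns from the third one on so that all consecutive minors become $1$; the results correspond to points of $X(\sigma^a)$ and $X(\sigma^b)$. Let $\Phi_{ij}:X(\sigma^a)\times X(\sigma^b)\to\{\Delta_{ij}\ne0\}\subset X(\sigma^{a+b-1})$ be the inverse of this construction, that is, undo the normalization of $V_2$ with $\Delta_{ij}=\Delta_{1,a+1}(V_1)$, and insert $V_1$ into $V_2$. **Theorem.** The map $\Phi_{ij}$ is a well-defined bijection onto $\{\Delta_{ij}\ne0\}$ and an isomorphism of irreducible varieties. Let $T_1$, $T_2$ be triangulations of the $(a+1)$-gon and the $(b+1)$-gon, and let $T$ be the triangulation of the $(a+b)$-gon formed by $T_1$, $T_2$ and $D_{ij}$. Let $\Sigma$ be the seed of $X(\sigma^{a+b-1})$ attached to $T$, with $\Delta_{ij}$ moreover declared frozen, and let $\Sigma_1\sqcup\Sigma_2$ be the product seed on $X(\sigma^a)\times X(\sigma^b)$ of the seeds attached to $T_1$ and $T_2$. Then 1. $\Sigma$ defines a cluster structure on $\{\Delta_{ij}\neq0\}$, and its pullback $\Phi_{ij}^*\Sigma$ defines a cluster structure on $X(\sigma^a)\times X(\sigma^b)$; 2.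 $\Sigma_1\sqcup\Sigma_2$ defines a cluster structure on $X(\sigma^a)\times X(\sigma^b)$; 3. $\Phi_{ij}$ is a quasi-equivalence between these cluster structures: with the natural bijection of indices ($\Delta_{ij}$ corresponding to the frozen variable of $X(\sigma^a)$, and $\Delta_{1,a+b}$ to the frozen variable of $X(\sigma^b)$), the seeds $\mu(\Phi_{ij}^*\Sigma)$ and $\mu(\Sigma_1\sqcup\Sigma_2)$ are quasi-equivalent for every (possibly empty) sequence $\mu$ of mutations at mutable indices. -/

import Mathlib

noncomputable section

namespace TwoStrand

/-! ### Two-strand braid varieties -/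

/-- The braid matrix `B(z)` on two strands. -/
def braidMatrix {R : Type*} [CommRing R] (z : R) : Matrix (Fin 2) (Fin 2) R :=
  !![z, -1; 1, 0]

/-- The braid variety `X(σᵏ)`: points `(z₁, …, z_k)` of `ℂᵏ` for which
`!![0, -1; 1, 0] * B(z₁) ⋯ B(z_k)` is upper triangular. The coordinate `z_m` is `z (m - 1)`. -/
def braidVariety (k : ℕ) : Set (Fin k → ℂ) :=
  {z | (!![0, -1; 1, 0] * (List.ofFn fun l => braidMatrix (z l)).prod :
    Matrix (Fin 2) (Fin 2) ℂ).BlockTriangular id}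

/-- The vectors `v₁, …, v_{k+1}` in the plane attached to `(z₁, …, z_k)`:
`v_m = B(z₁) ⋯ B(z_{m-1}) (1, 0)ᵀ`. They are placed at the vertices `1, …, k + 1` of a polygon
(numbered clockwise); on `X(σᵏ)` they form the `2 × (k+1)` matrix representing a point of the
(normalised) open positroid variety. -/
def vec {R : Type*} [CommRing R] {k : ℕ} (z : Fin k → R) (m : ℕ) : Fin 2 → R :=
  (((List.ofFn z).take (m - 1)).map braidMatrix).prod.mulVec ![1, 0]

/-- The determinant of two plane vectors. -/
def det₂ {R : Type*} [CommRing R] (u v : Fin 2 → R) : R := u 0 * v 1 - u 1 * v 0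

/-- The Plücker coordinate `Δ_{pq} = det (v_p, v_q)`. -/
def plucker {R : Type*} [CommRing R] {k : ℕ} (z : Fin k → R) (p q : ℕ) : R :=
  det₂ (vec z p) (vec z q)

/-- The open subset `{Δ_{ij} ≠ 0}` of `X(σᵏ)`. -/
def cutLocus (k i j : ℕ) : Set (Fin k → ℂ) :=
  {z | z ∈ braidVariety k ∧ plucker z i j ≠ 0}

/-! ### The diagonal cut -/

/-- The matrix `(v₁ … v_n)` brought by the left action of `GL₂` to the form with first column
`(1, 0)`, second column `(*, 1)` and last column `(0, *)`. -/
def standardForm (n : ℕ) (v : ℕ → Fin 2 → ℂ) (m : ℕ) : Fin 2 → ℂ :=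
  ![det₂ (v m) (v n) / det₂ (v 1) (v n), det₂ (v 1) (v m) / det₂ (v 1) (v 2)]

/-- The rescaling of `v₃, v₄, …` which turns all `Δ_{m,m+1}` into `1` (when `Δ₁₂ = 1`). -/
def rescale (v : ℕ → Fin 2 → ℂ) (m : ℕ) : Fin 2 → ℂ :=
  (∏ l ∈ Finset.Ico 2 m, det₂ (v l) (v (l + 1)) ^ ((-1 : ℤ) ^ (m - l))) • v m

/-- The parameters `z₁, …, z_k` with `B(z₁) ⋯ B(z_m) = (v_{m+1}, -v_m)`, when `v₁ = (1, 0)` and all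
`Δ_{m,m+1} = 1`: here `v₂ = (z₁, 1)` and `v_{m+1} = z_m v_m - v_{m-1}`,
so that `z_m = det (v_{m-1}, v_{m+1})`. -/
def parameters (k : ℕ) (v : ℕ → Fin 2 → ℂ) (l : Fin k) : ℂ :=
  if (l : ℕ) = 0 then v 2 0 else det₂ (v (l : ℕ)) (v ((l : ℕ) + 2))

/-- The point of `X(σᵏ)` attached to a `2 × (k+1)` matrix `(v₁ … v_{k+1})` whose cyclically
consecutive minors do not vanish: normalise the matrix, then read off the parameters. -/
def toBraid (k : ℕ) (v : ℕ → Fin 2 → ℂ) : Fin k → ℂ :=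
  parameters k (rescale (standardForm (k + 1) v))

/-- The diagonal `D_{ij}`, `j = i + a`, cuts the `(a+b)`-gon into an `(a+1)`-gon with vertices
`i, …, j` and a `(b+1)`-gon with vertices `1, …, i, j, …, a + b`. The `m`-th vertex of the
first one: -/
def vertexA (i m : ℕ) : ℕ := m + i - 1

/-- The `m`-th vertex of the second polygon. -/
def vertexB (a i m : ℕ) : ℕ := if m ≤ i then m else m + a - 1

/-- The first component of the cut: the point of `X(σᵃ)` attached to `(v_i … v_j)`. -/
def cutA (a b i : ℕ) (z : Fin (a + b - 1) → ℂ) : Fin a → ℂ :=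
  toBraid a fun m => vec z (vertexA i m)

/-- The second component of the cut: the point of `X(σᵇ)` attached to
`(v₁ … v_i v_j … v_{a+b})`. -/
def cutB (a b i : ℕ) (z : Fin (a + b - 1) → ℂ) : Fin b → ℂ :=
  toBraid b fun m => vec z (vertexB a i m)

/-- The matrix `V₂ = (v₁ … v_i v_j … v_{a+b})` recovered from the matrix `V₂'` of `y ∈ X(σᵇ)`
and the value `d` of `Δ_{ij}`, by undoing the normalisation. -/
def unscale (i : ℕ) {b : ℕ} (y : Fin b → ℂ) (d : ℂ) (m : ℕ) : Fin 2 → ℂ :=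
  if i = 1 then
    (if m ≤ 2 ∨ Even m then (1 : ℂ) else d⁻¹) • ![vec y m 0, d * vec y m 1]
  else if m ≤ i then vec y m else d ^ ((-1 : ℤ) ^ (m - i - 1)) • vec y m

/-- Insert the matrix `V₁` of `x ∈ X(σᵃ)` into `V₂`, after the row operations which match its first
and last columns `(1, 0)`, `(0, Δ_{1,a+1})` with the columns `v_i`, `v_j` of `V₂`. -/
def glueVec (i : ℕ) {a b : ℕ} (x : Fin a → ℂ) (y : Fin b → ℂ) (m : ℕ) : Fin 2 → ℂ :=
  let d : ℂ := plucker x 1 (a + 1)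
  let V₂ : ℕ → Fin 2 → ℂ := unscale i y d
  if m < i then V₂ m
  else if m ≤ i + a then
    vec x (m + 1 - i) 0 • V₂ i + (vec x (m + 1 - i) 1 / d) • V₂ (i + 1)
  else V₂ (m + 1 - a)

/-- The formula for `Φ_{ij} : X(σᵃ) × X(σᵇ) → X(σ^{a+b-1})`, `j = i + a`. -/
def glue (a b i : ℕ) (x : Fin a → ℂ) (y : Fin b → ℂ) : Fin (a + b - 1) → ℂ :=
  parameters (a + b - 1) (glueVec i x y)

/-! ### Rings of regular functions -/

/-- `ℂ[{Δ_{ij} ≠ 0}]`: the functions on the principal open subset `{Δ_{ij} ≠ 0}` of `X(σᵏ)` that are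
polynomials in the coordinates and `1 / Δ_{ij}`. -/
def cutLocusRing (k i j : ℕ) : Subalgebra ℂ (cutLocus k i j → ℂ) :=
  Algebra.adjoin ℂ
    (Set.range (fun (l : Fin k) (z : cutLocus k i j) => z.1 l) ∪ {fun z => (plucker z.1 i j)⁻¹})

/-- The coordinates `z₁, …, z_k` on `{Δ_{ij} ≠ 0}`. -/
def cutLocusCoord (k i j : ℕ) (l : Fin k) : cutLocusRing k i j :=
  ⟨fun z => z.1 l, Algebra.subset_adjoin (Or.inl ⟨l, rfl⟩)⟩

/-- `ℂ[X(σᵃ) × X(σᵇ)]`: the polynomial functions. -/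
def productRing (a b : ℕ) : Subalgebra ℂ (braidVariety a × braidVariety b → ℂ) :=
  Algebra.adjoin ℂ
    (Set.range (fun (l : Fin a) (p : braidVariety a × braidVariety b) => p.1.1 l) ∪
      Set.range (fun (l : Fin b) (p : braidVariety a × braidVariety b) => p.2.1 l))

/-- The coordinates of the first factor of `X(σᵃ) × X(σᵇ)`. -/
def productCoordA (a b : ℕ) (l : Fin a) : productRing a b :=
  ⟨fun p => p.1.1 l, Algebra.subset_adjoin (Or.inl ⟨l, rfl⟩)⟩

/-- The coordinates of the second factor of `X(σᵃ) × X(σᵇ)`. -/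
def productCoordB (a b : ℕ) (l : Fin b) : productRing a b :=
  ⟨fun p => p.2.1 l, Algebra.subset_adjoin (Or.inr ⟨l, rfl⟩)⟩

/-! ### Seeds, mutations, cluster structures -/

/-- Seed data in a field `K`, labelled by `I`: the variables `A_i`, which of them are frozen, and a
skew-symmetric exchange matrix `ε` (`ε i j` is the number of arrows from `i` to `j` minus the number
of arrows from `j` to `i`). -/
structure Seed (I K : Type*) where
  var : I → K
  frozen : Set I
  ε : I → I → ℤ
  skew : ∀ i j, ε i j = -ε j i

namespace Seed

variable {I J K L : Type*}

/-- Transport of a seed along a homomorphism of fields. -/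
def map [Field K] [Field L] (f : K →+* L) (s : Seed I K) : Seed I L where
  var i := f (s.var i)
  frozen := s.frozen
  ε := s.ε
  skew := s.skew

/-- Transport of a seed of rational functions along an isomorphism `A ≃ B` of rings of regular
functions, extended to the fields of fractions. -/
def transport {A B : Type*} [CommRing A] [IsDomain A] [Algebra ℂ A] [CommRing B] [IsDomain B]
    [Algebra ℂ B] (φ : A ≃ₐ[ℂ] B) (s : Seed I (FractionRing A)) : Seed I (FractionRing B) :=
  s.map ((IsFractionRing.algEquivOfAlgEquiv φ : FractionRing A ≃ₐ[ℂ] FractionRing B) :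
    FractionRing A →+* FractionRing B)

/-- The seed in which the variables labelled by `S` are moreover declared frozen. -/
def freeze (s : Seed I K) (S : Set I) : Seed I K where
  var := s.var
  frozen := s.frozen ∪ S
  ε := s.ε
  skew := s.skew

/-- The union of two seeds, with no arrows between them. -/
def sum (s : Seed I K) (t : Seed J K) : Seed (I ⊕ J) K where
  var := Sum.elim s.var t.var
  frozen := Sum.inl '' s.frozen ∪ Sum.inr '' t.frozen
  ε := Sum.elim (fun i => Sum.elim (s.ε i) 0) (fun j => Sum.elim 0 (t.ε j))
  skew := by
    rintro (i | i) (j | j)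
    · exact s.skew i j
    · simp
    · simp
    · exact t.skew i j

variable [Fintype I] [DecidableEq I] [Field K]

/-- The mutation `μ_k`. -/
def mutate (s : Seed I K) (k : I) : Seed I K where
  var := Function.update s.var k
    ((∏ i, s.var i ^ (s.ε k i).toNat + ∏ i, s.var i ^ (-s.ε k i).toNat) / s.var k)
  frozen := s.frozen
  ε i j :=
    if i = k ∨ j = k then -s.ε i j
    else s.ε i j + max (s.ε i k) 0 * max (s.ε k j) 0 - max (s.ε j k) 0 * max (s.ε k i) 0
  skew i j := by
    by_cases h : i = k ∨ j = k
    · rw [if_pos h, if_pos h.symm, s.skew i j]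
    · rw [if_neg h, if_neg fun h' => h h'.symm, s.skew i j]
      ring

/-- Successive mutations at the labels in a list. -/
def mutateList (s : Seed I K) (l : List I) : Seed I K := l.foldl mutate s

/-- The lists of mutable labels. -/
def MutableList (s : Seed I K) (l : List I) : Prop := ∀ k ∈ l, k ∉ s.frozen

/-- The group `𝐏` of Laurent monomials in the frozen variables. -/
def frozenMonomials (s : Seed I K) : Set K :=
  {x | ∃ n : I → ℤ, (∀ i, i ∉ s.frozen → n i = 0) ∧ x = ∏ i, s.var i ^ n i}

/-- The exchange ratio at `k`, that is the ratio of the two terms of the exchange relation. -/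
def exchangeRatio (s : Seed I K) (k : I) : K :=
  (∏ i, s.var i ^ (s.ε k i).toNat) / ∏ i, s.var i ^ (-s.ε k i).toNat

/-- Quasi-equivalence of seeds: the groups of frozen monomials coincide, corresponding mutable
variables are proportional up to frozen monomials, and corresponding exchange ratios coincide. -/
structure QuasiEquiv (s t : Seed I K) : Prop where
  frozen_eq : s.frozen = t.frozen
  monomials : s.frozenMonomials = t.frozenMonomials
  proportional : ∀ i, i ∉ s.frozen → ∃ M ∈ s.frozenMonomials, s.var i = M * t.var i
  ratios : ∀ i, i ∉ s.frozen → s.exchangeRatio i = t.exchangeRatio i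

/-- Quasi-equivalence of the cluster structures generated by two seeds: all corresponding seeds,
obtained by the same mutations, are quasi-equivalent. -/
def ClusterQuasiEquiv (s t : Seed I K) : Prop :=
  ∀ l : List I, s.MutableList l → QuasiEquiv (s.mutateList l) (t.mutateList l)

/-- `s` defines a cluster structure on an affine variety `V` with ring of regular functions `A` and
field of rational functions `K`. For every seed obtained from `s` by mutations:
* the variables are algebraically independent and generate the field `ℂ(V)`;
* they are regular on `V`, and the frozen ones vanish nowhere;
* the open subset of `V` where all the variables are nonzero is a torus with these variables as
  coordinates (all regular functions on `V` are Laurent polynomials in the variables).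
Moreover `ℂ[V]` is generated by all the cluster variables in all these seeds, and the inverses
of the frozen ones. -/
structure IsClusterStructure (A : Type*) [CommRing A] [Algebra ℂ A] [Algebra ℂ K] [Algebra A K]
    (s : Seed I K) : Prop where
  independent : ∀ l, s.MutableList l → AlgebraicIndependent ℂ (s.mutateList l).var
  generates_field : ∀ l, s.MutableList l →
    IntermediateField.adjoin ℂ (Set.range (s.mutateList l).var) = ⊤
  regular : ∀ l, s.MutableList l → ∀ i, ∃ f : A, algebraMap A K f = (s.mutateList l).var i
  frozen_unit : ∀ i ∈ s.frozen, ∃ f : A, IsUnit f ∧ algebraMap A K f = s.var i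
  chart : ∀ l, s.MutableList l → ∀ f : A, algebraMap A K f ∈ Algebra.adjoin ℂ
    (Set.range (s.mutateList l).var ∪ Set.range fun i => ((s.mutateList l).var i)⁻¹)
  generated : ∀ f : A, algebraMap A K f ∈ Algebra.adjoin ℂ
    ({x | ∃ l, s.MutableList l ∧ ∃ i, x = (s.mutateList l).var i} ∪
      {x | ∃ i ∈ s.frozen, x = (s.var i)⁻¹})

end Seed

/-! ### Triangulations and their seeds -/

/-- `e = (p, q)`, `p < q`, is a diagonal of the `n`-gon with vertices `1, …, n`. -/
def IsDiagonal (n : ℕ) (e : ℕ × ℕ) : Prop :=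
  1 ≤ e.1 ∧ e.1 + 2 ≤ e.2 ∧ e.2 ≤ n ∧ e ≠ (1, n)

/-- The two edges cross in their interiors. -/
def Crosses (e f : ℕ × ℕ) : Prop :=
  (e.1 < f.1 ∧ f.1 < e.2 ∧ e.2 < f.2) ∨ (f.1 < e.1 ∧ e.1 < f.2 ∧ f.2 < e.2)

/-- `edge` labels by `I` the edge `(1, n)` and the diagonals of a triangulation of the `n`-gon, a
maximal set of pairwise noncrossing diagonals. The sides `(m, m+1)` are not labelled. -/
structure IsTriangulation {I : Type*} (n : ℕ) (edge : I → ℕ × ℕ) : Prop where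
  injective : Function.Injective edge
  outer : ∃ l, edge l = (1, n)
  diagonal : ∀ l, edge l = (1, n) ∨ IsDiagonal n (edge l)
  noncrossing : ∀ l m, ¬ Crosses (edge l) (edge m)
  maximal : ∀ e, IsDiagonal n e → (∀ l, ¬ Crosses e (edge l)) → ∃ l, edge l = e

/-- `(p, q)` is a side `(m, m+1)` of the polygon or a labelled edge. -/
def IsEdge {I : Type*} (edge : I → ℕ × ℕ) (p q : ℕ) : Prop :=
  q = p + 1 ∨ ∃ l, edge l = (p, q)

/-- In some triangle `p < q < r` of the triangulation of the `n`-gon, the edge `f` follows the edge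
`e` in clockwise order `pq → qr → rp → pq`. -/
def Arrow {I : Type*} (n : ℕ) (edge : I → ℕ × ℕ) (e f : ℕ × ℕ) : Prop :=
  ∃ p q r : ℕ, 1 ≤ p ∧ p < q ∧ q < r ∧ r ≤ n ∧
    IsEdge edge p q ∧ IsEdge edge q r ∧ IsEdge edge p r ∧
    ((e = (p, q) ∧ f = (q, r)) ∨ (e = (q, r) ∧ f = (p, r)) ∨ (e = (p, r) ∧ f = (p, q)))

open Classical in
/-- The seed of a triangulation of the `(k+1)`-gon, for the braid variety `X(σᵏ)` with coordinates
`z`: the variables are the Plücker coordinates of the labelled edges, the one of `(1, k+1)` is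
frozen, and the quiver joins the edges of each triangle in clockwise order (two edges lie in at most
one common triangle). The sides `(m, m+1)`, with `Δ_{m,m+1} = 1`, are omitted. -/
def triangulationSeed {I K : Type*} [Field K] {k : ℕ} (z : Fin k → K) (edge : I → ℕ × ℕ) :
    Seed I K where
  var l := plucker z (edge l).1 (edge l).2
  frozen := {l | edge l = (1, k + 1)}
  ε l m := (if Arrow (k + 1) edge (edge l) (edge m) then 1 else 0) -
    (if Arrow (k + 1) edge (edge m) (edge l) then 1 else 0)
  skew l m := by ring

/-- The edges of triangulations of the two polygons cut out by `D_{ij}`, `j = i + a`, as edges of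
the `(a+b)`-gon. The outer edge `(1, a+1)` of the first polygon becomes `D_{ij}`, and the outer edge
`(1, b+1)` of the second one becomes `(1, a+b)`. -/
def glueEdges {I J : Type*} (a i : ℕ) (edgeA : I → ℕ × ℕ) (edgeB : J → ℕ × ℕ) :
    I ⊕ J → ℕ × ℕ :=
  Sum.elim (fun l => (vertexA i (edgeA l).1, vertexA i (edgeA l).2))
    (fun l => (vertexB a i (edgeB l).1, vertexB a i (edgeB l).2))

variable {I J : Type*}

/-- The seed on `{Δ_{ij} ≠ 0}`, `j = i + a`, obtained from the seed of `X(σ^{a+b-1})` attached to a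
glued triangulation by freezing the variable `Δ_{ij}`. -/
def cutSeed (a b i : ℕ) [IsDomain (cutLocusRing (a + b - 1) i (i + a))]
    (edgeA : I → ℕ × ℕ) (edgeB : J → ℕ × ℕ) :
    Seed (I ⊕ J) (FractionRing (cutLocusRing (a + b - 1) i (i + a))) :=
  (triangulationSeed
    (fun l => algebraMap _ (FractionRing (cutLocusRing (a + b - 1) i (i + a)))
      (cutLocusCoord (a + b - 1) i (i + a) l))
    (glueEdges a i edgeA edgeB)).freeze {l | glueEdges a i edgeA edgeB l = (i, i + a)}

/-- The product seed on `X(σᵃ) × X(σᵇ)`. -/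
def productSeed (a b : ℕ) [IsDomain (productRing a b)]
    (edgeA : I → ℕ × ℕ) (edgeB : J → ℕ × ℕ) : Seed (I ⊕ J) (FractionRing (productRing a b)) :=
  (triangulationSeed
    (fun l => algebraMap _ (FractionRing (productRing a b)) (productCoordA a b l)) edgeA).sum
  (triangulationSeed
    (fun l => algebraMap _ (FractionRing (productRing a b)) (productCoordB a b l)) edgeB)

end TwoStrand

end

/-! A point of `X(σᵏ)` amounts to a chain of plane vectors with consecutive determinants 1, starting
at `(1, 0)` and ending on the second axis. The three-term recurrence `vec_add_three` recovers the
coordinates from the chain (`vec_eq_of_consecutive`), so everything becomes a statement about `2 ×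
2` minors.

If `d = Δ_{ij}` is nonzero, then `v_i, v_j` is a basis. The vectors between them are recorded by
their coordinates in this basis, that is by `V₁`, and the remaining ones by `V₂`. Gluing keeps the
minors of `V₁` and multiplies the minor `Δ_{pq}` of the normalised `V₂` by `d ^ (c_p + c_q + s)`,
where `c` depends on the column and `s` only on `i` (`plucker_glue_A`, `plucker_glue_B`). On `X(σᵏ)`
one has `Δ_{1,k+1} · (v_k)₀ = 1`, so inverting `d` costs nothing on the product, and both directions
are regular. Irreducibility holds because the last coordinate of each factor is a fraction of
polynomials in the others: regular functions on the product are fractions of polynomials in free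
coordinates, which also bounds the dimension from below.

Flips of triangulations are mutations (`triangulationSeed_mutate`): the Plücker relation is the
exchange relation, and the quiver around a quadrilateral turns by one step. Since `D_{ij}` is
frozen, a sequence of mutations flips the two parts separately, in parallel for the glued and the
product seed (`exists_mutateList_eq`), so quasi-equivalence need only be checked for pairs of
triangulations. There the variables differ by powers of the frozen variable `d`. In an exchange
ratio each vertex of the quadrilateral occurs once in the numerator and once in the denominator, so
all powers of `d` cancel.

The product seed defines a cluster structure because crossings can be resolved one by one (the
Laurent phenomenon `IsTriangulation.plucker_mem`), every diagonal is reached by flips, and the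
number of variables does not exceed the transcendence degree: a generating family of that size is
algebraically independent. The structure passes to the pullback of the cut seed by quasi-equivalence
(`Seed.IsClusterStructure.of_clusterQuasiEquiv`), and from there to `{Δ_{ij} ≠ 0}` along the
isomorphism of rings. -/

namespace TwoStrand

/-! ### Recurrence and minors of the vectors of a braid. -/

section Vectors

variable {R : Type*} [CommRing R]

theorem prod_take_braidMatrix_mulVec {k : ℕ} (z : Fin k → R) (m : ℕ) (hm : m < k) :
    (((List.ofFn z).take (m + 1)).map braidMatrix).prod =
      (((List.ofFn z).take m).map braidMatrix).prod * braidMatrix (z ⟨m, hm⟩) := by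
  rw [List.take_succ_eq_append_getElem (by simpa using hm), List.map_append, List.prod_append]
  simp

theorem vec_one {k : ℕ} (z : Fin k → R) : vec z 1 = ![1, 0] := by
  simp [vec]

theorem vec_two {k : ℕ} (z : Fin k → R) (hk : 0 < k) : vec z 2 = ![z ⟨0, hk⟩, 1] := by
  have h := prod_take_braidMatrix_mulVec z 0 hk
  rw [vec, show 2 - 1 = 0 + 1 from rfl, h]
  ext s
  fin_cases s <;> simp [braidMatrix, Matrix.mulVec, dotProduct]

/-- Because `B(z)` sends the second basis vector to minus the first, the second column of each
partial product is minus the previous vector of the chain. -/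
theorem prod_take_mulVec_right {k : ℕ} (z : Fin k → R) (m : ℕ) (hm : m < k) :
    (((List.ofFn z).take (m + 1)).map braidMatrix).prod.mulVec ![0, 1] = -vec z (m + 1) := by
  rw [prod_take_braidMatrix_mulVec z m hm, ← Matrix.mulVec_mulVec]
  have : (braidMatrix (z ⟨m, hm⟩)).mulVec ![0, 1] = -![1, 0] := by
    ext s; fin_cases s <;> simp [braidMatrix, Matrix.mulVec, dotProduct]
  rw [this, Matrix.mulVec_neg]
  simp [vec]

/-- `B(z)(1,0)ᵀ = z(1,0)ᵀ + (0,1)ᵀ`; applying the earlier partial product to the two summands gives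
the last two vectors of the chain. -/
theorem vec_add_three {k : ℕ} (z : Fin k → R) (m : ℕ) (hm : m + 1 < k) :
    vec z (m + 3) = z ⟨m + 1, hm⟩ • vec z (m + 2) - vec z (m + 1) := by
  have h1 := prod_take_mulVec_right z m (by omega)
  have h2 : (braidMatrix (z ⟨m + 1, hm⟩)).mulVec ![1, 0] =
      z ⟨m + 1, hm⟩ • ![1, 0] + ![0, 1] := by
    ext s; fin_cases s <;> simp [braidMatrix, Matrix.mulVec, dotProduct]
  have h3 : vec z (m + 3) = ((((List.ofFn z).take (m + 1 + 1)).map braidMatrix).prod).mulVec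
      ![1, 0] := by
    simp [vec]
  rw [h3, prod_take_braidMatrix_mulVec z (m + 1) hm, ← Matrix.mulVec_mulVec, h2,
    Matrix.mulVec_add, Matrix.mulVec_smul, h1, sub_eq_add_neg]
  simp [vec]

/-- The entries are universal polynomials in the coordinates. This moves identities between
polynomials, regular functions, their values at points and rational functions. -/
theorem vec_map {S : Type*} [CommRing S] (f : R →+* S) {k : ℕ} (z : Fin k → R) (m : ℕ)
    (s : Fin 2) : vec (fun l => f (z l)) m s = f (vec z m s) := by
  have key : ∀ n ≤ k, (((List.ofFn fun l => f (z l)).take n).map braidMatrix).prod =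
      f.mapMatrix (((List.ofFn z).take n).map braidMatrix).prod := by
    intro n
    induction n with
    | zero => simp
    | succ n ih =>
      intro hn
      rw [prod_take_braidMatrix_mulVec _ n hn, prod_take_braidMatrix_mulVec _ n hn, map_mul,
        ih (by omega)]
      congr 1
      ext p q; fin_cases p <;> fin_cases q <;> simp [braidMatrix]
  have key' : ∀ n, (((List.ofFn fun l => f (z l)).take n).map braidMatrix).prod =
      f.mapMatrix (((List.ofFn z).take n).map braidMatrix).prod := by
    intro n
    rcases le_total n k with h | h
    -- Beyond the length of the list, `take` returns the whole list, so only prefixes of length at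
    -- most `k` matter.
    · exact key n h
    · have := key k le_rfl
      rw [List.take_of_length_le (by simp), List.take_of_length_le (by simp)] at this
      rwa [List.take_of_length_le (by simpa using h), List.take_of_length_le (by simpa using h)]
  unfold vec
  rw [key']
  fin_cases s <;> simp [Matrix.mulVec, dotProduct]

theorem plucker_map {S : Type*} [CommRing S] (f : R →+* S) {k : ℕ} (z : Fin k → R) (p q : ℕ) :
    plucker (fun l => f (z l)) p q = f (plucker z p q) := by
  simp [plucker, det₂, vec_map]

theorem plucker_consecutive {k : ℕ} (z : Fin k → R) (m : ℕ) (h1 : 1 ≤ m) (hm : m ≤ k) :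
    plucker z m (m + 1) = 1 := by
  induction m, h1 using Nat.le_induction with
  | base => simp [plucker, det₂, vec_one, vec_two z hm]
  | succ m h1 ih =>
    obtain ⟨m, rfl⟩ : ∃ n, m = n + 1 := ⟨m - 1, by omega⟩
    have := ih (by omega)
    simp only [plucker, det₂] at this ⊢
    rw [vec_add_three z m (by omega)]
    simp only [Pi.sub_apply, Pi.smul_apply, smul_eq_mul]
    linear_combination this

/-- The three-term relation, the source of every exchange relation below. -/
theorem det₂_plucker_relation (u v w x : Fin 2 → R) :
    det₂ u w * det₂ v x = det₂ u v * det₂ w x + det₂ u x * det₂ v w := by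
  simp only [det₂]; ring

theorem plucker_relation {k : ℕ} (z : Fin k → R) (p q r s : ℕ) :
    plucker z p r * plucker z q s =
      plucker z p q * plucker z r s + plucker z p s * plucker z q r :=
  det₂_plucker_relation _ _ _ _

/-- All coordinates but the first are minors of short diagonals, which is why minors generate the
ring of regular functions. -/
theorem coord_succ_eq_plucker {k : ℕ} (z : Fin k → R) (m : ℕ) (hm : m + 1 < k) :
    z ⟨m + 1, hm⟩ = plucker z (m + 1) (m + 3) := by
  have := plucker_consecutive z (m + 1) (by omega) (by omega)
  simp only [plucker, det₂] at this ⊢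
  rw [vec_add_three z m hm]
  simp only [Pi.sub_apply, Pi.smul_apply, smul_eq_mul]
  linear_combination (-z ⟨m + 1, hm⟩) * this

theorem plucker_one_left {k : ℕ} (z : Fin k → R) (m : ℕ) : plucker z 1 m = vec z m 1 := by
  simp [plucker, det₂, vec_one]

/-- When `v_{k+1}` lies on the second axis, `Δ_{k,k+1} = 1` becomes this product. The frozen
variable is thus a unit with polynomial inverse `(v_k)₀`. -/
theorem plucker_one_last_mul {k : ℕ} (hk : 1 ≤ k) (z : Fin k → R) (h0 : vec z (k + 1) 0 = 0) :
    plucker z 1 (k + 1) * vec z k 0 = 1 := by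
  have := plucker_consecutive z k hk le_rfl
  rw [plucker_one_left]
  simp only [plucker, det₂, h0] at this
  linear_combination this

/-- The first coordinate is not itself a minor; it becomes one after multiplication by the frozen
variable. -/
theorem coord_zero_mul_plucker {k : ℕ} (hk : 1 ≤ k) (z : Fin k → R) (h0 : vec z (k + 1) 0 = 0) :
    z ⟨0, hk⟩ * plucker z 1 (k + 1) = plucker z 2 (k + 1) := by
  rw [plucker_one_left]
  simp [plucker, det₂, vec_two z hk, h0]

/-- A sequence of vectors with `v₁ = (1, 0)` and consecutive determinants `1` is the sequence
attached to its parameters. -/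
theorem vec_eq_of_consecutive {k : ℕ} (z : Fin k → R) (v : ℕ → Fin 2 → R) (h1 : v 1 = ![1, 0])
    (hd : ∀ m, 1 ≤ m → m ≤ k → det₂ (v m) (v (m + 1)) = 1)
    (hz0 : ∀ h : 0 < k, z ⟨0, h⟩ = v 2 0)
    (hz : ∀ m (h : m + 1 < k), z ⟨m + 1, h⟩ = det₂ (v (m + 1)) (v (m + 3)))
    (m : ℕ) (hm : 1 ≤ m) (hmk : m ≤ k + 1) : vec z m = v m := by
  induction m using Nat.strong_induction_on with
  | _ m ih =>
    match m, hm with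
    | 1, _ => rw [vec_one, h1]
    | 2, _ =>
      have := hd 1 le_rfl (by omega)
      rw [vec_two z (by omega), hz0]
      ext s
      fin_cases s
      · rfl
      · simp [det₂, h1] at this
        simp [this]
    | m + 3, _ =>
      rw [vec_add_three z m (by omega), ih (m + 2) (by omega) (by omega) (by omega),
        ih (m + 1) (by omega) (by omega) (by omega), hz]
      -- Cramer's rule: the two consecutive determinants are 1, so `v_{m+3}` equals `det (v_{m+1},
      -- v_{m+3}) v_{m+2} - v_{m+1}`.
      have e1 := hd (m + 1) (by omega) (by omega)
      have e2 := hd (m + 2) (by omega) (by omega)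
      simp only [det₂] at e1 e2 ⊢
      ext s
      fin_cases s
      · simp only [Fin.zero_eta, Fin.isValue, Pi.sub_apply, Pi.smul_apply, smul_eq_mul]
        linear_combination (v (m+3) 0) * e1 + (-v (m+1) 0) * (-1 : R) * e2
      · simp only [Fin.mk_one, Fin.isValue, Pi.sub_apply, Pi.smul_apply, smul_eq_mul]
        linear_combination (v (m+3) 1) * e1 + (v (m+1) 1) * e2

end Vectors

/-! ### Parameters of a chain of vectors, and membership in the braid variety. -/

theorem parameters_zero {k : ℕ} (v : ℕ → Fin 2 → ℂ) (h : 0 < k) :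
    parameters k v ⟨0, h⟩ = v 2 0 := by
  simp [parameters]

theorem parameters_succ {k : ℕ} (v : ℕ → Fin 2 → ℂ) (m : ℕ) (h : m + 1 < k) :
    parameters k v ⟨m + 1, h⟩ = det₂ (v (m + 1)) (v (m + 3)) := by
  simp [parameters]

theorem vec_parameters {k : ℕ} (v : ℕ → Fin 2 → ℂ) (h1 : v 1 = ![1, 0])
    (hd : ∀ m, 1 ≤ m → m ≤ k → det₂ (v m) (v (m + 1)) = 1)
    (m : ℕ) (hm : 1 ≤ m) (hmk : m ≤ k + 1) : vec (parameters k v) m = v m :=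
  vec_eq_of_consecutive _ v h1 hd (parameters_zero v) (parameters_succ v) m hm hmk

theorem parameters_eq_of_vec {k : ℕ} (z : Fin k → ℂ) (v : ℕ → Fin 2 → ℂ)
    (h : ∀ m, 1 ≤ m → m ≤ k + 1 → v m = vec z m) : parameters k v = z := by
  funext ⟨l, hl⟩
  cases l with
  | zero => rw [parameters_zero, h 2 (by omega) (by omega), vec_two z hl]; rfl
  | succ l =>
    rw [parameters_succ, h _ (by omega) (by omega), h _ (by omega) (by omega),
      coord_succ_eq_plucker z l hl]
    rfl

/-- The rotation on the left moves the first row of the product to the second row, so the lower left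
entry is the first entry of the last vector. -/
theorem mem_braidVariety_iff {k : ℕ} (z : Fin k → ℂ) :
    z ∈ braidVariety k ↔ vec z (k + 1) 0 = 0 := by
  have h : (List.ofFn fun l => braidMatrix (z l)).prod =
      (((List.ofFn z).take (k + 1 - 1)).map braidMatrix).prod := by
    rw [List.take_of_length_le (by simp), List.map_ofFn]; rfl
  simp only [braidVariety, Set.mem_ofPred_eq, h, vec]
  generalize (((List.ofFn z).take (k + 1 - 1)).map braidMatrix).prod = P
  constructor
  · intro H
    have := H (show id (0 : Fin 2) < id 1 by decide)
    simpa [Matrix.mul_apply, Matrix.mulVec, dotProduct] using this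
  · intro H p q hpq
    have : p = 1 ∧ q = 0 := by
      revert p q; decide
    obtain ⟨rfl, rfl⟩ := this
    simpa [Matrix.mul_apply, Matrix.mulVec, dotProduct] using H

theorem plucker_one_last_ne_zero {k : ℕ} (hk : 1 ≤ k) {z : Fin k → ℂ} (hz : z ∈ braidVariety k) :
    plucker z 1 (k + 1) ≠ 0 :=
  left_ne_zero_of_mul_eq_one (plucker_one_last_mul hk z ((mem_braidVariety_iff z).1 hz))

theorem inv_plucker_one_last {k : ℕ} (hk : 1 ≤ k) {z : Fin k → ℂ} (hz : z ∈ braidVariety k) :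
    (plucker z 1 (k + 1))⁻¹ = vec z k 0 :=
  inv_eq_of_mul_eq_one_right (plucker_one_last_mul hk z ((mem_braidVariety_iff z).1 hz))

/-- There is a point of the braid variety at which `Δ_{pq} = q - p`. -/
theorem exists_mem_braidVariety_plucker (k : ℕ) (hk : 1 ≤ k) :
    ∃ z ∈ braidVariety k, ∀ p q, 1 ≤ p → p ≤ k + 1 → 1 ≤ q → q ≤ k + 1 →
      plucker z p q = (q : ℂ) - p := by
  have hk' : (k : ℂ) ≠ 0 := by exact_mod_cast (by omega : k ≠ 0)
  -- Equally spaced points on the line from `(1, 0)` to `(0, k)`: the minors are differences of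
  -- indices, hence nonzero for distinct vertices.
  let v : ℕ → Fin 2 → ℂ := fun m => ![((k : ℂ) + 1 - m) / k, (m : ℂ) - 1]
  have hv : ∀ p q, det₂ (v p) (v q) = (q : ℂ) - p := by
    intro p q
    simp only [det₂, v, Matrix.cons_val_zero, Matrix.cons_val_one]
    field_simp
    ring
  have h1 : v 1 = ![1, 0] := by
    ext s; fin_cases s <;> simp [v, hk']
  have hd : ∀ m, 1 ≤ m → m ≤ k → det₂ (v m) (v (m + 1)) = 1 := by
    intro m _ _; rw [hv]; push_cast; ring
  have key := vec_parameters v h1 hd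
  refine ⟨parameters k v, ?_, ?_⟩
  · rw [mem_braidVariety_iff, key (k + 1) (by omega) le_rfl]
    simp [v]
  · intro p q hp hp' hq hq'
    rw [plucker, key p hp hp', key q hq hq', hv]

/-! ### Triangles and crossings in a triangulation. -/

section Triangulations

variable {I J : Type*} {n : ℕ} {edge : I → ℕ × ℕ}

theorem IsEdge.of_eq {l : I} {p q : ℕ} (h : edge l = (p, q)) : IsEdge edge p q := Or.inr ⟨l, h⟩

theorem IsEdge.exists_label {p q : ℕ} (h : IsEdge edge p q) (hpq : q ≠ p + 1) :
    ∃ l, edge l = (p, q) := h.resolve_left hpq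

theorem IsTriangulation.bounds (hT : IsTriangulation n edge) (hn : 3 ≤ n) {l : I} {p q : ℕ}
    (h : edge l = (p, q)) : 1 ≤ p ∧ p + 2 ≤ q ∧ q ≤ n := by
  rcases hT.diagonal l with h' | h'
  · rw [h, Prod.mk.injEq] at h'; omega
  · rw [h] at h'; exact ⟨h'.1, h'.2.1, h'.2.2.1⟩

/-- Edges and sides of a triangulation do not cross. -/
theorem IsTriangulation.not_crosses (hT : IsTriangulation n edge) {p q r s : ℕ}
    (h : IsEdge edge p q) (h' : IsEdge edge r s) : ¬ Crosses (p, q) (r, s) := by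
  rcases h with rfl | ⟨l, hl⟩
  · simp only [Crosses]; omega
  · rcases h' with rfl | ⟨m, hm⟩
    · simp only [Crosses]; omega
    · rw [← hl, ← hm]; exact hT.noncrossing l m

/-- Maximality in a uniform form, with the sides and the outer edge included. -/
theorem IsTriangulation.isEdge_of_forall (hT : IsTriangulation n edge) {p q : ℕ} (hp : 1 ≤ p)
    (hpq : p < q) (hq : q ≤ n) (h : ∀ x y, (∃ l, edge l = (x, y)) → ¬ Crosses (p, q) (x, y)) :
    IsEdge edge p q := by
  by_cases h1 : q = p + 1
  · exact Or.inl h1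
  right
  by_cases h2 : (p, q) = (1, n)
  · rw [h2]; exact hT.outer
  · exact hT.maximal (p, q) ⟨hp, by simp only; omega, hq, h2⟩ fun l => h _ _ ⟨l, rfl⟩

/-- Below each labelled edge there is a triangle. -/
theorem IsTriangulation.exists_middle (hT : IsTriangulation n edge) (hn : 3 ≤ n) {l : I} {p q : ℕ}
    (h : edge l = (p, q)) : ∃ r, p < r ∧ r < q ∧ IsEdge edge p r ∧ IsEdge edge r q := by
  classical
  have hb := hT.bounds hn h
  -- The third vertex is the last neighbour `r` of `p` before `q`. An edge crossing `(r, q)` crosses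
  -- neither `(p, q)` nor `(p, r)`, so it would start at `p` and end beyond `r`.
  let P : ℕ → Prop := fun r => p < r ∧ r < q ∧ IsEdge edge p r
  have hP : P (p + 1) := ⟨by omega, by omega, Or.inl rfl⟩
  have hr := Nat.findGreatest_spec (P := P) (n := q) (by omega) hP
  have hmax : ∀ s, P s → s ≤ Nat.findGreatest P q := fun s hs =>
    Nat.le_findGreatest hs.2.1.le hs
  generalize Nat.findGreatest P q = r at hr hmax
  refine ⟨r, hr.1, hr.2.1, hr.2.2, hT.isEdge_of_forall (by omega) hr.2.1 (by omega) ?_⟩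
  intro x y hxy hc
  have c1 := hT.not_crosses (IsEdge.of_eq h) (Or.inr hxy)
  have c2 := hT.not_crosses hr.2.2 (Or.inr hxy)
  simp only [Crosses] at hc c1 c2
  obtain rfl : x = p := by omega
  have := hmax y ⟨by omega, by omega, Or.inr hxy⟩
  omega

/-- Above each edge or side other than `(1, n)` there is a triangle. -/
theorem IsTriangulation.exists_above (hT : IsTriangulation n edge) (hn : 3 ≤ n) {p q : ℕ}
    (hp : 1 ≤ p) (hpq : p < q) (hq : q ≤ n) (h : IsEdge edge p q) (h1 : (p, q) ≠ (1, n)) :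
    (∃ r, 1 ≤ r ∧ r < p ∧ IsEdge edge r p ∧ IsEdge edge r q) ∨
      ∃ r, q < r ∧ r ≤ n ∧ IsEdge edge p r ∧ IsEdge edge q r := by
  classical
  -- A shortest labelled edge strictly above `(p, q)` is taken. The leg of its triangle lying above
  -- `(p, q)` is shorter, so it must be `(p, q)` itself.
  let P : ℕ → Prop := fun s => ∃ x y, (∃ l, edge l = (x, y)) ∧ x ≤ p ∧ q ≤ y ∧ (x, y) ≠ (p, q) ∧
    s = y - x
  have hP : ∃ s, P s := ⟨n - 1, 1, n, hT.outer, hp, hq, h1.symm, rfl⟩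
  obtain ⟨x, y, ⟨l, hl⟩, hx, hy, hne, hs⟩ := Nat.find_spec hP
  have hmin : ∀ x' y', IsEdge edge x' y' → x' ≤ p → q ≤ y' → y' - x' < y - x →
      (x', y') = (p, q) := by
    intro x' y' hxy' hx' hy' hlt
    by_contra hne'
    have hlab : ∃ l, edge l = (x', y') := hxy'.exists_label (by
      rintro rfl
      exact hne' (by rw [Prod.mk.injEq]; omega))
    exact Nat.find_min hP (hs ▸ hlt) ⟨x', y', hlab, hx', hy', hne', rfl⟩
  clear hs
  obtain ⟨r, hr1, hr2, hr3, hr4⟩ := hT.exists_middle hn hl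
  have hb := hT.bounds hn hl
  have c1 := hT.not_crosses h hr3
  have c2 := hT.not_crosses h hr4
  simp only [Crosses] at c1 c2
  simp only [Prod.mk.injEq, ne_eq, not_and] at hne
  rcases (by omega : r ≤ p ∨ q ≤ r) with hrp | hrq
  · have := hmin r y hr4 hrp hy (by omega)
    simp only [Prod.mk.injEq] at this
    obtain ⟨rfl, rfl⟩ := this
    exact Or.inl ⟨x, by omega, hr1, hr3, IsEdge.of_eq hl⟩
  · have := hmin x r hr3 hx hrq (by omega)
    simp only [Prod.mk.injEq] at this
    obtain ⟨rfl, rfl⟩ := this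
    exact Or.inr ⟨y, hr2, by omega, IsEdge.of_eq hl, hr4⟩

/-- A diagonal `(p, q)` which is not an edge of the triangulation crosses the edge opposite to `p`
in some triangle with vertex `p`. -/
theorem IsTriangulation.exists_crossing (hT : IsTriangulation n edge) (hn : 3 ≤ n) {p q : ℕ}
    (hp : 1 ≤ p) (hpq : p < q) (hq : q ≤ n) (h : ¬ IsEdge edge p q) :
    ∃ x, p < x ∧ x < q ∧ IsEdge edge p x ∧
      ((∃ r, q < r ∧ r ≤ n ∧ IsEdge edge p r ∧ IsEdge edge x r) ∨
        ∃ r, 1 ≤ r ∧ r < p ∧ IsEdge edge r p ∧ IsEdge edge r x) := by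
  classical
  have hside : q ≠ p + 1 := fun h' => h (Or.inl h')
  -- Again `x` is the last neighbour of `p` before `q`. If the triangle above `(p, x)` has its apex
  -- `r` to the right of `x`, maximality of `x` excludes `r < q`, and `r = q` would make `(p, q)` an
  -- edge.
  let P : ℕ → Prop := fun r => p < r ∧ r < q ∧ IsEdge edge p r
  have hP : P (p + 1) := ⟨by omega, by omega, Or.inl rfl⟩
  have hx := Nat.findGreatest_spec (P := P) (n := q) (by omega) hP
  have hmax : ∀ s, P s → s ≤ Nat.findGreatest P q := fun s hs =>
    Nat.le_findGreatest hs.2.1.le hs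
  generalize Nat.findGreatest P q = x at hx hmax
  refine ⟨x, hx.1, hx.2.1, hx.2.2, ?_⟩
  rcases hT.exists_above hn hp hx.1 (by omega) hx.2.2
    (by simp only [ne_eq, Prod.mk.injEq]; omega) with ⟨r, h1, h2, h3, h4⟩ | ⟨r, h1, h2, h3, h4⟩
  · exact Or.inr ⟨r, h1, h2, h3, h4⟩
  · refine Or.inl ⟨r, ?_, h2, h3, h4⟩
    by_contra hr
    rcases (by omega : r = q ∨ r < q) with rfl | hr
    · exact h h3
    · have := hmax r ⟨by omega, hr, h3⟩
      omega

/-- A triangulation of the `n`-gon has `n - 2` labelled edges. -/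
theorem IsTriangulation.card_eq [Fintype I] (hT : IsTriangulation n edge) (hn : 3 ≤ n) :
    Fintype.card I = n - 2 := by
  choose mid h1 h2 h3 h4 using fun l => hT.exists_middle hn (Prod.mk.eta (p := edge l)).symm
  -- Each labelled edge is matched with the middle vertex of the triangle below it, giving a
  -- bijection with the vertices strictly between `1` and `n`.
  let f : I → Finset.Ioo 1 n := fun l => ⟨mid l, by
    have := hT.bounds hn (Prod.mk.eta (p := edge l)).symm
    have := h1 l; have := h2 l
    rw [Finset.mem_Ioo]; omega⟩
  have hinj : Function.Injective f := by
    intro l m hlm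
    have hm : mid l = mid m := congrArg Subtype.val hlm
    have c1 := hT.not_crosses (IsEdge.of_eq (Prod.mk.eta (p := edge l)).symm) (h3 m)
    have c2 := hT.not_crosses (IsEdge.of_eq (Prod.mk.eta (p := edge l)).symm) (h4 m)
    have c3 := hT.not_crosses (IsEdge.of_eq (Prod.mk.eta (p := edge m)).symm) (h3 l)
    have c4 := hT.not_crosses (IsEdge.of_eq (Prod.mk.eta (p := edge m)).symm) (h4 l)
    have := h1 l; have := h2 l; have := h1 m; have := h2 m
    simp only [Crosses] at c1 c2 c3 c4
    apply hT.injective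
    apply Prod.ext <;> omega
  have hsurj : Function.Surjective f := by
    rintro ⟨r, hr⟩
    rw [Finset.mem_Ioo] at hr
    -- Descent from the outer edge: if `r` is not the middle vertex, it lies strictly under one of
    -- the two shorter legs.
    suffices ∀ s, ∀ l, (edge l).2 - (edge l).1 = s → (edge l).1 < r → r < (edge l).2 →
        ∃ m, mid m = r by
      obtain ⟨l, hl⟩ := hT.outer
      obtain ⟨m, hm⟩ := this _ l rfl (by rw [hl]; exact hr.1) (by rw [hl]; exact hr.2)
      exact ⟨m, Subtype.ext hm⟩
    intro s
    induction s using Nat.strong_induction_on with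
    | _ s ih =>
      intro l hs hl1 hl2
      have := h1 l; have := h2 l
      rcases lt_trichotomy (mid l) r with h | h | h
      · obtain ⟨m, hm⟩ := (h4 l).exists_label (by omega)
        exact ih _ (by rw [← hs, hm]; dsimp only; omega) m rfl (by rwa [hm])
          (by rwa [hm])
      · exact ⟨l, h⟩
      · obtain ⟨m, hm⟩ := (h3 l).exists_label (by omega)
        exact ih _ (by rw [← hs, hm]; dsimp only; omega) m rfl (by rwa [hm])
          (by rwa [hm])
  rw [Fintype.card_of_bijective ⟨hinj, hsurj⟩]
  simp
  omega

/-! ### Flips -/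

/-- `w < x < y < z` are the vertices of a quadrilateral with sides in the triangulation. -/
structure IsQuad (n : ℕ) (edge : I → ℕ × ℕ) (w x y z : ℕ) : Prop where
  one_le : 1 ≤ w
  lt₁ : w < x
  lt₂ : x < y
  lt₃ : y < z
  le : z ≤ n
  wx : IsEdge edge w x
  xy : IsEdge edge x y
  yz : IsEdge edge y z
  wz : IsEdge edge w z

/-- `edge'` is obtained from `edge` by flipping the diagonal with label `l`. -/
def IsFlip [DecidableEq I] (n : ℕ) (edge : I → ℕ × ℕ) (l : I) (edge' : I → ℕ × ℕ) : Prop :=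
  ∃ w x y z, IsQuad n edge w x y z ∧
    ((edge l = (w, y) ∧ edge' = Function.update edge l (x, z)) ∨
      (edge l = (x, z) ∧ edge' = Function.update edge l (w, y)))

/-- The triangles below and above a diagonal together form its quadrilateral. -/
theorem IsTriangulation.exists_quad (hT : IsTriangulation n edge) (hn : 3 ≤ n) {l : I}
    (hl : edge l ≠ (1, n)) :
    ∃ w x y z, IsQuad n edge w x y z ∧ (edge l = (w, y) ∨ edge l = (x, z)) := by
  rcases hpq : edge l with ⟨p, q⟩
  have hb := hT.bounds hn hpq
  obtain ⟨m, m1, m2, m3, m4⟩ := hT.exists_middle hn hpq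
  rw [hpq] at hl
  rcases hT.exists_above hn hb.1 (by omega) hb.2.2 (IsEdge.of_eq hpq) hl with
    ⟨r, h1, h2, h3, h4⟩ | ⟨r, h1, h2, h3, h4⟩
  · exact ⟨r, p, m, q, ⟨h1, h2, m1, m2, hb.2.2, h3, m3, m4, h4⟩, Or.inr rfl⟩
  · exact ⟨p, m, q, r, ⟨hb.1, m1, m2, h1, h2, m3, m4, h4, h3⟩, Or.inl rfl⟩

theorem IsTriangulation.exists_flip [DecidableEq I] (hT : IsTriangulation n edge) (hn : 3 ≤ n)
    {l : I} (hl : edge l ≠ (1, n)) : ∃ edge', IsFlip n edge l edge' := by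
  obtain ⟨w, x, y, z, hQ, h | h⟩ := hT.exists_quad hn hl
  · exact ⟨_, w, x, y, z, hQ, Or.inl ⟨h, rfl⟩⟩
  · exact ⟨_, w, x, y, z, hQ, Or.inr ⟨h, rfl⟩⟩

theorem isEdge_update [DecidableEq I] {l : I} {e : ℕ × ℕ} {p q : ℕ} (h : IsEdge edge p q)
    (hl : edge l ≠ (p, q)) : IsEdge (Function.update edge l e) p q := by
  rcases h with h | ⟨m, hm⟩
  · exact Or.inl h
  · refine Or.inr ⟨m, ?_⟩
    rw [Function.update_of_ne, hm]
    rintro rfl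
    exact hl hm

theorem IsQuad.update [DecidableEq I] {l : I} {e : ℕ × ℕ} {w x y z : ℕ} (h : IsQuad n edge w x y z)
    (hl : edge l = (w, y) ∨ edge l = (x, z)) :
    IsQuad n (Function.update edge l e) w x y z := by
  have h1 := h.lt₁; have h2 := h.lt₂; have h3 := h.lt₃
  refine ⟨h.one_le, h1, h2, h3, h.le, isEdge_update h.wx ?_, isEdge_update h.xy ?_,
    isEdge_update h.yz ?_, isEdge_update h.wz ?_⟩ <;>
  · rcases hl with hl | hl <;> rw [hl, ne_eq, Prod.mk.injEq] <;> omega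

/-- Replacing the diagonal of a quadrilateral by the other one gives a triangulation. -/
theorem IsTriangulation.update_of_crosses [DecidableEq I] (hT : IsTriangulation n edge) {l : I}
    {w x y z : ℕ} (hQ : IsQuad n edge w x y z) {e : ℕ × ℕ}
    (he : (edge l = (w, y) ∧ e = (x, z)) ∨ (edge l = (x, z) ∧ e = (w, y))) :
    IsTriangulation n (Function.update edge l e) := by
  have q0 := hQ.one_le; have q1 := hQ.lt₁; have q2 := hQ.lt₂; have q3 := hQ.lt₃; have q4 := hQ.le
  have hd : IsDiagonal n e := by
    rcases he with ⟨-, rfl⟩ | ⟨-, rfl⟩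
    · refine ⟨by simp only; omega, by simp only; omega, q4, ?_⟩
      rw [ne_eq, Prod.mk.injEq]; omega
    · refine ⟨q0, by simp only; omega, by simp only; omega, ?_⟩
      rw [ne_eq, Prod.mk.injEq]; omega
  have hcross : Crosses (edge l) e ∧ Crosses e (edge l) := by
    rcases he with ⟨h, rfl⟩ | ⟨h, rfl⟩ <;> rw [h] <;> simp only [Crosses] <;> omega
  have hnot : ∀ m, edge m ≠ e := fun m hm => hT.noncrossing l m (hm ▸ hcross.1)
  have hl1 : edge l ≠ (1, n) := by
    rcases he with ⟨h, -⟩ | ⟨h, -⟩ <;> rw [h, ne_eq, Prod.mk.injEq] <;> omega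
  have hmem : ∀ f, (∃ m, edge m = f) → f ≠ edge l → ∃ m, Function.update edge l e m = f := by
    rintro f ⟨m, rfl⟩ hf
    exact ⟨m, Function.update_of_ne (fun h => hf (congrArg edge h)) _ _⟩
  -- A chord that crosses none of the four sides but crosses one diagonal of the quadrilateral is
  -- the other diagonal.
  have key : ∀ p q : ℕ, p < q → ¬ Crosses (w, x) (p, q) → ¬ Crosses (x, y) (p, q) →
      ¬ Crosses (y, z) (p, q) → ¬ Crosses (w, z) (p, q) →
      (Crosses e (p, q) → (p, q) = edge l) ∧ (Crosses (edge l) (p, q) → (p, q) = e) := by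
    intro p q hpq c1 c2 c3 c4
    simp only [Crosses] at c1 c2 c3 c4
    rcases he with ⟨h, rfl⟩ | ⟨h, rfl⟩ <;> rw [h] <;> simp only [Crosses, Prod.mk.injEq] <;>
      constructor <;> intro hc <;> omega
  have hmne : ∀ m, m ≠ l → ¬ Crosses e (edge m) := by
    intro m hm hc
    rcases hpq : edge m with ⟨p, q⟩
    have hpq' : p < q := by
      rcases hT.diagonal m with h | h <;> rw [hpq] at h
      · rw [Prod.mk.injEq] at h; omega
      · have := h.2.1; simp only at this; omega
    have h' := IsEdge.of_eq hpq
    have := (key p q hpq' (hT.not_crosses hQ.wx h') (hT.not_crosses hQ.xy h')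
      (hT.not_crosses hQ.yz h') (hT.not_crosses hQ.wz h')).1 (hpq ▸ hc)
    exact hm (hT.injective (hpq.trans this))
  have symm : ∀ e f : ℕ × ℕ, Crosses e f → Crosses f e := fun e f h => Or.symm h
  refine ⟨?_, ?_, ?_, ?_, ?_⟩
  · intro m m' h
    simp only [Function.update_apply] at h
    split_ifs at h with h1 h2 h2
    · rw [h1, h2]
    · exact absurd h.symm (hnot _)
    · exact absurd h (hnot _)
    · exact hT.injective h
  · exact hmem _ hT.outer hl1.symm
  · intro m
    by_cases hm : m = l
    · subst hm; rw [Function.update_self]; exact Or.inr hd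
    · rw [Function.update_of_ne hm]; exact hT.diagonal m
  · intro m m' h
    simp only [Function.update_apply] at h
    split_ifs at h with h1 h2 h2
    · simp only [Crosses] at h; omega
    · exact hmne _ h2 h
    · exact hmne _ h1 (symm _ _ h)
    · exact hT.noncrossing _ _ h
  · intro f hf hfc
    have hQ' := hQ.update (e := e) (l := l) (by rcases he with h | h <;> simp [h.1])
    have hside : ∀ p q, p < q → IsEdge (Function.update edge l e) p q → ¬ Crosses (p, q) f := by
      rintro p q hpq (rfl | ⟨m, hm⟩) hc
      · have := hf.2.1
        simp only [Crosses] at hc; omega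
      · rw [← hm] at hc
        exact hfc m (symm _ _ hc)
    -- Maximality of the new family: if `f` crosses the removed diagonal, it must be the inserted
    -- one; otherwise it is compatible with the old triangulation.
    by_cases hc : Crosses (edge l) f
    · have := (key f.1 f.2 (by have := hf.2.1; omega) (hside _ _ q1 hQ'.wx) (hside _ _ q2 hQ'.xy)
        (hside _ _ q3 hQ'.yz) (hside _ _ (by omega) hQ'.wz)).2 hc
      exact ⟨l, by rw [Function.update_self]; exact this.symm⟩
    · refine hmem f (hT.maximal f hf fun m => ?_) ?_
      · by_cases hm : m = l
        · subst hm; exact fun h => hc (symm _ _ h)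
        · have := hfc m
          rwa [Function.update_of_ne hm] at this
      · rintro rfl
        have := hfc l
        rw [Function.update_self] at this
        exact this hcross.1

theorem IsTriangulation.flip [DecidableEq I] (hT : IsTriangulation n edge) {l : I}
    {edge' : I → ℕ × ℕ} (h : IsFlip n edge l edge') : IsTriangulation n edge' := by
  obtain ⟨w, x, y, z, hQ, ⟨h, rfl⟩ | ⟨h, rfl⟩⟩ := h
  · exact hT.update_of_crosses hQ (Or.inl ⟨h, rfl⟩)
  · exact hT.update_of_crosses hQ (Or.inr ⟨h, rfl⟩)

/-- The outer edge is never a diagonal of a quadrilateral, so flips preserve the label of the frozen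
variable. -/
theorem IsFlip.eq_outer_iff [DecidableEq I] {l : I} {edge' : I → ℕ × ℕ}
    (h : IsFlip n edge l edge') (m : I) : edge' m = (1, n) ↔ edge m = (1, n) := by
  obtain ⟨w, x, y, z, hQ, h⟩ := h
  have q0 := hQ.one_le; have q1 := hQ.lt₁; have q2 := hQ.lt₂; have q3 := hQ.lt₃; have q4 := hQ.le
  by_cases hm : m = l
  · subst hm
    rcases h with ⟨h, rfl⟩ | ⟨h, rfl⟩ <;> rw [Function.update_self, h, Prod.mk.injEq,
      Prod.mk.injEq] <;> omega
  · rcases h with ⟨h, rfl⟩ | ⟨h, rfl⟩ <;> rw [Function.update_of_ne hm]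

/-- `edge'` is obtained from `edge` by successive flips at the labels in a list. -/
inductive FlipSequence [DecidableEq I] (n : ℕ) :
    List I → (I → ℕ × ℕ) → (I → ℕ × ℕ) → Prop
  | nil (edge : I → ℕ × ℕ) : FlipSequence n [] edge edge
  | cons {l : I} {ls : List I} {edge edge' edge'' : I → ℕ × ℕ} (h : IsFlip n edge l edge')
      (h' : FlipSequence n ls edge' edge'') : FlipSequence n (l :: ls) edge edge''

open Classical in
/-- The number of labelled edges crossing `(p, q)`. -/
noncomputable def crossingNumber [Fintype I] (edge : I → ℕ × ℕ) (p q : ℕ) : ℕ :=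
  (Finset.univ.filter fun l => Crosses (p, q) (edge l)).card

theorem crossingNumber_lt [Fintype I] {edge edge' : I → ℕ × ℕ} {p q r s : ℕ} (l : I)
    (hl : Crosses (r, s) (edge l)) (hl' : ¬ Crosses (p, q) (edge' l))
    (h : ∀ m, Crosses (p, q) (edge' m) → Crosses (r, s) (edge m)) :
    crossingNumber edge' p q < crossingNumber edge r s := by
  classical
  refine Finset.card_lt_card ⟨fun m => ?_, fun hs => ?_⟩
  · simpa using h m
  · exact hl' (by simpa using hs (x := l) (by simpa using hl))

/-- Every diagonal of the polygon can be reached from every triangulation by flips. -/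
theorem IsTriangulation.exists_flipSequence [Fintype I] [DecidableEq I]
    (hT : IsTriangulation n edge) (hn : 3 ≤ n) {p q : ℕ} (hp : 1 ≤ p) (hpq : p < q) (hq : q ≤ n) :
    ∃ ls edge', FlipSequence n ls edge edge' ∧ IsEdge edge' p q := by
  induction hc : crossingNumber edge p q using Nat.strong_induction_on generalizing edge with
  | _ c ih =>
    by_cases h : IsEdge edge p q
    · exact ⟨[], edge, FlipSequence.nil _, h⟩
    -- It suffices to flip so that the number of crossings drops: an edge crossing `(p, q)` and
    -- opposite to `p` is exchanged for a chord ending at `p`, which cannot cross `(p, q)`.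
    suffices ∃ l edge', IsFlip n edge l edge' ∧ crossingNumber edge' p q < c by
      obtain ⟨l, edge', hf, hlt⟩ := this
      obtain ⟨ls, edge'', h1, h2⟩ := ih _ hlt (hT.flip hf) rfl
      exact ⟨l :: ls, edge'', FlipSequence.cons hf h1, h2⟩
    have aux : ∀ (l : I) (e : ℕ × ℕ), Crosses (p, q) (edge l) → ¬ Crosses (p, q) e →
        crossingNumber (Function.update edge l e) p q < c := by
      intro l e h1 h2
      rw [← hc]
      refine crossingNumber_lt l h1 (by rwa [Function.update_self]) fun m hm => ?_
      by_cases hml : m = l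
      · subst hml; exact h1
      · rwa [Function.update_of_ne hml] at hm
    obtain ⟨x, x1, x2, x3, ⟨r, r1, r2, r3, r4⟩ | ⟨r, r1, r2, r3, r4⟩⟩ :=
      hT.exists_crossing hn hp hpq hq h
    · obtain ⟨l, hl⟩ := r4.exists_label (by omega)
      obtain ⟨m, m1, m2, m3, m4⟩ := hT.exists_middle hn hl
      refine ⟨l, _, ⟨p, x, m, r, ⟨hp, x1, m1, m2, r2, x3, m3, m4, r3⟩, Or.inr ⟨hl, rfl⟩⟩,
        aux l _ ?_ ?_⟩
      · rw [hl]; simp only [Crosses]; omega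
      · simp only [Crosses]; omega
    · obtain ⟨l, hl⟩ := r4.exists_label (by omega)
      -- Here `p` lies below the edge `(r, x)`, so the fourth vertex of the quadrilateral is the
      -- apex above that edge, on either side.
      rcases hT.exists_above hn r1 (by omega) (by omega) r4
        (by simp only [ne_eq, Prod.mk.injEq]; omega) with ⟨u, u1, u2, u3, u4⟩ | ⟨u, u1, u2, u3, u4⟩
      · refine ⟨l, _, ⟨u, r, p, x, ⟨u1, u2, r2, x1, by omega, u3, r3, x3, u4⟩,
          Or.inr ⟨hl, rfl⟩⟩, aux l _ ?_ ?_⟩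
        · rw [hl]; simp only [Crosses]; omega
        · simp only [Crosses]; omega
      · refine ⟨l, _, ⟨r, p, x, u, ⟨r1, r2, x1, u1, u2, r3, x3, u4, u3⟩,
          Or.inl ⟨hl, rfl⟩⟩, aux l _ ?_ ?_⟩
        · rw [hl]; simp only [Crosses]; omega
        · simp only [Crosses]; omega

/-- The Laurent phenomenon for Plücker coordinates. -/
theorem IsTriangulation.plucker_mem [Fintype I] {F K : Type*} [Field F] [Field K] [Algebra F K]
    {k : ℕ} {z : Fin k → K} (hk : 2 ≤ k) (hT : IsTriangulation (k + 1) edge) (S : Subalgebra F K)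
    (h0 : ∀ l, plucker z (edge l).1 (edge l).2 ≠ 0)
    (hS : ∀ l, plucker z (edge l).1 (edge l).2 ∈ S)
    (hS' : ∀ l, (plucker z (edge l).1 (edge l).2)⁻¹ ∈ S) {p q : ℕ} (hp : 1 ≤ p) (hpq : p < q)
    (hq : q ≤ k + 1) : plucker z p q ∈ S := by
  have hn : 3 ≤ k + 1 := by omega
  have edge_mem : ∀ p q, 1 ≤ p → q ≤ k + 1 → IsEdge edge p q → plucker z p q ∈ S := by
    rintro p q hp hq (rfl | ⟨l, hl⟩)
    · rw [plucker_consecutive z p hp (by omega)]; exact S.one_mem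
    · have := hS l
      rwa [hl] at this
  induction hc : crossingNumber edge p q using Nat.strong_induction_on generalizing p q with
  | _ c ih =>
    by_cases h : IsEdge edge p q
    · exact edge_mem p q hp hq h
    have ih' : ∀ (p' q' : ℕ) (l : I), 1 ≤ p' → p' < q' → q' ≤ k + 1 → Crosses (p, q) (edge l) →
        ¬ Crosses (p', q') (edge l) →
        (∀ m, Crosses (p', q') (edge m) → Crosses (p, q) (edge m)) → plucker z p' q' ∈ S :=
      fun p' q' l h1 h2 h3 h4 h5 h6 => ih _ (hc ▸ crossingNumber_lt l h4 h5 h6) h1 h2 h3 rfl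
    have lt : ∀ m, (edge m).1 < (edge m).2 := fun m => by
      have := hT.bounds hn (Prod.mk.eta (p := edge m)).symm; omega
    obtain ⟨x, x1, x2, x3, ⟨r, r1, r2, r3, r4⟩ | ⟨r, r1, r2, r3, r4⟩⟩ :=
      hT.exists_crossing hn hp hpq hq h
    · obtain ⟨l, hl⟩ := r4.exists_label (by omega)
      have h0l := h0 l
      have hSl := hS' l
      rw [hl] at h0l hSl
      -- The Plücker relation in the quadrilateral `p, x, q, r`, solved for `Δ_{pq}`. An edge
      -- crossing `(q, r)` or `(x, q)` cannot cross the triangle `p x r`, so it also crosses `(p,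
      -- q)`; the edge `(x, r)` itself is lost, and the number of crossings drops.
      have e : plucker z p q = (plucker z p x * plucker z q r + plucker z p r * plucker z x q) *
          (plucker z x r)⁻¹ := by
        rw [eq_mul_inv_iff_mul_eq₀ h0l]
        exact plucker_relation z p x q r
      rw [e]
      refine S.mul_mem (S.add_mem (S.mul_mem (edge_mem _ _ hp (by omega) x3)
        (ih' q r l (by omega) r1 r2 ?_ ?_ ?_)) (S.mul_mem (edge_mem _ _ hp r2 r3)
        (ih' x q l (by omega) x2 hq ?_ ?_ ?_))) hSl
      · rw [hl]; simp only [Crosses]; omega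
      · rw [hl]; simp only [Crosses]; omega
      · intro m hm
        have c1 := hT.not_crosses x3 (IsEdge.of_eq (Prod.mk.eta (p := edge m)).symm)
        have c2 := hT.not_crosses r3 (IsEdge.of_eq (Prod.mk.eta (p := edge m)).symm)
        have c3 := hT.not_crosses r4 (IsEdge.of_eq (Prod.mk.eta (p := edge m)).symm)
        have := lt m
        simp only [Crosses] at c1 c2 c3 hm ⊢; omega
      · rw [hl]; simp only [Crosses]; omega
      · rw [hl]; simp only [Crosses]; omega
      · intro m hm
        have c1 := hT.not_crosses x3 (IsEdge.of_eq (Prod.mk.eta (p := edge m)).symm)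
        have c2 := hT.not_crosses r3 (IsEdge.of_eq (Prod.mk.eta (p := edge m)).symm)
        have c3 := hT.not_crosses r4 (IsEdge.of_eq (Prod.mk.eta (p := edge m)).symm)
        have := lt m
        simp only [Crosses] at c1 c2 c3 hm ⊢; omega
    · obtain ⟨l, hl⟩ := r4.exists_label (by omega)
      have h0l := h0 l
      have hSl := hS' l
      rw [hl] at h0l hSl
      have e : plucker z p q = (plucker z r p * plucker z x q + plucker z r q * plucker z p x) *
          (plucker z r x)⁻¹ := by
        rw [eq_mul_inv_iff_mul_eq₀ h0l, mul_comm]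
        exact plucker_relation z r p x q
      rw [e]
      refine S.mul_mem (S.add_mem (S.mul_mem (edge_mem _ _ r1 (by omega) r3)
        (ih' x q l (by omega) x2 hq ?_ ?_ ?_)) (S.mul_mem
        (ih' r q l r1 (by omega) hq ?_ ?_ ?_) (edge_mem _ _ hp (by omega) x3))) hSl
      · rw [hl]; simp only [Crosses]; omega
      · rw [hl]; simp only [Crosses]; omega
      · intro m hm
        have c1 := hT.not_crosses x3 (IsEdge.of_eq (Prod.mk.eta (p := edge m)).symm)
        have c2 := hT.not_crosses r3 (IsEdge.of_eq (Prod.mk.eta (p := edge m)).symm)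
        have c3 := hT.not_crosses r4 (IsEdge.of_eq (Prod.mk.eta (p := edge m)).symm)
        have := lt m
        simp only [Crosses] at c1 c2 c3 hm ⊢; omega
      · rw [hl]; simp only [Crosses]; omega
      · rw [hl]; simp only [Crosses]; omega
      · intro m hm
        have c1 := hT.not_crosses x3 (IsEdge.of_eq (Prod.mk.eta (p := edge m)).symm)
        have c2 := hT.not_crosses r3 (IsEdge.of_eq (Prod.mk.eta (p := edge m)).symm)
        have c3 := hT.not_crosses r4 (IsEdge.of_eq (Prod.mk.eta (p := edge m)).symm)
        have := lt m
        simp only [Crosses] at c1 c2 c3 hm ⊢; omega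

end Triangulations

/-! ### Compatibility of mutation with unions, freezing and field homomorphisms. -/

namespace Seed

variable {I J K L : Type*}

theorem ext' {s t : Seed I K} (h1 : s.var = t.var) (h2 : s.frozen = t.frozen)
    (h3 : s.ε = t.ε) : s = t := by
  cases s; cases t; simp_all

section Mutation

variable [Fintype I] [Fintype J] [Field K] [Field L]

theorem exchangeRatio_sum_inl (s : Seed I K) (t : Seed J K) (k : I) :
    (s.sum t).exchangeRatio (Sum.inl k) = s.exchangeRatio k := by
  simp [exchangeRatio, sum]

theorem exchangeRatio_sum_inr (s : Seed I K) (t : Seed J K) (k : J) :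
    (s.sum t).exchangeRatio (Sum.inr k) = t.exchangeRatio k := by
  simp [exchangeRatio, sum]

theorem exchangeRatio_freeze (s : Seed I K) (S : Set I) (k : I) :
    (s.freeze S).exchangeRatio k = s.exchangeRatio k := rfl

variable [DecidableEq I] [DecidableEq J]

/-- Mutation never consults the frozen set. -/
theorem mutate_freeze (s : Seed I K) (S : Set I) (k : I) :
    (s.freeze S).mutate k = (s.mutate k).freeze S := rfl

theorem mutate_map (f : K →+* L) (s : Seed I K) (k : I) :
    (s.map f).mutate k = (s.mutate k).map f := by
  refine ext' ?_ rfl rfl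
  funext i
  by_cases h : i = k
  · subst h; simp [mutate, map]
  · simp [mutate, map, h]

theorem mutateList_map (f : K →+* L) (s : Seed I K) (l : List I) :
    (s.map f).mutateList l = (s.mutateList l).map f := by
  induction l generalizing s with
  | nil => rfl
  | cons k l ih => exact (congrArg (fun t => mutateList t l) (mutate_map f s k)).trans (ih _)

theorem mutate_var_self (s : Seed I K) (k : I) : (s.mutate k).var k =
    (∏ i, s.var i ^ (s.ε k i).toNat + ∏ i, s.var i ^ (-s.ε k i).toNat) / s.var k :=
  Function.update_self _ _ _

theorem mutate_var_of_ne (s : Seed I K) {i k : I} (h : i ≠ k) : (s.mutate k).var i = s.var i :=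
  Function.update_of_ne h _ _

theorem mutate_ε (s : Seed I K) (k i j : I) : (s.mutate k).ε i j =
    if i = k ∨ j = k then -s.ε i j
    else s.ε i j + max (s.ε i k) 0 * max (s.ε k j) 0 - max (s.ε j k) 0 * max (s.ε k i) 0 :=
  rfl

/-- With no arrows between the two parts, the exchange products see only one part, and no path
through `k` reaches the other. -/
theorem mutate_sum_inl (s : Seed I K) (t : Seed J K) (k : I) :
    (s.sum t).mutate (Sum.inl k) = (s.mutate k).sum t := by
  refine ext' ?_ rfl ?_
  · funext i
    by_cases h : i = Sum.inl k
    · subst h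
      rw [mutate_var_self]
      change _ = (s.mutate k).var k
      rw [mutate_var_self]
      simp [sum]
    · rw [mutate_var_of_ne _ h]
      rcases i with i | i
      · exact (mutate_var_of_ne s fun h' => h (congrArg _ h')).symm
      · rfl
  · funext i j
    rcases i with i | i <;> rcases j with j | j
    · change _ = (s.mutate k).ε i j
      rw [mutate_ε, mutate_ε]
      simp only [Sum.inl.injEq]
      rfl
    all_goals
      rw [mutate_ε]
      simp [sum]

theorem mutate_sum_inr (s : Seed I K) (t : Seed J K) (k : J) :
    (s.sum t).mutate (Sum.inr k) = s.sum (t.mutate k) := by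
  refine ext' ?_ rfl ?_
  · funext i
    by_cases h : i = Sum.inr k
    · subst h
      rw [mutate_var_self]
      change _ = (t.mutate k).var k
      rw [mutate_var_self]
      simp [sum]
    · rw [mutate_var_of_ne _ h]
      rcases i with i | i
      · rfl
      · exact (mutate_var_of_ne t fun h' => h (congrArg _ h')).symm
  · funext i j
    rcases i with i | i <;> rcases j with j | j
    on_goal 4 =>
      change _ = (t.mutate k).ε i j
      rw [mutate_ε, mutate_ε]
      simp only [Sum.inr.injEq]
      rfl
    · rw [mutate_ε]
      simp [sum]
    all_goals
      rw [mutate_ε]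
      simp [sum]

end Mutation

end Seed

/-! ### Arrows around the quadrilateral of a diagonal. -/

section TriangulationSeed

variable {I : Type*} {n : ℕ} {edge : I → ℕ × ℕ}

/-- The edge `e` is one of the edges of the triangle `p < q < r` and `f` follows it in clockwise
order. -/
def TriangleArrow (p q r : ℕ) (e f : ℕ × ℕ) : Prop :=
  (e = (p, q) ∧ f = (q, r)) ∨ (e = (q, r) ∧ f = (p, r)) ∨ (e = (p, r) ∧ f = (p, q))

/-- `IsArrowQuad k s₁ s₂ s₃ s₄` : the triangles at the edge `k` are clockwise `s₁ s₂ k` and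
`k s₃ s₄`. -/
structure IsArrowQuad (n : ℕ) (edge : I → ℕ × ℕ) (A : ℕ × ℕ → ℕ × ℕ → Prop)
    (k s₁ s₂ s₃ s₄ : ℕ × ℕ) : Prop where
  left : ∀ e, (∃ l, edge l = e) → (Arrow n edge e k ↔ e = s₂ ∨ e = s₄)
  right : ∀ e, (∃ l, edge l = e) → (Arrow n edge k e ↔ e = s₁ ∨ e = s₃)
  other : ∀ e f, (∃ l, edge l = e) → (∃ l, edge l = f) → e ≠ k → f ≠ k →
    (Arrow n edge e f ↔ A e f ∨ (e = s₁ ∧ f = s₂) ∨ (e = s₃ ∧ f = s₄))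
  disjoint : ∀ e f, (∃ l, edge l = e) → (∃ l, edge l = f) → A e f →
    ¬ ((e = s₁ ∧ f = s₂) ∨ (e = s₃ ∧ f = s₄))

/-- The arrows in triangles which do not contain the edge labelled by `l`. -/
def ArrowAwayFrom (n : ℕ) (edge : I → ℕ × ℕ) (l : I) (e f : ℕ × ℕ) : Prop :=
  ∃ p q r : ℕ, 1 ≤ p ∧ p < q ∧ q < r ∧ r ≤ n ∧ edge l ≠ (p, q) ∧ edge l ≠ (q, r) ∧ edge l ≠ (p, r) ∧
    IsEdge edge p q ∧ IsEdge edge q r ∧ IsEdge edge p r ∧ TriangleArrow p q r e f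

/-- The third vertex of a triangle on the diagonal of a quadrilateral. -/
theorem IsTriangulation.triangle_left (hT : IsTriangulation n edge) {w x y z : ℕ}
    (hQ : IsQuad n edge w x y z) :
    (∀ p, IsEdge edge w p → IsEdge edge p y → w < p → p < y → p = x) ∧
    (∀ p, IsEdge edge w p → IsEdge edge y p → y < p → p = z) ∧
    (∀ p, IsEdge edge p w → IsEdge edge p y → p < w → False) := by
  have q1 := hQ.lt₁; have q2 := hQ.lt₂; have q3 := hQ.lt₃
  refine ⟨fun p h1 h2 h3 h4 => ?_, fun p h1 h2 h3 => ?_, fun p h1 h2 h3 => ?_⟩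
  · have c1 := hT.not_crosses h1 hQ.xy
    have c2 := hT.not_crosses h2 hQ.wx
    simp only [Crosses] at c1 c2; omega
  · have c1 := hT.not_crosses h2 hQ.wz
    have c2 := hT.not_crosses h1 hQ.yz
    simp only [Crosses] at c1 c2; omega
  · have c1 := hT.not_crosses h2 hQ.wz
    simp only [Crosses] at c1; omega

theorem IsTriangulation.triangle_right (hT : IsTriangulation n edge) {w x y z : ℕ}
    (hQ : IsQuad n edge w x y z) :
    (∀ p, IsEdge edge x p → IsEdge edge p z → x < p → p < z → p = y) ∧
    (∀ p, IsEdge edge x p → IsEdge edge z p → z < p → False) ∧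
    (∀ p, IsEdge edge p x → IsEdge edge p z → p < x → p = w) := by
  have q1 := hQ.lt₁; have q2 := hQ.lt₂; have q3 := hQ.lt₃
  refine ⟨fun p h1 h2 h3 h4 => ?_, fun p h1 h2 h3 => ?_, fun p h1 h2 h3 => ?_⟩
  · have c1 := hT.not_crosses h1 hQ.yz
    have c2 := hT.not_crosses h2 hQ.xy
    simp only [Crosses] at c1 c2; omega
  · have c1 := hT.not_crosses h1 hQ.wz
    simp only [Crosses] at c1; omega
  · have c1 := hT.not_crosses h2 hQ.wx
    have c2 := hT.not_crosses h1 hQ.wz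
    simp only [Crosses] at c1 c2; omega

/-- The triangle `w x y` gives `wx → xy → wy → wx`, and `w y z` gives `wy → yz → wz → wy`. The lemma
on third vertices shows that no other triangle contains the diagonal. -/
theorem IsTriangulation.isArrowQuad_left (hT : IsTriangulation n edge) {w x y z : ℕ}
    (hQ : IsQuad n edge w x y z) {l : I} (hl : edge l = (w, y)) :
    IsArrowQuad n edge (ArrowAwayFrom n edge l) (w, y) (w, x) (x, y) (y, z) (w, z) := by
  have q0 := hQ.one_le; have q1 := hQ.lt₁; have q2 := hQ.lt₂; have q3 := hQ.lt₃; have q4 := hQ.le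
  have hk := IsEdge.of_eq hl
  obtain ⟨t1, t2, t3⟩ := hT.triangle_left hQ
  have a1 : ∀ e f, TriangleArrow w x y e f → Arrow n edge e f := fun e f h =>
    ⟨w, x, y, q0, q1, q2, by omega, hQ.wx, hQ.xy, hk, h⟩
  have a2 : ∀ e f, TriangleArrow w y z e f → Arrow n edge e f := fun e f h =>
    ⟨w, y, z, q0, by omega, q3, by omega, hk, hQ.yz, hQ.wz, h⟩
  refine ⟨?_, ?_, ?_, ?_⟩
  · rintro e -
    constructor
    · rintro ⟨p, q, r, b1, b2, b3, b4, e1, e2, e3, ⟨rfl, h⟩ | ⟨rfl, h⟩ | ⟨rfl, h⟩⟩ <;>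
        rw [Prod.mk.injEq] at h <;> obtain ⟨rfl, rfl⟩ := h
      · exact (t3 p e1 e3 b2).elim
      · left; rw [t1 q e1 e2 b2 b3]
      · right; rw [t2 r e3 e2 b3]
    · rintro (rfl | rfl)
      · exact a1 _ _ (Or.inr (Or.inl ⟨rfl, rfl⟩))
      · exact a2 _ _ (Or.inr (Or.inr ⟨rfl, rfl⟩))
  · rintro e -
    constructor
    · rintro ⟨p, q, r, b1, b2, b3, b4, e1, e2, e3, ⟨h, rfl⟩ | ⟨h, rfl⟩ | ⟨h, rfl⟩⟩ <;>
        rw [Prod.mk.injEq] at h <;> obtain ⟨rfl, rfl⟩ := h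
      · right; rw [t2 r e3 e2 b3]
      · exact (t3 p e1 e3 b2).elim
      · left; rw [t1 q e1 e2 b2 b3]
    · rintro (rfl | rfl)
      · exact a1 _ _ (Or.inr (Or.inr ⟨rfl, rfl⟩))
      · exact a2 _ _ (Or.inl ⟨rfl, rfl⟩)
  · rintro e f he hf hek hfk
    constructor
    · rintro ⟨p, q, r, b1, b2, b3, b4, e1, e2, e3, h⟩
      by_cases k1 : edge l = (p, q)
      · rw [hl, Prod.mk.injEq] at k1; obtain ⟨rfl, rfl⟩ := k1
        obtain rfl := t2 r e3 e2 b3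
        rcases h with ⟨h, h'⟩ | ⟨h, h'⟩ | ⟨h, h'⟩
        · exact absurd h hek
        · exact Or.inr (Or.inr ⟨h, h'⟩)
        · exact absurd h' hfk
      by_cases k2 : edge l = (q, r)
      · rw [hl, Prod.mk.injEq] at k2; obtain ⟨rfl, rfl⟩ := k2
        exact (t3 p e1 e3 b2).elim
      by_cases k3 : edge l = (p, r)
      · rw [hl, Prod.mk.injEq] at k3; obtain ⟨rfl, rfl⟩ := k3
        obtain rfl := t1 q e1 e2 b2 b3
        rcases h with ⟨h, h'⟩ | ⟨h, h'⟩ | ⟨h, h'⟩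
        · exact Or.inr (Or.inl ⟨h, h'⟩)
        · exact absurd h' hfk
        · exact absurd h hek
      exact Or.inl ⟨p, q, r, b1, b2, b3, b4, k1, k2, k3, e1, e2, e3, h⟩
    · rintro (⟨p, q, r, b1, b2, b3, b4, -, -, -, e1, e2, e3, h⟩ | ⟨rfl, rfl⟩ | ⟨rfl, rfl⟩)
      · exact ⟨p, q, r, b1, b2, b3, b4, e1, e2, e3, h⟩
      · exact a1 _ _ (Or.inl ⟨rfl, rfl⟩)
      · exact a2 _ _ (Or.inr (Or.inl ⟨rfl, rfl⟩))
  · rintro e f - - ⟨p, q, r, b1, b2, b3, b4, k1, k2, k3, -, -, -, h⟩ h'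
    simp only [hl, TriangleArrow, ne_eq, Prod.mk.injEq] at k1 k2 k3 h
    rcases h' with ⟨rfl, rfl⟩ | ⟨rfl, rfl⟩ <;> simp only [Prod.mk.injEq] at h <;> omega

/-- For the other diagonal the sides appear in the same cyclic order, shifted by one. This shift is
the whole effect of a flip on the quiver near the diagonal. -/
theorem IsTriangulation.isArrowQuad_right (hT : IsTriangulation n edge) {w x y z : ℕ}
    (hQ : IsQuad n edge w x y z) {l : I} (hl : edge l = (x, z)) :
    IsArrowQuad n edge (ArrowAwayFrom n edge l) (x, z) (x, y) (y, z) (w, z) (w, x) := by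
  have q0 := hQ.one_le; have q1 := hQ.lt₁; have q2 := hQ.lt₂; have q3 := hQ.lt₃; have q4 := hQ.le
  have hk := IsEdge.of_eq hl
  obtain ⟨t1, t2, t3⟩ := hT.triangle_right hQ
  have a1 : ∀ e f, TriangleArrow x y z e f → Arrow n edge e f := fun e f h =>
    ⟨x, y, z, by omega, q2, q3, q4, hQ.xy, hQ.yz, hk, h⟩
  have a2 : ∀ e f, TriangleArrow w x z e f → Arrow n edge e f := fun e f h =>
    ⟨w, x, z, q0, q1, by omega, q4, hQ.wx, hk, hQ.wz, h⟩
  refine ⟨?_, ?_, ?_, ?_⟩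
  · rintro e -
    constructor
    · rintro ⟨p, q, r, b1, b2, b3, b4, e1, e2, e3, ⟨rfl, h⟩ | ⟨rfl, h⟩ | ⟨rfl, h⟩⟩ <;>
        rw [Prod.mk.injEq] at h <;> obtain ⟨rfl, rfl⟩ := h
      · right; rw [t3 p e1 e3 b2]
      · left; rw [t1 q e1 e2 b2 b3]
      · exact (t2 r e3 e2 b3).elim
    · rintro (rfl | rfl)
      · exact a1 _ _ (Or.inr (Or.inl ⟨rfl, rfl⟩))
      · exact a2 _ _ (Or.inl ⟨rfl, rfl⟩)
  · rintro e -
    constructor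
    · rintro ⟨p, q, r, b1, b2, b3, b4, e1, e2, e3, ⟨h, rfl⟩ | ⟨h, rfl⟩ | ⟨h, rfl⟩⟩ <;>
        rw [Prod.mk.injEq] at h <;> obtain ⟨rfl, rfl⟩ := h
      · exact (t2 r e3 e2 b3).elim
      · right; rw [t3 p e1 e3 b2]
      · left; rw [t1 q e1 e2 b2 b3]
    · rintro (rfl | rfl)
      · exact a1 _ _ (Or.inr (Or.inr ⟨rfl, rfl⟩))
      · exact a2 _ _ (Or.inr (Or.inl ⟨rfl, rfl⟩))
  · rintro e f he hf hek hfk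
    constructor
    · rintro ⟨p, q, r, b1, b2, b3, b4, e1, e2, e3, h⟩
      by_cases k1 : edge l = (p, q)
      · rw [hl, Prod.mk.injEq] at k1; obtain ⟨rfl, rfl⟩ := k1
        exact (t2 r e3 e2 b3).elim
      by_cases k2 : edge l = (q, r)
      · rw [hl, Prod.mk.injEq] at k2; obtain ⟨rfl, rfl⟩ := k2
        obtain rfl := t3 p e1 e3 b2
        rcases h with ⟨h, h'⟩ | ⟨h, h'⟩ | ⟨h, h'⟩
        · exact absurd h' hfk
        · exact absurd h hek
        · exact Or.inr (Or.inr ⟨h, h'⟩)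
      by_cases k3 : edge l = (p, r)
      · rw [hl, Prod.mk.injEq] at k3; obtain ⟨rfl, rfl⟩ := k3
        obtain rfl := t1 q e1 e2 b2 b3
        rcases h with ⟨h, h'⟩ | ⟨h, h'⟩ | ⟨h, h'⟩
        · exact Or.inr (Or.inl ⟨h, h'⟩)
        · exact absurd h' hfk
        · exact absurd h hek
      exact Or.inl ⟨p, q, r, b1, b2, b3, b4, k1, k2, k3, e1, e2, e3, h⟩
    · rintro (⟨p, q, r, b1, b2, b3, b4, -, -, -, e1, e2, e3, h⟩ | ⟨rfl, rfl⟩ | ⟨rfl, rfl⟩)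
      · exact ⟨p, q, r, b1, b2, b3, b4, e1, e2, e3, h⟩
      · exact a1 _ _ (Or.inl ⟨rfl, rfl⟩)
      · exact a2 _ _ (Or.inr (Or.inr ⟨rfl, rfl⟩))
  · rintro e f - - ⟨p, q, r, b1, b2, b3, b4, k1, k2, k3, -, -, -, h⟩ h'
    simp only [hl, TriangleArrow, ne_eq, Prod.mk.injEq] at k1 k2 k3 h
    rcases h' with ⟨rfl, rfl⟩ | ⟨rfl, rfl⟩ <;> simp only [Prod.mk.injEq] at h <;> omega

/-- Triangles avoiding the flipped label are the same before and after the flip, since neither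
diagonal is one of their sides. -/
theorem arrowAwayFrom_update [DecidableEq I] (hT : Function.Injective edge) {l : I} {e' : ℕ × ℕ}
    (he' : ∀ m, edge m ≠ e') (hs : e'.2 ≠ e'.1 + 1) (hs' : (edge l).2 ≠ (edge l).1 + 1)
    (e f : ℕ × ℕ) :
    ArrowAwayFrom n (Function.update edge l e') l e f ↔ ArrowAwayFrom n edge l e f := by
  have key : ∀ p q, (e' ≠ (p, q) ∧ IsEdge (Function.update edge l e') p q) ↔
      (edge l ≠ (p, q) ∧ IsEdge edge p q) := by
    intro p q
    constructor
    · rintro ⟨h1, rfl | ⟨m, hm⟩⟩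
      · exact ⟨fun h => hs' (by rw [h]), Or.inl rfl⟩
      · by_cases hml : m = l
        · subst hml; rw [Function.update_self] at hm; exact absurd hm h1
        · rw [Function.update_of_ne hml] at hm
          exact ⟨fun h => hml (hT (hm.trans h.symm)), Or.inr ⟨m, hm⟩⟩
    · rintro ⟨h1, rfl | ⟨m, hm⟩⟩
      · exact ⟨fun h => hs (by rw [h]), Or.inl rfl⟩
      · exact ⟨fun h => he' m (hm.trans h.symm), isEdge_update (Or.inr ⟨m, hm⟩) h1⟩
  unfold ArrowAwayFrom
  refine exists_congr fun p => exists_congr fun q => exists_congr fun r => ?_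
  have k1 := key p q; have k2 := key q r; have k3 := key p r
  rw [Function.update_self]
  tauto

end TriangulationSeed

/-! ### Flips as mutations. -/

section TriangulationSeed

variable {I : Type*} {n : ℕ} {edge : I → ℕ × ℕ}

/-- The two triangles at a diagonal play symmetric roles. -/
theorem IsArrowQuad.rotate {A : ℕ × ℕ → ℕ × ℕ → Prop} {k s₁ s₂ s₃ s₄ : ℕ × ℕ}
    (h : IsArrowQuad n edge A k s₁ s₂ s₃ s₄) : IsArrowQuad n edge A k s₃ s₄ s₁ s₂ where
  left e he := (h.left e he).trans Or.comm
  right e he := (h.right e he).trans Or.comm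
  other e f he hf hek hfk := (h.other e f he hf hek hfk).trans (or_congr_right Or.comm)
  disjoint e f he hf hA := fun h' => h.disjoint e f he hf hA h'.symm

/-- The indicator function of an edge. -/
def edgeIndicator (s e : ℕ × ℕ) : ℤ := if e = s then 1 else 0

open Classical in
/-- The antisymmetrisation of a relation. -/
noncomputable def arrowSign (A : ℕ × ℕ → ℕ × ℕ → Prop) (e f : ℕ × ℕ) : ℤ :=
  (if A e f then 1 else 0) - (if A f e then 1 else 0)

theorem triangulationSeed_ε {K : Type*} [Field K] {k : ℕ} (z : Fin k → K) (l m : I) :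
    (triangulationSeed z edge).ε l m = arrowSign (Arrow (k + 1) edge) (edge l) (edge m) := rfl

/-- Four distinct edges. -/
structure FourDistinct (s₁ s₂ s₃ s₄ : ℕ × ℕ) : Prop where
  ne₁₂ : s₁ ≠ s₂
  ne₁₃ : s₁ ≠ s₃
  ne₁₄ : s₁ ≠ s₄
  ne₂₃ : s₂ ≠ s₃
  ne₂₄ : s₂ ≠ s₄
  ne₃₄ : s₃ ≠ s₄

theorem FourDistinct.cases {s₁ s₂ s₃ s₄ : ℕ × ℕ} (hs : FourDistinct s₁ s₂ s₃ s₄) (e : ℕ × ℕ) :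
    (edgeIndicator s₁ e = 1 ∧ edgeIndicator s₂ e = 0 ∧ edgeIndicator s₃ e = 0 ∧
      edgeIndicator s₄ e = 0 ∧ e = s₁) ∨
    (edgeIndicator s₁ e = 0 ∧ edgeIndicator s₂ e = 1 ∧ edgeIndicator s₃ e = 0 ∧
      edgeIndicator s₄ e = 0 ∧ e = s₂) ∨
    (edgeIndicator s₁ e = 0 ∧ edgeIndicator s₂ e = 0 ∧ edgeIndicator s₃ e = 1 ∧
      edgeIndicator s₄ e = 0 ∧ e = s₃) ∨
    (edgeIndicator s₁ e = 0 ∧ edgeIndicator s₂ e = 0 ∧ edgeIndicator s₃ e = 0 ∧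
      edgeIndicator s₄ e = 1 ∧ e = s₄) ∨
    (edgeIndicator s₁ e = 0 ∧ edgeIndicator s₂ e = 0 ∧ edgeIndicator s₃ e = 0 ∧
      edgeIndicator s₄ e = 0 ∧ e ≠ s₁ ∧ e ≠ s₂ ∧ e ≠ s₃ ∧ e ≠ s₄) := by
  obtain ⟨h1, h2, h3, h4, h5, h6⟩ := hs
  unfold edgeIndicator
  by_cases e1 : e = s₁
  · subst e1; simp [*]
  by_cases e2 : e = s₂
  · subst e2; simp [*]
  by_cases e3 : e = s₃
  · subst e3; simp [*]
  by_cases e4 : e = s₄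
  · subst e4; simp [*]
  simp [*]

variable {A A' : ℕ × ℕ → ℕ × ℕ → Prop} {k s₁ s₂ s₃ s₄ : ℕ × ℕ}

theorem arrowSign_swap (A : ℕ × ℕ → ℕ × ℕ → Prop) (e f : ℕ × ℕ) :
    arrowSign A f e = -arrowSign A e f := by
  unfold arrowSign; ring

theorem IsArrowQuad.arrowSign_right (h : IsArrowQuad n edge A k s₁ s₂ s₃ s₄)
    (hs : FourDistinct s₁ s₂ s₃ s₄) {e : ℕ × ℕ} (he : ∃ l, edge l = e) :
    arrowSign (Arrow n edge) k e = edgeIndicator s₁ e + edgeIndicator s₃ e - edgeIndicator s₂ e -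
      edgeIndicator s₄ e := by
  have h1 := h.left e he
  have h2 := h.right e he
  obtain ⟨n1, n2, n3, n4, n5, n6⟩ := hs
  unfold arrowSign
  rcases FourDistinct.cases ⟨n1, n2, n3, n4, n5, n6⟩ e with
    ⟨e1, e2, e3, e4, rfl⟩ | ⟨e1, e2, e3, e4, rfl⟩ | ⟨e1, e2, e3, e4, rfl⟩ | ⟨e1, e2, e3, e4, rfl⟩ |
    ⟨e1, e2, e3, e4, e5, e6, e7, e8⟩ <;>
  · rw [e1, e2, e3, e4]
    simp [*, n1.symm, n2.symm, n3.symm, n4.symm, n5.symm, n6.symm]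

/-- Arrows between edges other than the diagonal come from triangles away from it or from its own
two triangles. By the field `disjoint` no arrow arises both ways, so the indicators add. -/
theorem IsArrowQuad.arrowSign_other (h : IsArrowQuad n edge A k s₁ s₂ s₃ s₄)
    (hs : FourDistinct s₁ s₂ s₃ s₄) {e f : ℕ × ℕ} (he : ∃ l, edge l = e) (hf : ∃ l, edge l = f)
    (hek : e ≠ k) (hfk : f ≠ k) :
    arrowSign (Arrow n edge) e f = arrowSign A e f +
      edgeIndicator s₁ e * edgeIndicator s₂ f + edgeIndicator s₃ e * edgeIndicator s₄ f -
      edgeIndicator s₁ f * edgeIndicator s₂ e - edgeIndicator s₃ f * edgeIndicator s₄ e := by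
  have key : ∀ e f, (∃ l, edge l = e) → (∃ l, edge l = f) → e ≠ k → f ≠ k →
      ∀ [Decidable (Arrow n edge e f)] [Decidable (A e f)],
      (if Arrow n edge e f then (1 : ℤ) else 0) = (if A e f then (1 : ℤ) else 0) +
        edgeIndicator s₁ e * edgeIndicator s₂ f + edgeIndicator s₃ e * edgeIndicator s₄ f := by
    intro e f he hf hek hfk _ _
    have h1 := h.other e f he hf hek hfk
    have h2 := h.disjoint e f he hf
    have h3 := hs.ne₁₃
    unfold edgeIndicator
    by_cases c1 : e = s₁ ∧ f = s₂
    · obtain ⟨rfl, rfl⟩ := c1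
      have : ¬ A e f := fun hA => h2 hA (Or.inl ⟨rfl, rfl⟩)
      simp [h1, this, h3]
    by_cases c2 : e = s₃ ∧ f = s₄
    · obtain ⟨rfl, rfl⟩ := c2
      have : ¬ A e f := fun hA => h2 hA (Or.inr ⟨rfl, rfl⟩)
      simp [h1, this, h3.symm]
    have h4 : Arrow n edge e f ↔ A e f := h1.trans (by tauto)
    have i1 : (if e = s₁ then (1 : ℤ) else 0) * (if f = s₂ then (1 : ℤ) else 0) = 0 := by
      rcases not_and_or.1 c1 with h | h <;> simp [h]
    have i2 : (if e = s₃ then (1 : ℤ) else 0) * (if f = s₄ then (1 : ℤ) else 0) = 0 := by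
      rcases not_and_or.1 c2 with h | h <;> simp [h]
    rw [i1, i2]
    simp [h4]
  classical
  unfold arrowSign
  rw [key e f he hf hek hfk, key f e hf he hfk hek]
  ring

/-- The mutation rule for the quiver of a triangulation. -/
theorem arrowSign_mutation {edge' : I → ℕ × ℕ} {k' : ℕ × ℕ}
    (h : IsArrowQuad n edge A k s₁ s₂ s₃ s₄) (h' : IsArrowQuad n edge' A' k' s₂ s₃ s₄ s₁)
    (hA : ∀ e f, A' e f ↔ A e f) (hs : FourDistinct s₁ s₂ s₃ s₄) {e f : ℕ × ℕ}
    (he : ∃ l, edge l = e) (hf : ∃ l, edge l = f) (he' : ∃ l, edge' l = e) (hf' : ∃ l, edge' l = f)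
    (hek : e ≠ k) (hfk : f ≠ k) (hek' : e ≠ k') (hfk' : f ≠ k') :
    arrowSign (Arrow n edge') e f = arrowSign (Arrow n edge) e f +
      max (arrowSign (Arrow n edge) e k) 0 * max (arrowSign (Arrow n edge) k f) 0 -
      max (arrowSign (Arrow n edge) f k) 0 * max (arrowSign (Arrow n edge) k e) 0 := by
  have hs' : FourDistinct s₂ s₃ s₄ s₁ :=
    ⟨hs.ne₂₃, hs.ne₂₄, hs.ne₁₂.symm, hs.ne₃₄, hs.ne₁₃.symm, hs.ne₁₄.symm⟩
  have hAA : arrowSign A' e f = arrowSign A e f := by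
    have : A' = A := funext fun e => funext fun f => propext (hA e f)
    rw [this]
  rw [h.arrowSign_other hs he hf hek hfk, h'.arrowSign_other hs' he' hf' hek' hfk',
    arrowSign_swap _ k e, arrowSign_swap _ k f, h.arrowSign_right hs he, h.arrowSign_right hs hf,
    hAA]
  -- Positive and negative parts of the arrows at the diagonal: it points to `s₁, s₃` and receives
  -- arrows from `s₂, s₄`. Of the four composites, `s₂ → s₁` and `s₄ → s₃` cancel old arrows, while
  -- `s₂ → s₃` and `s₄ → s₁` are the new ones.
  have p : ∀ e, max (edgeIndicator s₁ e + edgeIndicator s₃ e - edgeIndicator s₂ e -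
      edgeIndicator s₄ e) 0 = edgeIndicator s₁ e + edgeIndicator s₃ e ∧
      max (-(edgeIndicator s₁ e + edgeIndicator s₃ e - edgeIndicator s₂ e -
      edgeIndicator s₄ e)) 0 = edgeIndicator s₂ e + edgeIndicator s₄ e := by
    intro e
    rcases hs.cases e with ⟨e1, e2, e3, e4, -⟩ | ⟨e1, e2, e3, e4, -⟩ | ⟨e1, e2, e3, e4, -⟩ |
      ⟨e1, e2, e3, e4, -⟩ | ⟨e1, e2, e3, e4, -⟩ <;> rw [e1, e2, e3, e4] <;> decide
  rw [(p e).1, (p e).2, (p f).1, (p f).2]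
  ring

/-- A side or labelled edge of the triangulation with vertices between `1` and `n`. -/
def IsPolygonEdge (n : ℕ) (edge : I → ℕ × ℕ) (s : ℕ × ℕ) : Prop :=
  1 ≤ s.1 ∧ s.2 ≤ n ∧ IsEdge edge s.1 s.2

theorem IsQuad.fourDistinct {w x y z : ℕ} (hQ : IsQuad n edge w x y z) :
    FourDistinct (w, x) (x, y) (y, z) (w, z) := by
  have q1 := hQ.lt₁; have q2 := hQ.lt₂; have q3 := hQ.lt₃
  constructor <;> simp only [ne_eq, Prod.mk.injEq] <;> omega

theorem IsQuad.fourDistinct' {w x y z : ℕ} (hQ : IsQuad n edge w x y z) :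
    FourDistinct (x, y) (y, z) (w, z) (w, x) := by
  have q1 := hQ.lt₁; have q2 := hQ.lt₂; have q3 := hQ.lt₃
  constructor <;> simp only [ne_eq, Prod.mk.injEq] <;> omega

theorem IsQuad.isPolygonEdge {w x y z : ℕ} (hQ : IsQuad n edge w x y z) :
    IsPolygonEdge n edge (w, x) ∧ IsPolygonEdge n edge (x, y) ∧ IsPolygonEdge n edge (y, z) ∧
      IsPolygonEdge n edge (w, z) := by
  have q0 := hQ.one_le; have q1 := hQ.lt₁; have q2 := hQ.lt₂; have q3 := hQ.lt₃; have q4 := hQ.le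
  refine ⟨⟨q0, ?_, hQ.wx⟩, ⟨?_, ?_, hQ.xy⟩, ⟨?_, q4, hQ.yz⟩, ⟨q0, q4, hQ.wz⟩⟩ <;> simp only <;> omega

variable [Fintype I] {K : Type*} [Field K] {m : ℕ} {z : Fin m → K}

/-- An unlabelled side contributes an empty product, which agrees with its minor 1. Sides and
labelled edges can therefore be treated alike in exchange relations. -/
theorem prod_ite_edge (hT : IsTriangulation (m + 1) edge) (hm : 2 ≤ m) {s : ℕ × ℕ}
    (h1 : 1 ≤ s.1) (h2 : s.2 ≤ m + 1) (h : IsEdge edge s.1 s.2) :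
    ∏ i, (if edge i = s then plucker z s.1 s.2 else 1) = plucker z s.1 s.2 := by
  classical
  rcases h with h | ⟨l, hl⟩
  · rw [Finset.prod_eq_one]
    · rw [h, plucker_consecutive z _ h1 (by omega)]
    · intro i _
      rw [if_neg]
      intro hi
      have := hT.bounds (by omega) (p := s.1) (q := s.2) (l := i) (by rw [hi])
      omega
  · rw [Finset.prod_eq_single l, if_pos hl]
    · intro i _ hi
      rw [if_neg]
      intro hi'
      exact hi (hT.injective (hi'.trans hl.symm))
    · simp

/-- Each term of the exchange relation is the product over a pair of opposite sides of the
quadrilateral. -/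
theorem IsArrowQuad.exchange (hT : IsTriangulation (m + 1) edge) (hm : 2 ≤ m) {l : I}
    (h : IsArrowQuad (m + 1) edge A (edge l) s₁ s₂ s₃ s₄) (hs : FourDistinct s₁ s₂ s₃ s₄)
    (h₁ : IsPolygonEdge (m + 1) edge s₁) (h₂ : IsPolygonEdge (m + 1) edge s₂)
    (h₃ : IsPolygonEdge (m + 1) edge s₃) (h₄ : IsPolygonEdge (m + 1) edge s₄) :
    (∏ i, (triangulationSeed z edge).var i ^ ((triangulationSeed z edge).ε l i).toNat =
      plucker z s₁.1 s₁.2 * plucker z s₃.1 s₃.2) ∧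
    (∏ i, (triangulationSeed z edge).var i ^ (-(triangulationSeed z edge).ε l i).toNat =
      plucker z s₂.1 s₂.2 * plucker z s₄.1 s₄.2) := by
  have hne := hs
  obtain ⟨n1, n2, n3, n4, n5, n6⟩ := hs
  constructor
  · rw [← prod_ite_edge (z := z) hT hm h₁.1 h₁.2.1 h₁.2.2,
      ← prod_ite_edge (z := z) hT hm h₃.1 h₃.2.1 h₃.2.2, ← Finset.prod_mul_distrib]
    refine Finset.prod_congr rfl fun i _ => ?_
    rw [triangulationSeed_ε, h.arrowSign_right hne ⟨i, rfl⟩]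
    change plucker z (edge i).1 (edge i).2 ^ _ = _
    rcases hne.cases (edge i) with
      ⟨e1, e2, e3, e4, e5⟩ | ⟨e1, e2, e3, e4, e5⟩ | ⟨e1, e2, e3, e4, e5⟩ | ⟨e1, e2, e3, e4, e5⟩ |
      ⟨e1, e2, e3, e4, e5, e6, e7, e8⟩ <;> rw [e1, e2, e3, e4] <;>
      simp [*, n1.symm, n2.symm, n3.symm, n6.symm]
  · rw [← prod_ite_edge (z := z) hT hm h₂.1 h₂.2.1 h₂.2.2,
      ← prod_ite_edge (z := z) hT hm h₄.1 h₄.2.1 h₄.2.2, ← Finset.prod_mul_distrib]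
    refine Finset.prod_congr rfl fun i _ => ?_
    rw [triangulationSeed_ε, h.arrowSign_right hne ⟨i, rfl⟩]
    change plucker z (edge i).1 (edge i).2 ^ _ = _
    rcases hne.cases (edge i) with
      ⟨e1, e2, e3, e4, e5⟩ | ⟨e1, e2, e3, e4, e5⟩ | ⟨e1, e2, e3, e4, e5⟩ | ⟨e1, e2, e3, e4, e5⟩ |
      ⟨e1, e2, e3, e4, e5, e6, e7, e8⟩ <;> rw [e1, e2, e3, e4] <;>
      simp [*, n4.symm, n5.symm]

/-- The two terms of the exchange relation at the diagonal `(w, y)` of a quadrilateral. -/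
theorem IsQuad.exchange_left {p q r s : ℕ} (hT : IsTriangulation (m + 1) edge) (hm : 2 ≤ m)
    (hQ : IsQuad (m + 1) edge p q r s) {l : I} (hl : edge l = (p, r)) :
    (∏ i, (triangulationSeed z edge).var i ^ ((triangulationSeed z edge).ε l i).toNat =
      plucker z p q * plucker z r s) ∧
    (∏ i, (triangulationSeed z edge).var i ^ (-(triangulationSeed z edge).ε l i).toNat =
      plucker z q r * plucker z p s) := by
  have h := hT.isArrowQuad_left hQ hl
  obtain ⟨e1, e2, e3, e4⟩ := hQ.isPolygonEdge
  rw [← hl] at h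
  exact h.exchange hT hm hQ.fourDistinct e1 e2 e3 e4

/-- The two terms of the exchange relation at the diagonal `(x, z)` of a quadrilateral. -/
theorem IsQuad.exchange_right {p q r s : ℕ} (hT : IsTriangulation (m + 1) edge) (hm : 2 ≤ m)
    (hQ : IsQuad (m + 1) edge p q r s) {l : I} (hl : edge l = (q, s)) :
    (∏ i, (triangulationSeed z edge).var i ^ ((triangulationSeed z edge).ε l i).toNat =
      plucker z q r * plucker z p s) ∧
    (∏ i, (triangulationSeed z edge).var i ^ (-(triangulationSeed z edge).ε l i).toNat =
      plucker z r s * plucker z p q) := by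
  have h := hT.isArrowQuad_right hQ hl
  obtain ⟨e1, e2, e3, e4⟩ := hQ.isPolygonEdge
  rw [← hl] at h
  exact h.exchange hT hm hQ.fourDistinct' e2 e3 e4 e1

/-- The flipped diagonal sees the sides in the order `s₂ s₃ s₄ s₁`: its own arrows are reversed, and
the others follow `arrowSign_mutation`. -/
theorem triangulationSeed_mutate_ε [DecidableEq I] {l : I} {e' : ℕ × ℕ}
    (hT : IsTriangulation (m + 1) edge) (hm : 2 ≤ m) (hne : ∀ i, edge i ≠ e')
    (hside : e'.2 ≠ e'.1 + 1) (hs : FourDistinct s₁ s₂ s₃ s₄)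
    (h : IsArrowQuad (m + 1) edge (ArrowAwayFrom (m + 1) edge l) (edge l) s₁ s₂ s₃ s₄)
    (h' : IsArrowQuad (m + 1) (Function.update edge l e')
      (ArrowAwayFrom (m + 1) (Function.update edge l e') l) e' s₂ s₃ s₄ s₁) :
    ((triangulationSeed z edge).mutate l).ε =
      (triangulationSeed z (Function.update edge l e')).ε := by
  have hs' : FourDistinct s₂ s₃ s₄ s₁ :=
    ⟨hs.ne₂₃, hs.ne₂₄, hs.ne₁₂.symm, hs.ne₃₄, hs.ne₁₃.symm, hs.ne₁₄.symm⟩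
  have hA := arrowAwayFrom_update (n := m + 1) (l := l) hT.injective hne hside
    (by have := hT.bounds (by omega) (Prod.mk.eta (p := edge l)).symm; omega)
  have hright : ∀ j, j ≠ l → arrowSign (Arrow (m + 1) (Function.update edge l e')) e' (edge j) =
      -arrowSign (Arrow (m + 1) edge) (edge l) (edge j) := by
    intro j hj
    rw [h'.arrowSign_right hs' ⟨j, Function.update_of_ne hj _ _⟩, h.arrowSign_right hs ⟨j, rfl⟩]
    ring
  have hself : ∀ B : ℕ × ℕ → ℕ × ℕ → Prop, ∀ e, arrowSign B e e = 0 := fun B e => by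
    simp [arrowSign]
  funext i j
  rw [Seed.mutate_ε]
  simp only [triangulationSeed_ε]
  by_cases hi : i = l <;> by_cases hj : j = l
  · subst hi; subst hj
    simp [hself]
  · subst hi
    rw [if_pos (Or.inl rfl), Function.update_self, Function.update_of_ne hj, hright j hj]
  · subst hj
    rw [if_pos (Or.inr rfl), Function.update_self, Function.update_of_ne hi,
      arrowSign_swap _ e', hright i hi, arrowSign_swap _ (edge i), neg_neg]
  · rw [if_neg (by tauto), Function.update_of_ne hi, Function.update_of_ne hj]
    refine (arrowSign_mutation h h' hA hs ⟨i, rfl⟩ ⟨j, rfl⟩ ⟨i, Function.update_of_ne hi _ _⟩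
      ⟨j, Function.update_of_ne hj _ _⟩ ?_ ?_ (hne i) (hne j)).symm
    · exact fun h => hi (hT.injective h)
    · exact fun h => hj (hT.injective h)

/-- Flips of triangulations are mutations of their seeds. -/
theorem triangulationSeed_mutate [DecidableEq I] {l : I} {edge' : I → ℕ × ℕ}
    (hT : IsTriangulation (m + 1) edge) (hm : 2 ≤ m) (hF : IsFlip (m + 1) edge l edge')
    (h0 : plucker z (edge l).1 (edge l).2 ≠ 0) :
    (triangulationSeed z edge).mutate l = triangulationSeed z edge' := by
  have hout := hF.eq_outer_iff
  have hT' := hT.flip hF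
  obtain ⟨p, q, r, s, hQ, h⟩ := hF
  have q0 := hQ.one_le; have q1 := hQ.lt₁; have q2 := hQ.lt₂; have q3 := hQ.lt₃
  have hQ' : ∀ e', IsQuad (m + 1) (Function.update edge l e') p q r s := fun e' =>
    hQ.update (by rcases h with h | h <;> simp [h.1])
  have hfr : (triangulationSeed z edge).frozen = (triangulationSeed z edge').frozen :=
    Set.ext fun i => (hout i).symm
  rcases h with ⟨hl, rfl⟩ | ⟨hl, rfl⟩
  · refine Seed.ext' ?_ hfr ?_
    · funext i
      by_cases hi : i = l
      · subst hi
        have ex := hQ.exchange_left (z := z) hT hm hl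
        rw [Seed.mutate_var_self, ex.1, ex.2]
        change _ / plucker z (edge i).1 (edge i).2 = plucker z _ _
        rw [div_eq_iff h0, Function.update_self, hl, mul_comm (plucker z (q, s).1 _)]
        -- The product of the two diagonals equals the sum of the two products of opposite sides.
        linear_combination -plucker_relation z p q r s
      · rw [Seed.mutate_var_of_ne _ hi]
        change plucker z _ _ = plucker z _ _
        rw [Function.update_of_ne hi]
    · refine triangulationSeed_mutate_ε hT hm ?_ (by simp only; omega) hQ.fourDistinct ?_
        (hT'.isArrowQuad_right (hQ' _) (Function.update_self _ _ _))
      · intro i hi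
        refine hT.noncrossing l i ?_
        rw [hl, hi]; simp only [Crosses]; omega
      · rw [hl]; exact hT.isArrowQuad_left hQ hl
  · refine Seed.ext' ?_ hfr ?_
    · funext i
      by_cases hi : i = l
      · subst hi
        have ex := hQ.exchange_right (z := z) hT hm hl
        rw [Seed.mutate_var_self, ex.1, ex.2]
        change _ / plucker z (edge i).1 (edge i).2 = plucker z _ _
        rw [div_eq_iff h0, Function.update_self, hl]
        linear_combination -plucker_relation z p q r s
      · rw [Seed.mutate_var_of_ne _ hi]
        change plucker z _ _ = plucker z _ _
        rw [Function.update_of_ne hi]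
    -- Starting from the other diagonal, the cyclic orders match only after the two triangles are
    -- interchanged.
    · refine triangulationSeed_mutate_ε hT hm ?_ (by simp only; omega) hQ.fourDistinct' ?_
        (hT'.isArrowQuad_left (hQ' _) (Function.update_self _ _ _)).rotate
      · intro i hi
        refine hT.noncrossing l i ?_
        rw [hl, hi]; simp only [Crosses]; omega
      · rw [hl]; exact hT.isArrowQuad_right hQ hl

end TriangulationSeed

/-! ### Gluing triangulations along the diagonal `D_{ij}`. -/

section GlueTriangulations

variable {I J : Type*} {a b i : ℕ} {edgeA : I → ℕ × ℕ} {edgeB : J → ℕ × ℕ}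

theorem glueEdges_inl {l : I} {p q : ℕ} (h : edgeA l = (p, q)) :
    glueEdges a i edgeA edgeB (Sum.inl l) = (vertexA i p, vertexA i q) := by
  simp [glueEdges, h]

theorem glueEdges_inr {l : J} {p q : ℕ} (h : edgeB l = (p, q)) :
    glueEdges a i edgeA edgeB (Sum.inr l) = (vertexB a i p, vertexB a i q) := by
  simp [glueEdges, h]

theorem isEdge_glueEdges_A {p q : ℕ} (hp : 1 ≤ p) (hi : 1 ≤ i) (h : IsEdge edgeA p q) :
    IsEdge (glueEdges a i edgeA edgeB) (vertexA i p) (vertexA i q) := by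
  rcases h with rfl | ⟨l, hl⟩
  · left; simp only [vertexA]; omega
  · exact IsEdge.of_eq (glueEdges_inl hl)

theorem isEdge_glueEdges_B (hA : IsTriangulation (a + 1) edgeA) (ha : 1 ≤ a) (hi : 1 ≤ i) {p q : ℕ}
    (h : IsEdge edgeB p q) :
    IsEdge (glueEdges a i edgeA edgeB) (vertexB a i p) (vertexB a i q) := by
  rcases h with rfl | ⟨l, hl⟩
  · rcases lt_trichotomy p i with h | rfl | h
    · left; simp only [vertexB]; split_ifs <;> omega
    -- The side `(i, i+1)` of the second polygon becomes `D_{ij}`, which is labelled by the outer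
    -- edge of the first triangulation.
    · obtain ⟨l, hl⟩ := hA.outer
      have : (vertexB a p p, vertexB a p (p + 1)) = (vertexA p 1, vertexA p (a + 1)) := by
        simp only [vertexA, vertexB, Prod.mk.injEq]
        split_ifs <;> omega
      rw [Prod.mk.injEq] at this
      rw [this.1, this.2]
      exact IsEdge.of_eq (glueEdges_inl hl)
    · left; simp only [vertexB]; split_ifs <;> omega
  · exact IsEdge.of_eq (glueEdges_inr hl)

theorem vertexA_bounds {p : ℕ} (hi : 1 ≤ i) (hp : 1 ≤ p) (hp' : p ≤ a + 1) :
    i ≤ vertexA i p ∧ vertexA i p ≤ i + a ∧ vertexA i p + 1 = p + i := by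
  simp only [vertexA]; omega

theorem vertexB_cases (ha : 1 ≤ a) (p : ℕ) :
    (p ≤ i ∧ vertexB a i p = p) ∨ (i < p ∧ vertexB a i p + 1 = p + a) := by
  simp only [vertexB]; split_ifs <;> omega

theorem isTriangulation_glueEdges (ha : 2 ≤ a) (hb : 2 ≤ b) (hi : 1 ≤ i) (hib : i ≤ b)
    (hA : IsTriangulation (a + 1) edgeA) (hB : IsTriangulation (b + 1) edgeB) :
    IsTriangulation (a + b) (glueEdges a i edgeA edgeB) := by
  have bA : ∀ l, 1 ≤ (edgeA l).1 ∧ (edgeA l).1 + 2 ≤ (edgeA l).2 ∧ (edgeA l).2 ≤ a + 1 := fun l =>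
    hA.bounds (by omega) (Prod.mk.eta (p := edgeA l)).symm
  have bB : ∀ l, 1 ≤ (edgeB l).1 ∧ (edgeB l).1 + 2 ≤ (edgeB l).2 ∧ (edgeB l).2 ≤ b + 1 := fun l =>
    hB.bounds (by omega) (Prod.mk.eta (p := edgeB l)).symm
  have vA : ∀ l, vertexA i (edgeA l).1 + 1 = (edgeA l).1 + i ∧
      vertexA i (edgeA l).2 + 1 = (edgeA l).2 + i := by
    intro l; simp only [vertexA]; have := bA l; omega
  have vB1 : ∀ l, _ := fun l => vertexB_cases (a := a) (i := i) (by omega) (edgeB l).1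
  have vB2 : ∀ l, _ := fun l => vertexB_cases (a := a) (i := i) (by omega) (edgeB l).2
  refine ⟨?_, ?_, ?_, ?_, ?_⟩
  · rintro (l | l) (m | m) h <;> simp only [glueEdges, Sum.elim_inl, Sum.elim_inr,
      Prod.mk.injEq] at h
    · have := vA l; have := vA m
      rw [hA.injective (Prod.ext (by omega) (by omega) : edgeA l = edgeA m)]
    · have := vA l; have := bA l; have := vB1 m; have := vB2 m; have := bB m; omega
    · have := vA m; have := bA m; have := vB1 l; have := vB2 l; have := bB l; omega
    · have := vB1 m; have := vB2 m; have := vB1 l; have := vB2 l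
      rw [hB.injective (Prod.ext (by omega) (by omega) : edgeB l = edgeB m)]
  · obtain ⟨l, hl⟩ := hB.outer
    refine ⟨Sum.inr l, ?_⟩
    rw [glueEdges_inr hl, Prod.mk.injEq]
    simp only [vertexB]
    split_ifs <;> omega
  · rintro (l | l)
    · right
      have := vA l; have := bA l
      simp only [glueEdges, Sum.elim_inl, IsDiagonal, ne_eq, Prod.mk.injEq]
      omega
    · have := vB1 l; have := vB2 l; have := bB l
      simp only [glueEdges, Sum.elim_inr, IsDiagonal, ne_eq, Prod.mk.injEq]
      omega
  · rintro (l | l) (m | m) h <;> simp only [glueEdges, Sum.elim_inl, Sum.elim_inr, Crosses] at h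
    · have := vA l; have := vA m
      have c := hA.noncrossing l m
      simp only [Crosses] at c
      omega
    · have := vA l; have := bA l; have := vB1 m; have := vB2 m; have := bB m; omega
    · have := vA m; have := bA m; have := vB1 l; have := vB2 l; have := bB l; omega
    · have := vB1 m; have := vB2 m; have := vB1 l; have := vB2 l
      have c := hB.noncrossing l m
      simp only [Crosses] at c
      omega
  · rintro ⟨p, q⟩ he hc
    have hd1 := he.1; have hd2 := he.2.1; have hd3 := he.2.2.1; have hd4 := he.2.2.2
    simp only [ne_eq, Prod.mk.injEq] at hd1 hd2 hd3 hd4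
    obtain ⟨l₀, hl₀⟩ := hA.outer
    have c0 := hc (Sum.inl l₀)
    rw [glueEdges_inl hl₀] at c0
    simp only [Crosses, vertexA] at c0
    -- A diagonal not crossing `D_{ij}` lies in one of the two pieces, where maximality of that
    -- triangulation applies.
    by_cases hin : i ≤ p ∧ q ≤ i + a
    · have : IsEdge edgeA (p + 1 - i) (q + 1 - i) := by
        refine hA.isEdge_of_forall (by omega) (by omega) (by omega) ?_
        rintro x y ⟨l, hl⟩ hcr
        refine hc (Sum.inl l) ?_
        have := vA l
        rw [glueEdges_inl hl]
        rw [hl] at this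
        simp only [Crosses] at hcr this ⊢
        omega
      obtain ⟨l, hl⟩ := this.exists_label (by omega)
      refine ⟨Sum.inl l, ?_⟩
      rw [glueEdges_inl hl, Prod.mk.injEq]
      simp only [vertexA]; omega
    -- Vertex numbers in the second polygon: those up to `i` are kept, the later ones are lowered by
    -- `a - 1`.
    · obtain ⟨p', hp'⟩ : ∃ p', (p ≤ i ∧ p' = p) ∨ (i < p ∧ p' + a = p + 1) := by
        rcases le_or_gt p i with h | h
        · exact ⟨p, Or.inl ⟨h, rfl⟩⟩
        · exact ⟨p + 1 - a, Or.inr ⟨h, by omega⟩⟩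
      obtain ⟨q', hq'⟩ : ∃ q', (q ≤ i ∧ q' = q) ∨ (i < q ∧ q' + a = q + 1) := by
        rcases le_or_gt q i with h | h
        · exact ⟨q, Or.inl ⟨h, rfl⟩⟩
        · exact ⟨q + 1 - a, Or.inr ⟨h, by omega⟩⟩
      have : IsEdge edgeB p' q' := by
        refine hB.isEdge_of_forall (by omega) (by omega) (by omega) ?_
        rintro x y ⟨l, hl⟩ hcr
        refine hc (Sum.inr l) ?_
        have h1 := vB1 l
        have h2 := vB2 l
        rw [glueEdges_inr hl]
        rw [hl] at h1 h2
        simp only [Crosses] at hcr h1 h2 ⊢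
        omega
      obtain ⟨l, hl⟩ := this.exists_label (by omega)
      refine ⟨Sum.inr l, ?_⟩
      have h1 := vB1 l
      have h2 := vB2 l
      rw [hl] at h1 h2
      rw [glueEdges_inr hl, Prod.mk.injEq]
      simp only at h1 h2
      omega

theorem IsQuad.glueEdges_A (hi : 1 ≤ i) (hib : i ≤ b) {w x y z : ℕ}
    (hQ : IsQuad (a + 1) edgeA w x y z) :
    IsQuad (a + b) (glueEdges a i edgeA edgeB) (vertexA i w) (vertexA i x) (vertexA i y)
      (vertexA i z) := by
  have q0 := hQ.one_le; have q1 := hQ.lt₁; have q2 := hQ.lt₂; have q3 := hQ.lt₃; have q4 := hQ.le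
  refine ⟨?_, ?_, ?_, ?_, ?_, isEdge_glueEdges_A q0 hi hQ.wx,
    isEdge_glueEdges_A (by omega) hi hQ.xy, isEdge_glueEdges_A (by omega) hi hQ.yz,
    isEdge_glueEdges_A q0 hi hQ.wz⟩ <;> simp only [vertexA] <;> omega

theorem IsQuad.glueEdges_B (hA : IsTriangulation (a + 1) edgeA) (ha : 1 ≤ a) (hi : 1 ≤ i)
    {w x y z : ℕ} (hQ : IsQuad (b + 1) edgeB w x y z) :
    IsQuad (a + b) (glueEdges a i edgeA edgeB) (vertexB a i w) (vertexB a i x) (vertexB a i y)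
      (vertexB a i z) := by
  have q0 := hQ.one_le; have q1 := hQ.lt₁; have q2 := hQ.lt₂; have q3 := hQ.lt₃; have q4 := hQ.le
  refine ⟨?_, ?_, ?_, ?_, ?_, isEdge_glueEdges_B hA ha hi hQ.wx,
    isEdge_glueEdges_B hA ha hi hQ.xy, isEdge_glueEdges_B hA ha hi hQ.yz,
    isEdge_glueEdges_B hA ha hi hQ.wz⟩ <;> simp only [vertexB] <;> split_ifs <;> omega

variable [DecidableEq I] [DecidableEq J]

theorem IsFlip.glueEdges_A (hi : 1 ≤ i) (hib : i ≤ b) {l : I} {edgeA' : I → ℕ × ℕ}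
    (h : IsFlip (a + 1) edgeA l edgeA') :
    IsFlip (a + b) (glueEdges a i edgeA edgeB) (Sum.inl l) (glueEdges a i edgeA' edgeB) := by
  obtain ⟨w, x, y, z, hQ, h⟩ := h
  refine ⟨_, _, _, _, hQ.glueEdges_A hi hib, ?_⟩
  have key : ∀ p q, glueEdges a i (Function.update edgeA l (p, q)) edgeB =
      Function.update (glueEdges a i edgeA edgeB) (Sum.inl l) (vertexA i p, vertexA i q) := by
    intro p q
    funext m
    rcases m with m | m
    · by_cases hm : m = l
      · subst hm; simp [glueEdges]
      · simp [glueEdges, hm]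
    · simp [glueEdges]
  rcases h with ⟨h, rfl⟩ | ⟨h, rfl⟩
  · exact Or.inl ⟨glueEdges_inl h, key _ _⟩
  · exact Or.inr ⟨glueEdges_inl h, key _ _⟩

theorem IsFlip.glueEdges_B (hA : IsTriangulation (a + 1) edgeA) (ha : 1 ≤ a) (hi : 1 ≤ i)
    {l : J} {edgeB' : J → ℕ × ℕ} (h : IsFlip (b + 1) edgeB l edgeB') :
    IsFlip (a + b) (glueEdges a i edgeA edgeB) (Sum.inr l) (glueEdges a i edgeA edgeB') := by
  obtain ⟨w, x, y, z, hQ, h⟩ := h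
  refine ⟨_, _, _, _, hQ.glueEdges_B hA ha hi, ?_⟩
  have key : ∀ p q, glueEdges a i edgeA (Function.update edgeB l (p, q)) =
      Function.update (glueEdges a i edgeA edgeB) (Sum.inr l) (vertexB a i p, vertexB a i q) := by
    intro p q
    funext m
    rcases m with m | m
    · simp [glueEdges]
    · by_cases hm : m = l
      · subst hm; simp [glueEdges]
      · simp [glueEdges, hm]
  rcases h with ⟨h, rfl⟩ | ⟨h, rfl⟩
  · exact Or.inl ⟨glueEdges_inr h, key _ _⟩
  · exact Or.inr ⟨glueEdges_inr h, key _ _⟩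

end GlueTriangulations

/-! ### Normalisation of matrices -/

section Normalisation

theorem det₂_smul_smul {R : Type*} [CommRing R] (c d : R) (u v : Fin 2 → R) :
    det₂ (c • u) (d • v) = c * d * det₂ u v := by
  simp only [det₂, Pi.smul_apply, smul_eq_mul]; ring

/-- The normalisation is a row operation of determinant `1 / Δ₁₂`, so all minors are scaled by the
same factor. -/
theorem det₂_standardForm {n : ℕ} {v : ℕ → Fin 2 → ℂ} (h : det₂ (v 1) (v n) ≠ 0) (p q : ℕ) :
    det₂ (standardForm n v p) (standardForm n v q) = det₂ (v p) (v q) / det₂ (v 1) (v 2) := by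
  -- If `Δ₁₂ = 0`, division by zero makes the second row vanish, and both sides are 0.
  by_cases h2 : det₂ (v 1) (v 2) = 0
  · simp [det₂, standardForm] at h2 ⊢
    simp [h2]
  rw [eq_div_iff h2]
  have : det₂ (standardForm n v p) (standardForm n v q) = (det₂ (v p) (v n) / det₂ (v 1) (v n)) *
    (det₂ (v 1) (v q) / det₂ (v 1) (v 2)) - (det₂ (v 1) (v p) / det₂ (v 1) (v 2)) *
    (det₂ (v q) (v n) / det₂ (v 1) (v n)) := rfl
  rw [this]
  field_simp
  simp only [det₂]; ring

/-- The factors in the rescaling of the columns. -/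
noncomputable def rescaleFactor (v : ℕ → Fin 2 → ℂ) (m : ℕ) : ℂ :=
  ∏ l ∈ Finset.Ico 2 m, det₂ (v l) (v (l + 1)) ^ ((-1 : ℤ) ^ (m - l))

theorem rescale_eq (v : ℕ → Fin 2 → ℂ) (m : ℕ) : rescale v m = rescaleFactor v m • v m := rfl

theorem rescaleFactor_of_le_two (v : ℕ → Fin 2 → ℂ) {m : ℕ} (hm : m ≤ 2) :
    rescaleFactor v m = 1 := by
  rw [rescaleFactor, Finset.Ico_eq_empty (by omega), Finset.prod_empty]

/-- The alternating exponents cancel in two successive factors, except for the last minor, which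
occurs once, inverted. -/
theorem rescaleFactor_succ_mul (v : ℕ → Fin 2 → ℂ) {m : ℕ} (hm : 2 ≤ m)
    (h : ∀ l, 2 ≤ l → l ≤ m → det₂ (v l) (v (l + 1)) ≠ 0) :
    rescaleFactor v m * rescaleFactor v (m + 1) * det₂ (v m) (v (m + 1)) = 1 := by
  unfold rescaleFactor
  rw [Finset.prod_Ico_succ_top hm, ← mul_assoc, ← Finset.prod_mul_distrib, Finset.prod_eq_one]
  · simp [h m hm le_rfl]
  · intro l hl
    rw [Finset.mem_Ico] at hl
    rw [← zpow_add₀ (h l hl.1 hl.2.le), show m + 1 - l = (m - l) + 1 by omega, pow_succ]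
    simp

/-- If a chain with consecutive minors 1 has its columns scaled by `c`, with `c₁ = c₂ = 1`, the
consecutive minors become `c_l c_{l+1}`. The rescaling factor then undoes `c`. -/
theorem rescaleFactor_mul_eq_one (v : ℕ → Fin 2 → ℂ) (c : ℕ → ℂ) {k : ℕ} (h1 : c 1 = 1)
    (h2 : c 2 = 1) (h0 : ∀ l, 2 ≤ l → l ≤ k + 1 → c l ≠ 0)
    (h : ∀ l, 2 ≤ l → l ≤ k → det₂ (v l) (v (l + 1)) = c l * c (l + 1)) (m : ℕ) (hm : 1 ≤ m)
    (hmk : m ≤ k + 1) : rescaleFactor v m * c m = 1 := by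
  rcases (by omega : m = 1 ∨ 2 ≤ m) with rfl | hm2
  · rw [rescaleFactor_of_le_two v (by omega), h1, one_mul]
  induction m, hm2 using Nat.le_induction with
  | base => rw [rescaleFactor_of_le_two v le_rfl, h2, one_mul]
  | succ m hm2 ih =>
    have ih := ih (by omega) (by omega)
    have key := rescaleFactor_succ_mul v hm2 fun l hl hl' => by
      rw [h l hl (by omega)]
      exact mul_ne_zero (h0 l hl (by omega)) (h0 (l + 1) (by omega) (by omega))
    rw [h m hm2 (by omega)] at key
    linear_combination key - (rescaleFactor v (m + 1) * c (m + 1)) * ih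

/-- The vectors of the point attached to a matrix. -/
theorem vec_toBraid {k : ℕ} (hk : 1 ≤ k) {v : ℕ → Fin 2 → ℂ}
    (h1 : ∀ m, 1 ≤ m → m ≤ k → det₂ (v m) (v (m + 1)) ≠ 0) (hn : det₂ (v 1) (v (k + 1)) ≠ 0) :
    toBraid k v ∈ braidVariety k ∧ ∀ m, 1 ≤ m → m ≤ k + 1 → vec (toBraid k v) m =
      rescaleFactor (standardForm (k + 1) v) m • standardForm (k + 1) v m := by
  have h12 := h1 1 le_rfl hk
  have key : ∀ m, 1 ≤ m → m ≤ k + 1 → vec (toBraid k v) m =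
      rescaleFactor (standardForm (k + 1) v) m • standardForm (k + 1) v m := by
    intro m hm hmk
    refine vec_parameters (rescale (standardForm (k + 1) v)) ?_ ?_ m hm hmk
    · rw [rescale_eq, rescaleFactor_of_le_two _ (by omega), one_smul, standardForm, div_self hn]
      simp [det₂, mul_comm]
    · intro m hm hmk
      rw [rescale_eq, rescale_eq, det₂_smul_smul]
      -- The first consecutive minor is already 1 by the row operation; the rescaling starts from
      -- the third column.
      rcases (by omega : m = 1 ∨ 2 ≤ m) with rfl | hm2
      · rw [rescaleFactor_of_le_two _ (by omega), rescaleFactor_of_le_two _ (by omega),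
          det₂_standardForm hn, div_self h12]
        norm_num
      · refine rescaleFactor_succ_mul _ hm2 fun l hl hl' => ?_
        rw [det₂_standardForm hn]
        exact div_ne_zero (h1 l (by omega) (by omega)) h12
  refine ⟨?_, key⟩
  rw [mem_braidVariety_iff, key (k + 1) (by omega) le_rfl]
  simp [standardForm, det₂, mul_comm]

/-- The point attached to a matrix is determined by the minors up to rescaling of columns. -/
theorem toBraid_eq {k : ℕ} (hk : 1 ≤ k) {v : ℕ → Fin 2 → ℂ} {x : Fin k → ℂ}
    (hx : x ∈ braidVariety k) (c : ℕ → ℂ) (d : ℂ) (hd : d ≠ 0) (h1 : c 1 = 1) (h2 : c 2 = 1)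
    (h0 : ∀ l, 1 ≤ l → l ≤ k + 1 → c l ≠ 0)
    (h : ∀ p q, 1 ≤ p → p ≤ k + 1 → 1 ≤ q → q ≤ k + 1 →
      det₂ (v p) (v q) = c p * c q * d * plucker x p q) : toBraid k v = x := by
  have hlast := plucker_one_last_ne_zero hk hx
  have hn : det₂ (v 1) (v (k + 1)) ≠ 0 := by
    rw [h 1 (k + 1) (by omega) (by omega) (by omega) le_rfl]
    exact mul_ne_zero (mul_ne_zero (mul_ne_zero (h0 _ le_rfl (by omega)) (h0 _ (by omega) le_rfl))
      hd) hlast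
  have h12 : det₂ (v 1) (v 2) = d := by
    rw [h 1 2 le_rfl (by omega) (by omega) (by omega), plucker_consecutive x 1 le_rfl hk, h1, h2]
    ring
  -- The row operation removes the common factor `d`, leaving the vectors of `x` up to the column
  -- factors.
  have hst : ∀ m, 1 ≤ m → m ≤ k + 1 → standardForm (k + 1) v m = c m • vec x m := by
    intro m hm hmk
    have hc := h0 (k + 1) (by omega) le_rfl
    have e0 : vec x (k + 1) 0 = 0 := (mem_braidVariety_iff x).1 hx
    rw [plucker_one_left] at hlast
    have f1 := h m (k + 1) hm hmk (by omega) le_rfl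
    have f2 := h 1 (k + 1) le_rfl (by omega) (by omega) le_rfl
    have f3 := h 1 m le_rfl (by omega) hm hmk
    rw [plucker_one_left] at f2 f3
    rw [standardForm, f1, f2, f3, h12]
    ext s
    fin_cases s
    · simp only [plucker, det₂, e0, h1, Fin.zero_eta, Fin.isValue, Matrix.cons_val_zero,
        Pi.smul_apply, smul_eq_mul]
      field_simp
      ring
    · change c 1 * c m * d * vec x m 1 / d = c m * vec x m 1
      rw [h1]
      field_simp
  have hr := rescaleFactor_mul_eq_one (standardForm (k + 1) v) c (k := k) h1 h2
    (fun l hl hl' => h0 l (by omega) hl') fun l hl hl' => by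
      rw [hst l (by omega) (by omega), hst (l + 1) (by omega) (by omega), det₂_smul_smul]
      have := plucker_consecutive x l (by omega) hl'
      rw [plucker] at this
      rw [this, mul_one]
  refine parameters_eq_of_vec x _ fun m hm hmk => ?_
  rw [rescale_eq, hst m hm hmk, smul_smul, hr m hm hmk, one_smul]

end Normalisation

/-! ### The gluing map -/

section Glue

/-- The exponent of `Δ_{ij}` in the rescaling of the `m`-th column of `V₂`. -/
def gluePower (i m : ℕ) : ℤ :=
  if i = 1 then (if m ≤ 2 ∨ Even m then 0 else -1) else if m ≤ i then 0 else (-1) ^ (m - i - 1)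

/-- The exponent of `Δ_{ij}` in the determinant of the row operation on `V₂`. -/
def glueShear (i : ℕ) : ℤ := if i = 1 then 1 else 0

theorem gluePower_of_le {i m : ℕ} (h : m ≤ i) : gluePower i m = 0 := by
  unfold gluePower
  split_ifs <;> first | rfl | omega

theorem gluePower_two {i : ℕ} (hi : 1 ≤ i) : gluePower i 2 = 0 := by
  unfold gluePower
  split_ifs with h1 h2 h3 <;> first | rfl | (simp at h2) | omega

/-- The exponents are chosen so that, after gluing, all consecutive minors of `V₂` are 1 except that
of columns `i, i + 1`, which is `Δ_{ij}`. For `i = 1` this is the minor `Δ₁₂` used by the row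
operation, hence the extra determinant `glueShear`. -/
theorem gluePower_add {i m : ℕ} (hi : 1 ≤ i) (hm : 1 ≤ m) :
    gluePower i m + gluePower i (m + 1) + glueShear i = if m = i then 1 else 0 := by
  unfold gluePower glueShear
  by_cases h : i = 1
  · subst h
    simp only [if_true]
    rcases (by omega : m = 1 ∨ m = 2 ∨ 3 ≤ m) with rfl | rfl | h
    · simp
    · have : ¬ Even 3 := by decide
      simp [this]
    · rw [if_neg (by omega : ¬ m = 1)]
      have h1 : ¬ m ≤ 2 := by omega
      have h2 : ¬ m + 1 ≤ 2 := by omega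
      rcases Nat.even_or_odd m with he | ho
      · have : ¬ Even (m + 1) := by simpa [Nat.even_add_one] using he
        simp [he, this, h1]
        omega
      · have h3 : ¬ Even m := by simpa using ho
        have : Even (m + 1) := by simpa [Nat.even_add_one] using ho
        simp [h3, this, h1]
  · simp only [h, if_false]
    rcases lt_trichotomy m i with h | rfl | h
    · simp [h.le, h.ne, Nat.succ_le_of_lt h]
    · simp
    · rw [if_neg (by omega), if_neg (by omega), if_neg (by omega),
        show m + 1 - i - 1 = (m - i - 1) + 1 by omega, pow_succ]
      ring

/-- One formula for both cases: a row operation of determinant `d ^ glueShear i` followed by powers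
of `d` on the columns. -/
theorem unscale_eq {i b : ℕ} (y : Fin b → ℂ) {d : ℂ} (m : ℕ) :
    unscale i y d m = d ^ gluePower i m • ![vec y m 0, d ^ glueShear i * vec y m 1] := by
  unfold unscale gluePower glueShear
  split_ifs with h1 h2 h3
  · simp
  · simp
  · ext s; fin_cases s <;> simp
  · ext s; fin_cases s <;> simp

theorem det₂_unscale {i b : ℕ} (y : Fin b → ℂ) {d : ℂ} (hd : d ≠ 0) (p q : ℕ) :
    det₂ (unscale i y d p) (unscale i y d q) =
      d ^ (gluePower i p + gluePower i q + glueShear i) * plucker y p q := by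
  rw [unscale_eq, unscale_eq, det₂_smul_smul, zpow_add₀ hd, zpow_add₀ hd, mul_assoc, mul_assoc]
  simp only [det₂, plucker, Matrix.cons_val_zero, Matrix.cons_val_one]
  ring

variable {a b i : ℕ} {x : Fin a → ℂ} {y : Fin b → ℂ}

theorem glueVec_vertexA (hi : 1 ≤ i) {p : ℕ} (hp : 1 ≤ p) (hp' : p ≤ a + 1) :
    glueVec i x y (vertexA i p) = vec x p 0 • unscale i y (plucker x 1 (a + 1)) i +
      (vec x p 1 / plucker x 1 (a + 1)) • unscale i y (plucker x 1 (a + 1)) (i + 1) := by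
  obtain ⟨h1, h2, h3⟩ := vertexA_bounds hi hp hp'
  simp only [glueVec]
  rw [if_neg (by omega), if_pos h2, h3, Nat.add_sub_cancel]

/-- At the common vertices `i` and `j` the glued vector is defined by the formula for `V₁`. It
agrees with `V₂` because the first and last columns of `V₁` are `(1, 0)` and `(0, d)`. -/
theorem glueVec_vertexB (ha : 1 ≤ a) (hi : 1 ≤ i) (hx : x ∈ braidVariety a) {p : ℕ} :
    glueVec i x y (vertexB a i p) = unscale i y (plucker x 1 (a + 1)) p := by
  have hd := plucker_one_last_ne_zero ha hx
  rcases lt_trichotomy p i with h | rfl | h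
  · rw [show vertexB a i p = p from if_pos h.le]
    exact if_pos h
  · have := glueVec_vertexA (x := x) (y := y) hi le_rfl (by omega : 1 ≤ a + 1)
    rw [show vertexA p 1 = vertexB a p p by simp [vertexA, vertexB]] at this
    rw [this, vec_one]
    simp
  · rcases (by omega : p = i + 1 ∨ i + 1 < p) with rfl | h'
    · have := glueVec_vertexA (x := x) (y := y) hi (by omega : 1 ≤ a + 1) le_rfl
      rw [show vertexA i (a + 1) = vertexB a i (i + 1) by simp [vertexA, vertexB]; omega] at this
      rw [this, ← plucker_one_left, div_self hd, (mem_braidVariety_iff x).1 hx]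
      simp
    · rw [show vertexB a i p = p + a - 1 from if_neg (by omega)]
      simp only [glueVec]
      rw [if_neg (by omega), if_neg (by omega),
        show p + a - 1 + 1 - a = p by omega]

/-- The columns of `V₁` are expanded in the basis `v_i`, `v_j / d`, whose determinant is 1. -/
theorem det₂_glueVec_A (ha : 1 ≤ a) (hi : 1 ≤ i) (hib : i ≤ b) (hx : x ∈ braidVariety a) {p q : ℕ}
    (hp : 1 ≤ p) (hp' : p ≤ a + 1) (hq : 1 ≤ q) (hq' : q ≤ a + 1) :
    det₂ (glueVec i x y (vertexA i p)) (glueVec i x y (vertexA i q)) = plucker x p q := by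
  have hd := plucker_one_last_ne_zero ha hx
  rw [glueVec_vertexA hi hp hp', glueVec_vertexA hi hq hq']
  have h := det₂_unscale (i := i) y hd i (i + 1)
  rw [gluePower_add hi hi, if_pos rfl, plucker_consecutive y i hi hib, zpow_one, mul_one] at h
  generalize plucker x 1 (a + 1) = d at *
  generalize unscale i y d i = u at *
  generalize unscale i y d (i + 1) = v at *
  have : det₂ (vec x p 0 • u + (vec x p 1 / d) • v) (vec x q 0 • u + (vec x q 1 / d) • v) =
      plucker x p q * (det₂ u v / d) := by
    simp only [det₂, plucker, Pi.add_apply, Pi.smul_apply, smul_eq_mul]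
    field_simp
    ring
  rw [this, h, div_self hd, mul_one]

theorem det₂_glueVec_B (ha : 1 ≤ a) (hi : 1 ≤ i) (hx : x ∈ braidVariety a) (p q : ℕ) :
    det₂ (glueVec i x y (vertexB a i p)) (glueVec i x y (vertexB a i q)) =
      plucker x 1 (a + 1) ^ (gluePower i p + gluePower i q + glueShear i) * plucker y p q := by
  rw [glueVec_vertexB ha hi hx, glueVec_vertexB ha hi hx,
    det₂_unscale y (plucker_one_last_ne_zero ha hx)]

/-- Each side `(m, m+1)` of the large polygon is a side of exactly one of the two pieces. -/
theorem det₂_glueVec_succ (ha : 1 ≤ a) (hi : 1 ≤ i) (hib : i ≤ b) (hx : x ∈ braidVariety a)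
    {m : ℕ} (hm : 1 ≤ m) (hm' : m ≤ a + b - 1) :
    det₂ (glueVec i x y m) (glueVec i x y (m + 1)) = 1 := by
  by_cases h : i ≤ m ∧ m < i + a
  · have := det₂_glueVec_A (y := y) ha hi hib hx (p := m + 1 - i) (q := m + 1 - i + 1) (by omega)
      (by omega) (by omega) (by omega)
    rw [plucker_consecutive x _ (by omega) (by omega)] at this
    rw [← this]
    simp only [vertexA]
    congr 2 <;> omega
  · obtain ⟨p, hp, hp', hpi, h1, h2⟩ : ∃ p, 1 ≤ p ∧ p ≤ b ∧ p ≠ i ∧ vertexB a i p = m ∧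
        vertexB a i (p + 1) = m + 1 := by
      rcases lt_or_ge m i with h' | h'
      · refine ⟨m, hm, by omega, by omega, ?_, ?_⟩ <;> simp only [vertexB] <;> split_ifs <;> omega
      · refine ⟨m + 1 - a, by omega, by omega, by omega, ?_, ?_⟩ <;> simp only [vertexB] <;>
          split_ifs <;> omega
    have := det₂_glueVec_B (y := y) ha hi hx p (p + 1)
    rwa [h1, h2, gluePower_add hi hp, if_neg hpi, plucker_consecutive y p hp hp', zpow_zero,
      mul_one] at this

theorem vec_glue (ha : 1 ≤ a) (hi : 1 ≤ i) (hib : i ≤ b) (hx : x ∈ braidVariety a)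
    {m : ℕ} (hm : 1 ≤ m) (hm' : m ≤ a + b) : vec (glue a b i x y) m = glueVec i x y m := by
  refine vec_parameters (glueVec i x y) ?_ (fun m h1 h2 => det₂_glueVec_succ ha hi hib hx h1 h2)
    m hm (by omega)
  have := glueVec_vertexB (y := y) ha hi hx (p := 1)
  rw [show vertexB a i 1 = 1 by simp [vertexB, hi]] at this
  rw [this, unscale_eq, gluePower_of_le hi, vec_one]
  simp

theorem plucker_glue_A (ha : 1 ≤ a) (hi : 1 ≤ i) (hib : i ≤ b)
    (hx : x ∈ braidVariety a) {p q : ℕ} (hp : 1 ≤ p) (hp' : p ≤ a + 1) (hq : 1 ≤ q)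
    (hq' : q ≤ a + 1) :
    plucker (glue a b i x y) (vertexA i p) (vertexA i q) = plucker x p q := by
  have h1 := vertexA_bounds (a := a) hi hp hp'
  have h2 := vertexA_bounds (a := a) hi hq hq'
  rw [plucker, vec_glue ha hi hib hx (by omega) (by omega),
    vec_glue ha hi hib hx (by omega) (by omega), det₂_glueVec_A ha hi hib hx hp hp' hq hq']

theorem plucker_glue_B (ha : 1 ≤ a) (hi : 1 ≤ i) (hib : i ≤ b)
    (hx : x ∈ braidVariety a) {p q : ℕ} (hp : 1 ≤ p) (hp' : p ≤ b + 1) (hq : 1 ≤ q)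
    (hq' : q ≤ b + 1) :
    plucker (glue a b i x y) (vertexB a i p) (vertexB a i q) =
      plucker x 1 (a + 1) ^ (gluePower i p + gluePower i q + glueShear i) * plucker y p q := by
  have h1 := vertexB_cases (a := a) (i := i) ha p
  have h2 := vertexB_cases (a := a) (i := i) ha q
  rw [plucker, vec_glue ha hi hib hx (by omega) (by omega),
    vec_glue ha hi hib hx (by omega) (by omega), det₂_glueVec_B ha hi hx]

theorem glue_mem_cutLocus (ha : 1 ≤ a) (hi : 1 ≤ i) (hib : i ≤ b)
    (hx : x ∈ braidVariety a) (hy : y ∈ braidVariety b) :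
    glue a b i x y ∈ cutLocus (a + b - 1) i (i + a) := by
  constructor
  · rw [mem_braidVariety_iff, vec_glue ha hi hib hx (by omega) (by omega)]
    have := glueVec_vertexB (y := y) ha hi hx (p := b + 1)
    rw [show vertexB a i (b + 1) = a + b - 1 + 1 by simp only [vertexB]; split_ifs <;> omega] at this
    rw [this, unscale_eq]
    simp [(mem_braidVariety_iff y).1 hy]
  · have := plucker_glue_A (y := y) ha hi hib hx le_rfl (by omega : 1 ≤ a + 1)
      (by omega : 1 ≤ a + 1) le_rfl
    rw [show vertexA i 1 = i by simp [vertexA],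
      show vertexA i (a + 1) = i + a by simp only [vertexA]; omega] at this
    rw [this]
    exact plucker_one_last_ne_zero ha hx

/-- The minors of the first piece are unchanged, so all scaling factors are 1. -/
theorem cutA_glue (ha : 1 ≤ a) (hi : 1 ≤ i) (hib : i ≤ b)
    (hx : x ∈ braidVariety a) : cutA a b i (glue a b i x y) = x := by
  refine toBraid_eq ha hx (fun _ => 1) 1 one_ne_zero rfl rfl (fun _ _ _ => one_ne_zero) ?_
  intro p q hp hp' hq hq'
  rw [one_mul, one_mul, one_mul]
  exact plucker_glue_A ha hi hib hx hp hp' hq hq'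

/-- The column factors and the determinant of the row operation are powers of `Δ_{ij}`, equal to 1
on the first two columns, so the normalisation removes them. -/
theorem cutB_glue (ha : 1 ≤ a) (hb : 1 ≤ b) (hi : 1 ≤ i) (hib : i ≤ b)
    (hx : x ∈ braidVariety a) (hy : y ∈ braidVariety b) : cutB a b i (glue a b i x y) = y := by
  have hd := plucker_one_last_ne_zero ha hx
  refine toBraid_eq hb hy (fun m => plucker x 1 (a + 1) ^ gluePower i m)
    (plucker x 1 (a + 1) ^ glueShear i) (zpow_ne_zero _ hd) ?_ ?_ (fun _ _ _ => zpow_ne_zero _ hd) ?_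
  · rw [gluePower_of_le hi, zpow_zero]
  · rw [gluePower_two hi, zpow_zero]
  · intro p q hp hp' hq hq'
    rw [← zpow_add₀ hd, ← zpow_add₀ hd]
    exact plucker_glue_B ha hi hib hx hp hp' hq hq'

/-- The vectors of the first component of the cut. -/
theorem vec_cutA (ha : 1 ≤ a) (hi : 1 ≤ i) (hib : i ≤ b) {z : Fin (a + b - 1) → ℂ}
    (hz : z ∈ cutLocus (a + b - 1) i (i + a)) :
    cutA a b i z ∈ braidVariety a ∧ ∀ m, 1 ≤ m → m ≤ a + 1 → vec (cutA a b i z) m =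
      ![plucker z (vertexA i m) (i + a) / plucker z i (i + a), plucker z i (vertexA i m)] := by
  have e1 : vertexA i 1 = i := by simp [vertexA]
  have e2 : vertexA i (a + 1) = i + a := by simp only [vertexA]; omega
  have hc : ∀ m, 1 ≤ m → m ≤ a → det₂ (vec z (vertexA i m)) (vec z (vertexA i (m + 1))) = 1 := by
    intro m hm hm'
    obtain ⟨h1, h2, h3⟩ := vertexA_bounds (a := a) hi hm (by omega)
    rw [show vertexA i (m + 1) = vertexA i m + 1 by simp only [vertexA]; omega]
    exact plucker_consecutive z _ (by omega) (by omega)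
  have hn : det₂ (vec z (vertexA i 1)) (vec z (vertexA i (a + 1))) ≠ 0 := by
    rw [e1, e2]; exact hz.2
  obtain ⟨h1, h2⟩ := vec_toBraid ha (v := fun m => vec z (vertexA i m))
    (fun m hm hm' => by rw [hc m hm hm']; exact one_ne_zero) hn
  refine ⟨h1, fun m hm hm' => ?_⟩
  rw [cutA, h2 m hm hm']
  -- Consecutive minors of `V₁` are already 1, so no rescaling occurs.
  have hr := rescaleFactor_mul_eq_one (standardForm (a + 1) fun m => vec z (vertexA i m))
    (fun _ => 1) (k := a) rfl rfl (fun _ _ _ => one_ne_zero)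
    (fun l hl hl' => by
      rw [det₂_standardForm hn, hc l (by omega) hl', hc 1 le_rfl ha]; norm_num) m hm hm'
  rw [mul_one] at hr
  rw [hr, one_smul, standardForm, hc 1 le_rfl ha, e1, e2, div_one]
  rfl

/-- The vectors of the second component of the cut. -/
theorem vec_cutB (ha : 1 ≤ a) (hb : 1 ≤ b) (hi : 1 ≤ i) (hib : i ≤ b) {z : Fin (a + b - 1) → ℂ}
    (hz : z ∈ cutLocus (a + b - 1) i (i + a)) :
    cutB a b i z ∈ braidVariety b ∧ ∀ m, 1 ≤ m → m ≤ b + 1 → vec (cutB a b i z) m =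
      plucker z i (i + a) ^ (-gluePower i m) •
        ![vec z (vertexB a i m) 0, plucker z i (i + a) ^ (-glueShear i) * vec z (vertexB a i m) 1] := by
  have e1 : vertexB a i 1 = 1 := by simp [vertexB, hi]
  have e2 : vertexB a i (b + 1) = a + b - 1 + 1 := by
    simp only [vertexB]; split_ifs <;> omega
  have hd := hz.2
  have hlast := plucker_one_last_ne_zero (by omega) hz.1
  have hc : ∀ m, 1 ≤ m → m ≤ b → det₂ (vec z (vertexB a i m)) (vec z (vertexB a i (m + 1))) =
      plucker z i (i + a) ^ (if m = i then (1 : ℤ) else 0) := by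
    intro m hm hm'
    split_ifs with h
    · subst h
      rw [show vertexB a m m = m by simp [vertexB],
        show vertexB a m (m + 1) = m + a by simp only [vertexB]; split_ifs <;> omega, zpow_one]
      rfl
    · have h1 := vertexB_cases (a := a) (i := i) ha m
      rw [show vertexB a i (m + 1) = vertexB a i m + 1 by
        simp only [vertexB]; split_ifs <;> omega, zpow_zero]
      exact plucker_consecutive z _ (by omega) (by omega)
  -- The minor `Δ₁₂` of `V₂` is `Δ_{ij}` for `i = 1` and 1 otherwise; this is what `glueShear`
  -- records.
  have hc1 : det₂ (vec z (vertexB a i 1)) (vec z (vertexB a i (1 + 1))) =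
      plucker z i (i + a) ^ glueShear i := by
    rw [hc 1 le_rfl hb, ← gluePower_add hi le_rfl, gluePower_of_le hi, gluePower_two hi, zero_add,
      zero_add]
  have hn : det₂ (vec z (vertexB a i 1)) (vec z (vertexB a i (b + 1))) ≠ 0 := by
    rw [e1, e2]; exact hlast
  obtain ⟨h1, h2⟩ := vec_toBraid hb (v := fun m => vec z (vertexB a i m))
    (fun m hm hm' => by rw [hc m hm hm']; exact zpow_ne_zero _ hd) hn
  refine ⟨h1, fun m hm hm' => ?_⟩
  rw [cutB, h2 m hm hm']
  have hr := rescaleFactor_mul_eq_one (standardForm (b + 1) fun m => vec z (vertexB a i m))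
    (fun m => plucker z i (i + a) ^ gluePower i m) (k := b)
    (by rw [gluePower_of_le hi, zpow_zero]) (by rw [gluePower_two hi, zpow_zero])
    (fun _ _ _ => zpow_ne_zero _ hd)
    (fun l hl hl' => by
      rw [det₂_standardForm hn, hc l (by omega) hl', hc1, ← zpow_sub₀ hd, ← zpow_add₀ hd,
        ← gluePower_add hi (by omega), add_sub_cancel_right]) m hm hm'
  rw [zpow_neg, ← eq_inv_of_mul_eq_one_left hr]
  congr 1
  rw [plucker_one_left] at hlast
  rw [standardForm, hc1, zpow_neg, e1, e2]
  ext s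
  fin_cases s
  · simp [det₂, vec_one, (mem_braidVariety_iff z).1 hz.1, hlast]
  · simp only [det₂, vec_one, Fin.mk_one, Matrix.cons_val_one, Matrix.cons_val_zero]
    field_simp
    ring

theorem glue_cut (ha : 1 ≤ a) (hb : 1 ≤ b) (hi : 1 ≤ i) (hib : i ≤ b) {z : Fin (a + b - 1) → ℂ}
    (hz : z ∈ cutLocus (a + b - 1) i (i + a)) :
    glue a b i (cutA a b i z) (cutB a b i z) = z := by
  obtain ⟨hA, vA⟩ := vec_cutA ha hi hib hz
  obtain ⟨hB, vB⟩ := vec_cutB ha hb hi hib hz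
  have hd := hz.2
  have hdA : plucker (cutA a b i z) 1 (a + 1) = plucker z i (i + a) := by
    rw [plucker_one_left, vA (a + 1) (by omega) le_rfl,
      show vertexA i (a + 1) = i + a by simp only [vertexA]; omega]
    rfl
  -- The powers of `Δ_{ij}` in `unscale` are inverse to those introduced by the normalisation.
  have hU : ∀ m, 1 ≤ m → m ≤ b + 1 →
      unscale i (cutB a b i z) (plucker z i (i + a)) m = vec z (vertexB a i m) := by
    intro m hm hm'
    rw [unscale_eq, vB m hm hm', zpow_neg, zpow_neg]
    have h1 := zpow_ne_zero (gluePower i m) hd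
    have h2 := zpow_ne_zero (glueShear i) hd
    generalize plucker z i (i + a) ^ gluePower i m = u at *
    generalize plucker z i (i + a) ^ glueShear i = v at *
    ext s
    fin_cases s <;> simp <;> field_simp
  refine parameters_eq_of_vec z _ fun m hm hm' => ?_
  by_cases h : i ≤ m ∧ m ≤ i + a
  · have := glueVec_vertexA (x := cutA a b i z) (y := cutB a b i z) hi (p := m + 1 - i)
      (by omega) (by omega)
    have e : vertexA i (m + 1 - i) = m := by simp only [vertexA]; omega
    rw [hdA, vA _ (by omega) (by omega), hU i hi (by omega), hU (i + 1) (by omega) (by omega), e,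
      show vertexB a i i = i by simp [vertexB],
      show vertexB a i (i + 1) = i + a by simp only [vertexB]; split_ifs <;> omega] at this
    rw [this]
    -- Cramer's rule: `v_m = (Δ_{mj} / Δ_{ij}) v_i + (Δ_{im} / Δ_{ij}) v_j`.
    ext s
    fin_cases s <;>
    · simp only [Fin.zero_eta, Fin.mk_one, Fin.isValue, Pi.add_apply, Pi.smul_apply, smul_eq_mul,
        Matrix.cons_val_zero, Matrix.cons_val_one]
      field_simp
      simp only [plucker, det₂]
      ring
  · obtain ⟨p, hp, hp', h1⟩ : ∃ p, 1 ≤ p ∧ p ≤ b + 1 ∧ vertexB a i p = m := by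
      rcases lt_or_ge m i with h' | h'
      · refine ⟨m, hm, by omega, ?_⟩; simp only [vertexB]; split_ifs <;> omega
      · refine ⟨m + 1 - a, by omega, by omega, ?_⟩; simp only [vertexB]; split_ifs <;> omega
    rw [← h1, glueVec_vertexB ha hi hA, hdA, hU p hp hp']

/-- The gluing map as a bijection. -/
noncomputable def glueEquiv (ha : 1 ≤ a) (hb : 1 ≤ b) (hi : 1 ≤ i) (hib : i ≤ b) :
    braidVariety a × braidVariety b ≃ cutLocus (a + b - 1) i (i + a) where
  toFun p := ⟨glue a b i p.1 p.2, glue_mem_cutLocus ha hi hib p.1.2 p.2.2⟩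
  invFun z := (⟨cutA a b i z, (vec_cutA ha hi hib z.2).1⟩,
    ⟨cutB a b i z, (vec_cutB ha hb hi hib z.2).1⟩)
  left_inv p := Prod.ext (Subtype.ext (cutA_glue ha hi hib p.1.2))
    (Subtype.ext (cutB_glue ha hb hi hib p.1.2 p.2.2))
  right_inv z := Subtype.ext (glue_cut ha hb hi hib z.2)

end Glue

/-! ### Regular functions -/

section FunctionAlgebras

variable {V : Type*} {B : Subalgebra ℂ (V → ℂ)}

/-- Evaluation of the functions in an algebra of functions at a point. -/
def evalAt (B : Subalgebra ℂ (V → ℂ)) (p : V) : B →ₐ[ℂ] ℂ :=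
  (Pi.evalAlgHom ℂ (fun _ : V => ℂ) p).comp B.val

theorem ext_evalAt {f g : B} (h : ∀ p, f.1 p = g.1 p) : f = g := Subtype.ext (funext h)

theorem vec_mem {k : ℕ} {z : V → Fin k → ℂ} (h : ∀ l, (fun p => z p l) ∈ B) (m : ℕ) (s : Fin 2) :
    (fun p => vec (z p) m s) ∈ B := by
  have : (fun p => vec (z p) m s) = (vec (fun l => (⟨_, h l⟩ : B)) m s).1 := by
    funext p
    exact vec_map (evalAt B p).toRingHom (fun l => (⟨_, h l⟩ : B)) m s
  rw [this]
  exact Subtype.property _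

theorem det₂_mem {u v : V → Fin 2 → ℂ} (hu : ∀ s, (fun p => u p s) ∈ B)
    (hv : ∀ s, (fun p => v p s) ∈ B) : (fun p => det₂ (u p) (v p)) ∈ B :=
  B.sub_mem (B.mul_mem (hu 0) (hv 1)) (B.mul_mem (hu 1) (hv 0))

theorem plucker_mem {k : ℕ} {z : V → Fin k → ℂ} (h : ∀ l, (fun p => z p l) ∈ B) (m n : ℕ) :
    (fun p => plucker (z p) m n) ∈ B :=
  det₂_mem (vec_mem h m) (vec_mem h n)

/-- Regularity of a map into a braid variety can be tested on its vectors, for which explicit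
formulas are available. -/
theorem coord_mem_of_vec_mem {k : ℕ} {z : V → Fin k → ℂ}
    (h : ∀ m, 1 ≤ m → m ≤ k + 1 → ∀ s, (fun p => vec (z p) m s) ∈ B) (l : Fin k) :
    (fun p => z p l) ∈ B := by
  obtain ⟨l, hl⟩ := l
  cases l with
  | zero =>
    have := h 2 (by omega) (by omega) 0
    simp only [vec_two _ hl] at this
    exact this
  | succ l =>
    simp only [coord_succ_eq_plucker _ l hl]
    exact det₂_mem (h _ (by omega) (by omega)) (h _ (by omega) (by omega))

theorem zpow_mem_of_inv_mem {d : V → ℂ} (h : d ∈ B) (h' : (fun p => (d p)⁻¹) ∈ B) (n : ℤ) :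
    (fun p => d p ^ n) ∈ B := by
  obtain ⟨n, rfl | rfl⟩ := n.eq_nat_or_neg
  · simp only [zpow_natCast]
    exact B.pow_mem h n
  · simp only [zpow_neg, zpow_natCast, ← inv_pow]
    exact B.pow_mem h' n

end FunctionAlgebras

/-! ### Gluing and cutting are given by regular functions. -/

section Pullback

variable {a b i : ℕ}

theorem coordA_mem (l : Fin a) : (fun p : braidVariety a × braidVariety b => p.1.1 l) ∈
    productRing a b := (productCoordA a b l).2

theorem coordB_mem (l : Fin b) : (fun p : braidVariety a × braidVariety b => p.2.1 l) ∈
    productRing a b := (productCoordB a b l).2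

theorem inv_pluckerA_mem (ha : 1 ≤ a) :
    (fun p : braidVariety a × braidVariety b => (plucker p.1.1 1 (a + 1))⁻¹) ∈ productRing a b := by
  simp only [inv_plucker_one_last ha (Subtype.property _)]
  exact vec_mem coordA_mem a 0

theorem inv_pluckerB_mem (hb : 1 ≤ b) :
    (fun p : braidVariety a × braidVariety b => (plucker p.2.1 1 (b + 1))⁻¹) ∈ productRing a b := by
  simp only [inv_plucker_one_last hb (Subtype.property _)]
  exact vec_mem coordB_mem b 0

theorem unscale_mem (ha : 1 ≤ a) (m : ℕ) (s : Fin 2) :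
    (fun p : braidVariety a × braidVariety b => unscale i p.2.1 (plucker p.1.1 1 (a + 1)) m s) ∈
      productRing a b := by
  have hd : (fun p : braidVariety a × braidVariety b => plucker p.1.1 1 (a + 1)) ∈
    productRing a b := plucker_mem coordA_mem _ _
  have hz := zpow_mem_of_inv_mem hd (inv_pluckerA_mem ha)
  simp only [unscale_eq]
  fin_cases s
  · exact Subalgebra.mul_mem _ (hz _) (vec_mem coordB_mem m 0)
  · exact Subalgebra.mul_mem _ (hz _) (Subalgebra.mul_mem _ (hz _) (vec_mem coordB_mem m 1))

theorem glueVec_mem (ha : 1 ≤ a) (m : ℕ) (s : Fin 2) :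
    (fun p : braidVariety a × braidVariety b => glueVec i p.1.1 p.2.1 m s) ∈ productRing a b := by
  by_cases h1 : m < i
  · simp only [glueVec, if_pos h1]
    exact unscale_mem ha m s
  by_cases h2 : m ≤ i + a
  · simp only [glueVec, if_neg h1, if_pos h2, div_eq_mul_inv]
    exact Subalgebra.add_mem _ (Subalgebra.mul_mem _ (vec_mem coordA_mem _ 0) (unscale_mem ha _ s))
      (Subalgebra.mul_mem _ (Subalgebra.mul_mem _ (vec_mem coordA_mem _ 1) (inv_pluckerA_mem ha))
        (unscale_mem ha _ s))
  · simp only [glueVec, if_neg h1, if_neg h2]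
    exact unscale_mem ha _ s

theorem comp_glueEquiv_mem (ha : 1 ≤ a) (hb : 1 ≤ b) (hi : 1 ≤ i) (hib : i ≤ b)
    {f : cutLocus (a + b - 1) i (i + a) → ℂ} (hf : f ∈ cutLocusRing (a + b - 1) i (i + a)) :
    (fun p => f (glueEquiv ha hb hi hib p)) ∈ productRing a b := by
  refine Algebra.adjoin_induction (p := fun f _ =>
    (fun p => f (glueEquiv ha hb hi hib p)) ∈ productRing a b) ?_ ?_ ?_ ?_ hf
  · rintro f (⟨l, rfl⟩ | rfl)
    · refine coord_mem_of_vec_mem (z := fun p : braidVariety a × braidVariety b =>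
        glue a b i p.1.1 p.2.1) (fun m hm hm' s => ?_) l
      simp only [vec_glue ha hi hib (Subtype.property _) hm (by omega : m ≤ a + b)]
      exact glueVec_mem ha m s
    -- `Δ_{ij}` pulls back to the frozen variable of the first factor, whose inverse is a
    -- polynomial.
    · have : ∀ p : braidVariety a × braidVariety b,
          plucker (glueEquiv ha hb hi hib p).1 i (i + a) = plucker p.1.1 1 (a + 1) := by
        intro p
        rw [← plucker_glue_A (y := p.2.1) ha hi hib p.1.2 le_rfl (by omega : 1 ≤ a + 1)
          (by omega : 1 ≤ a + 1) le_rfl, show vertexA i 1 = i by simp [vertexA],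
          show vertexA i (a + 1) = i + a by simp only [vertexA]; omega]
        rfl
      simp only [this]
      exact inv_pluckerA_mem ha
  · exact fun r => Subalgebra.algebraMap_mem _ r
  · exact fun f g _ _ hf hg => Subalgebra.add_mem _ hf hg
  · exact fun f g _ _ hf hg => Subalgebra.mul_mem _ hf hg

theorem comp_glueEquiv_symm_mem (ha : 1 ≤ a) (hb : 1 ≤ b) (hi : 1 ≤ i) (hib : i ≤ b)
    {f : braidVariety a × braidVariety b → ℂ} (hf : f ∈ productRing a b) :
    (fun z => f ((glueEquiv ha hb hi hib).symm z)) ∈ cutLocusRing (a + b - 1) i (i + a) := by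
  have hz : ∀ l, (fun z : cutLocus (a + b - 1) i (i + a) => z.1 l) ∈
      cutLocusRing (a + b - 1) i (i + a) := fun l => (cutLocusCoord (a + b - 1) i (i + a) l).2
  have hd : (fun z : cutLocus (a + b - 1) i (i + a) => (plucker z.1 i (i + a))⁻¹) ∈
      cutLocusRing (a + b - 1) i (i + a) := Algebra.subset_adjoin (Or.inr rfl)
  have hpow := zpow_mem_of_inv_mem (plucker_mem hz i (i + a)) hd
  refine Algebra.adjoin_induction (p := fun f _ =>
    (fun z => f ((glueEquiv ha hb hi hib).symm z)) ∈ cutLocusRing (a + b - 1) i (i + a)) ?_ ?_ ?_ ?_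
    hf
  · rintro f (⟨l, rfl⟩ | ⟨l, rfl⟩)
    · refine coord_mem_of_vec_mem (z := fun z : cutLocus (a + b - 1) i (i + a) =>
        cutA a b i z.1) (fun m hm hm' s => ?_) l
      simp only [(vec_cutA ha hi hib (Subtype.property _)).2 m hm hm']
      fin_cases s
      · exact Subalgebra.mul_mem _ (plucker_mem hz _ _) hd
      · exact plucker_mem hz _ _
    · refine coord_mem_of_vec_mem (z := fun z : cutLocus (a + b - 1) i (i + a) =>
        cutB a b i z.1) (fun m hm hm' s => ?_) l
      simp only [(vec_cutB ha hb hi hib (Subtype.property _)).2 m hm hm']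
      fin_cases s
      · exact Subalgebra.mul_mem _ (hpow _) (vec_mem hz _ _)
      · exact Subalgebra.mul_mem _ (hpow _) (Subalgebra.mul_mem _ (hpow _) (vec_mem hz _ _))
  · exact fun r => Subalgebra.algebraMap_mem _ r
  · exact fun f g _ _ hf hg => Subalgebra.add_mem _ hf hg
  · exact fun f g _ _ hf hg => Subalgebra.mul_mem _ hf hg

/-- The isomorphism of rings of regular functions induced by the gluing map. -/
noncomputable def gluePullback (ha : 1 ≤ a) (hb : 1 ≤ b) (hi : 1 ≤ i) (hib : i ≤ b) :
    cutLocusRing (a + b - 1) i (i + a) ≃ₐ[ℂ] productRing a b where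
  toFun f := ⟨fun p => f.1 (glueEquiv ha hb hi hib p), comp_glueEquiv_mem ha hb hi hib f.2⟩
  invFun f := ⟨fun z => f.1 ((glueEquiv ha hb hi hib).symm z),
    comp_glueEquiv_symm_mem ha hb hi hib f.2⟩
  left_inv f := Subtype.ext (funext fun z => congrArg f.1 (Equiv.apply_symm_apply _ z))
  right_inv f := Subtype.ext (funext fun p => congrArg f.1 (Equiv.symm_apply_apply _ p))
  map_mul' _ _ := rfl
  map_add' _ _ := rfl
  commutes' _ := rfl

end Pullback

/-! ### The product of braid varieties is irreducible -/

section Irreducible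

/-- The vector `v_m` depends only on the first `m - 1` coordinates. -/
theorem vec_castSucc {R : Type*} [CommRing R] {k : ℕ} (z : Fin (k + 1) → R) {m : ℕ} (hm : 1 ≤ m)
    (hm' : m ≤ k + 1) : vec (fun l => z (Fin.castSucc l)) m = vec z m := by
  refine vec_eq_of_consecutive _ (vec z) (vec_one z) (fun m h1 h2 =>
    plucker_consecutive z m h1 (by omega)) (fun h => ?_) (fun m h => ?_) m hm hm'
  · rw [vec_two z (by omega)]; rfl
  · rw [Fin.castSucc_mk, coord_succ_eq_plucker z m (by omega)]; rfl

theorem vec_last {R : Type*} [CommRing R] {m : ℕ} (z : Fin (m + 2) → R) :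
    vec z (m + 3) = z (Fin.last (m + 1)) • vec z (m + 2) - vec z (m + 1) :=
  vec_add_three z m (by omega)

/-- A point of the braid variety is determined by its first coordinates. -/
theorem exists_mem_braidVariety_castSucc {m : ℕ} (u : Fin (m + 1) → ℂ)
    (hu : vec u (m + 2) 0 ≠ 0) :
    ∃ z ∈ braidVariety (m + 2), (fun l => z (Fin.castSucc l)) = u := by
  -- The last coordinate solves the linear equation `(v_{k+1})₀ = z_k (v_k)₀ - (v_{k-1})₀ = 0`.
  let z : Fin (m + 2) → ℂ := Fin.snoc u (vec u (m + 1) 0 / vec u (m + 2) 0)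
  have hz : (fun l => z (Fin.castSucc l)) = u := by
    funext l; exact Fin.snoc_castSucc (α := fun _ => ℂ) _ _ l
  refine ⟨z, ?_, hz⟩
  have h1 := vec_castSucc z (m := m + 1) (by omega) (by omega)
  have h2 := vec_castSucc z (m := m + 2) (by omega) (by omega)
  rw [hz] at h1 h2
  rw [mem_braidVariety_iff, vec_last, ← h1, ← h2,
    show z (Fin.last (m + 1)) = vec u (m + 1) 0 / vec u (m + 2) 0 from
      Fin.snoc_last (α := fun _ => ℂ) _ _]
  simp [hu]

theorem vec_castSucc_ne_zero {m : ℕ} {z : Fin (m + 2) → ℂ} (hz : z ∈ braidVariety (m + 2)) :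
    vec (fun l => z (Fin.castSucc l)) (m + 2) 0 ≠ 0 := by
  rw [vec_castSucc z (by omega) (by omega)]
  exact right_ne_zero_of_mul_eq_one
    (plucker_one_last_mul (by omega) z ((mem_braidVariety_iff z).1 hz))

theorem last_mul_vec {m : ℕ} {z : Fin (m + 2) → ℂ} (hz : z ∈ braidVariety (m + 2)) :
    z (Fin.last (m + 1)) * vec (fun l => z (Fin.castSucc l)) (m + 2) 0 =
      vec (fun l => z (Fin.castSucc l)) (m + 1) 0 := by
  have := (mem_braidVariety_iff z).1 hz
  rw [vec_last] at this
  rw [vec_castSucc z (by omega) (by omega), vec_castSucc z (by omega) (by omega)]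
  simpa [sub_eq_zero] using this

variable {m n : ℕ}

/-- The coordinates on the product other than the last ones of the two factors. -/
def freeCoord (p : braidVariety (m + 2) × braidVariety (n + 2)) : Fin (m + 1) ⊕ Fin (n + 1) → ℂ :=
  Sum.elim (fun l => p.1.1 (Fin.castSucc l)) (fun l => p.2.1 (Fin.castSucc l))

/-- The polynomials `(v_k)₁` of the two factors. -/
noncomputable def denominatorA (m n j : ℕ) : MvPolynomial (Fin (m + 1) ⊕ Fin (n + 1)) ℂ :=
  vec (fun l => MvPolynomial.X (Sum.inl l)) j 0

/-- See `denominatorA`. -/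
noncomputable def denominatorB (m n j : ℕ) : MvPolynomial (Fin (m + 1) ⊕ Fin (n + 1)) ℂ :=
  vec (fun l => MvPolynomial.X (Sum.inr l)) j 0

theorem eval_denominatorA (u : Fin (m + 1) ⊕ Fin (n + 1) → ℂ) (j : ℕ) :
    MvPolynomial.eval u (denominatorA m n j) = vec (fun l => u (Sum.inl l)) j 0 := by
  rw [denominatorA, ← vec_map]
  simp

theorem eval_denominatorB (u : Fin (m + 1) ⊕ Fin (n + 1) → ℂ) (j : ℕ) :
    MvPolynomial.eval u (denominatorB m n j) = vec (fun l => u (Sum.inr l)) j 0 := by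
  rw [denominatorB, ← vec_map]
  simp

/-- The common denominator of the regular functions on the product. -/
noncomputable def denominator (m n : ℕ) : MvPolynomial (Fin (m + 1) ⊕ Fin (n + 1)) ℂ :=
  denominatorA m n (m + 2) * denominatorB m n (n + 2)

theorem eval_denominator_ne_zero (p : braidVariety (m + 2) × braidVariety (n + 2)) :
    MvPolynomial.eval (freeCoord p) (denominator m n) ≠ 0 := by
  rw [denominator, map_mul, eval_denominatorA, eval_denominatorB]
  exact mul_ne_zero (vec_castSucc_ne_zero p.1.2) (vec_castSucc_ne_zero p.2.2)

theorem exists_freeCoord_eq {u : Fin (m + 1) ⊕ Fin (n + 1) → ℂ}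
    (hu : MvPolynomial.eval u (denominator m n) ≠ 0) :
    ∃ p : braidVariety (m + 2) × braidVariety (n + 2), freeCoord p = u := by
  rw [denominator, map_mul, eval_denominatorA, eval_denominatorB] at hu
  obtain ⟨x, hx, hx'⟩ := exists_mem_braidVariety_castSucc _ (left_ne_zero_of_mul hu)
  obtain ⟨y, hy, hy'⟩ := exists_mem_braidVariety_castSucc _ (right_ne_zero_of_mul hu)
  refine ⟨(⟨x, hx⟩, ⟨y, hy⟩), ?_⟩
  funext l
  rcases l with l | l
  · exact congrFun hx' l
  · exact congrFun hy' l

theorem nonempty_product (ha : 1 ≤ m) (hb : 1 ≤ n) :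
    Nonempty (braidVariety m × braidVariety n) := by
  obtain ⟨x, hx, -⟩ := exists_mem_braidVariety_plucker m ha
  obtain ⟨y, hy, -⟩ := exists_mem_braidVariety_plucker n hb
  exact ⟨(⟨x, hx⟩, ⟨y, hy⟩)⟩

/-- A polynomial in the free coordinates which vanishes on the product is zero. -/
theorem eq_zero_of_eval_freeCoord {P : MvPolynomial (Fin (m + 1) ⊕ Fin (n + 1)) ℂ}
    (hP : ∀ p : braidVariety (m + 2) × braidVariety (n + 2),
      MvPolynomial.eval (freeCoord p) P = 0) : P = 0 := by
  -- The free coordinates fill the complement of the zeros of the denominator, so this product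
  -- vanishes on all of affine space.
  have h : P * denominator m n = 0 := by
    refine MvPolynomial.funext fun u => ?_
    rw [map_mul, map_zero]
    by_cases hu : MvPolynomial.eval u (denominator m n) = 0
    · rw [hu, mul_zero]
    · obtain ⟨p, rfl⟩ := exists_freeCoord_eq hu
      rw [hP, zero_mul]
  refine (mul_eq_zero.1 h).resolve_right fun h0 => ?_
  obtain ⟨p⟩ := nonempty_product (m := m + 2) (n := n + 2) (by omega) (by omega)
  exact eval_denominator_ne_zero p (by rw [h0, map_zero])

/-- Only the two last coordinates are not polynomials in the free ones, and each becomes one after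
multiplication by the denominator. -/
theorem exists_polynomial {f : braidVariety (m + 2) × braidVariety (n + 2) → ℂ}
    (hf : f ∈ productRing (m + 2) (n + 2)) :
    ∃ (P : MvPolynomial (Fin (m + 1) ⊕ Fin (n + 1)) ℂ) (e : ℕ), ∀ p,
      f p * MvPolynomial.eval (freeCoord p) (denominator m n) ^ e =
        MvPolynomial.eval (freeCoord p) P := by
  refine Algebra.adjoin_induction (p := fun f _ =>
    ∃ (P : MvPolynomial (Fin (m + 1) ⊕ Fin (n + 1)) ℂ) (e : ℕ), ∀ p,
      f p * MvPolynomial.eval (freeCoord p) (denominator m n) ^ e =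
        MvPolynomial.eval (freeCoord p) P) ?_ ?_ ?_ ?_ hf
  · rintro f (⟨l, rfl⟩ | ⟨l, rfl⟩)
    · refine Fin.lastCases ?_ (fun l => ?_) l
      · refine ⟨denominatorA m n (m + 1) * denominatorB m n (n + 2), 1, fun p => ?_⟩
        rw [denominator, pow_one, map_mul, map_mul, ← mul_assoc, eval_denominatorA,
          eval_denominatorA]
        congr 1
        exact last_mul_vec p.1.2
      · exact ⟨MvPolynomial.X (Sum.inl l), 0, fun p => by simp [freeCoord]⟩
    · refine Fin.lastCases ?_ (fun l => ?_) l
      · refine ⟨denominatorA m n (m + 2) * denominatorB m n (n + 1), 1, fun p => ?_⟩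
        rw [denominator, pow_one, map_mul, map_mul, mul_left_comm, eval_denominatorB,
          eval_denominatorB]
        congr 1
        exact last_mul_vec p.2.2
      · exact ⟨MvPolynomial.X (Sum.inr l), 0, fun p => by simp [freeCoord]⟩
  · exact fun r => ⟨MvPolynomial.C r, 0, fun p => by simp⟩
  · rintro f g - - ⟨P, e, hP⟩ ⟨Q, e', hQ⟩
    refine ⟨P * denominator m n ^ e' + Q * denominator m n ^ e, e + e', fun p => ?_⟩
    simp only [map_add, map_mul, map_pow, ← hP, ← hQ, Pi.add_apply]
    ring
  · rintro f g - - ⟨P, e, hP⟩ ⟨Q, e', hQ⟩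
    refine ⟨P * Q, e + e', fun p => ?_⟩
    simp only [map_mul, ← hP, ← hQ, Pi.mul_apply]
    ring

/-- After clearing denominators, a product of regular functions vanishes only if a product of
polynomials does. -/
theorem isDomain_productRing_aux : IsDomain (productRing (m + 2) (n + 2)) := by
  have := nonempty_product (m := m + 2) (n := n + 2) (by omega) (by omega)
  have : NoZeroDivisors (productRing (m + 2) (n + 2)) := by
    refine ⟨fun {f g} hfg => ?_⟩
    obtain ⟨P, e, hP⟩ := exists_polynomial f.2
    obtain ⟨Q, e', hQ⟩ := exists_polynomial g.2
    have h0 : P * Q = 0 := eq_zero_of_eval_freeCoord fun p => by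
      have : f.1 p * g.1 p = 0 := congrFun (congrArg Subtype.val hfg) p
      rw [map_mul, ← hP, ← hQ]
      linear_combination (MvPolynomial.eval (freeCoord p) (denominator m n) ^ e *
        MvPolynomial.eval (freeCoord p) (denominator m n) ^ e') * this
    have key : ∀ (f : productRing (m + 2) (n + 2)) (e : ℕ), (∀ p,
        f.1 p * MvPolynomial.eval (freeCoord p) (denominator m n) ^ e =
          MvPolynomial.eval (freeCoord p) 0) → f = 0 := fun f e h => ext_evalAt fun p => by
      have := h p
      rw [map_zero] at this
      exact (mul_eq_zero.1 this).resolve_right (pow_ne_zero _ (eval_denominator_ne_zero p))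
    rcases mul_eq_zero.1 h0 with rfl | rfl
    · exact Or.inl (key f e hP)
    · exact Or.inr (key g e' hQ)
  exact NoZeroDivisors.to_isDomain _

theorem isDomain_productRing {a b : ℕ} (ha : 2 ≤ a) (hb : 2 ≤ b) : IsDomain (productRing a b) := by
  obtain ⟨m, rfl⟩ : ∃ m, a = m + 2 := ⟨a - 2, by omega⟩
  obtain ⟨n, rfl⟩ : ∃ n, b = n + 2 := ⟨b - 2, by omega⟩
  exact isDomain_productRing_aux

/-- A polynomial relation between these functions vanishes at all points of the product, so
`eq_zero_of_eval_freeCoord` applies. -/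
theorem algebraicIndependent_freeCoord (m n : ℕ) :
    AlgebraicIndependent ℂ (Sum.elim (fun l => productCoordA (m + 2) (n + 2) (Fin.castSucc l))
      (fun l => productCoordB (m + 2) (n + 2) (Fin.castSucc l))) := by
  rw [algebraicIndependent_iff]
  intro P hP
  refine eq_zero_of_eval_freeCoord fun p => ?_
  have h1 := congrArg (evalAt _ p) hP
  rw [map_zero, MvPolynomial.comp_aeval_apply] at h1
  have e : (fun l => evalAt (productRing (m + 2) (n + 2)) p
      (Sum.elim (fun l => productCoordA (m + 2) (n + 2) (Fin.castSucc l))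
        (fun l => productCoordB (m + 2) (n + 2) (Fin.castSucc l)) l)) = freeCoord p := by
    funext l
    rcases l with l | l <;> rfl
  rw [e] at h1
  rw [← MvPolynomial.coe_aeval_eq_eval]
  exact h1

theorem card_le_trdeg_fractionRing {A ι : Type} [Fintype ι] [CommRing A] [IsDomain A] [Algebra ℂ A]
    {c : ι → A} (hc : AlgebraicIndependent ℂ c) :
    (Fintype.card ι : Cardinal) ≤ Algebra.trdeg ℂ (FractionRing A) := by
  have := (hc.map' (f := IsScalarTower.toAlgHom ℂ A (FractionRing A))
    (IsFractionRing.injective A (FractionRing A))).cardinalMk_le_trdeg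
  simpa using this

/-- The dimension of the product of braid varieties. -/
theorem le_trdeg_productRing {a b : ℕ} (ha : 2 ≤ a) (hb : 2 ≤ b) [IsDomain (productRing a b)] :
    ((a - 1 + (b - 1) : ℕ) : Cardinal) ≤ Algebra.trdeg ℂ (FractionRing (productRing a b)) := by
  obtain ⟨m, rfl⟩ : ∃ m, a = m + 2 := ⟨a - 2, by omega⟩
  obtain ⟨n, rfl⟩ : ∃ n, b = n + 2 := ⟨b - 2, by omega⟩
  have := card_le_trdeg_fractionRing (algebraicIndependent_freeCoord m n)
  rwa [Fintype.card_sum, Fintype.card_fin, Fintype.card_fin] at this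

end Irreducible

/-! ### Frozen monomials, and transfer of cluster structures. -/

namespace Seed

section General

variable {I K : Type*}

theorem mutableList_iff {s t : Seed I K} (h : s.frozen = t.frozen) (l : List I) :
    s.MutableList l ↔ t.MutableList l := by
  simp only [MutableList, h]

variable [Fintype I] [Field K]

theorem frozenMonomials_mul_mem {s : Seed I K} (h0 : ∀ i ∈ s.frozen, s.var i ≠ 0) {x y : K}
    (hx : x ∈ s.frozenMonomials) (hy : y ∈ s.frozenMonomials) : x * y ∈ s.frozenMonomials := by
  obtain ⟨n, hn, rfl⟩ := hx
  obtain ⟨m, hm, rfl⟩ := hy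
  refine ⟨n + m, fun i hi => by simp [hn i hi, hm i hi], ?_⟩
  rw [← Finset.prod_mul_distrib]
  refine Finset.prod_congr rfl fun i _ => ?_
  by_cases hi : i ∈ s.frozen
  · rw [Pi.add_apply, zpow_add₀ (h0 i hi)]
  · simp [hn i hi, hm i hi]

theorem frozenMonomials_one_mem (s : Seed I K) : 1 ∈ s.frozenMonomials :=
  ⟨0, fun _ _ => rfl, by simp⟩

theorem frozenMonomials_zpow_mem {s : Seed I K} {x : K} (hx : x ∈ s.frozenMonomials) (m : ℤ) :
    x ^ m ∈ s.frozenMonomials := by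
  obtain ⟨n, hn, rfl⟩ := hx
  refine ⟨fun i => n i * m, fun i hi => by simp [hn i hi], ?_⟩
  rw [← Finset.prod_zpow]
  exact Finset.prod_congr rfl fun i _ => (zpow_mul _ _ _).symm

/-- The frozen monomials belong to each set closed under products which contains the frozen
variables and their inverses. -/
theorem frozenMonomials_induction {s : Seed I K} {p : K → Prop} (h1 : p 1)
    (hmul : ∀ x y, p x → p y → p (x * y)) (h : ∀ i ∈ s.frozen, p (s.var i) ∧ p (s.var i)⁻¹) {x : K}
    (hx : x ∈ s.frozenMonomials) : p x := by
  obtain ⟨n, hn, rfl⟩ := hx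
  have hpow : ∀ y (m : ℕ), p y → p (y ^ m) := fun y m hy => by
    induction m with
    | zero => rwa [pow_zero]
    | succ m ih => rw [pow_succ]; exact hmul _ _ ih hy
  refine Finset.prod_induction _ p hmul h1 fun i _ => ?_
  by_cases hi : i ∈ s.frozen
  · obtain ⟨m, hm | hm⟩ := (n i).eq_nat_or_neg
    · rw [hm, zpow_natCast]; exact hpow _ _ (h i hi).1
    · rw [hm, zpow_neg, zpow_natCast, ← inv_pow]; exact hpow _ _ (h i hi).2
  · rw [hn i hi, zpow_zero]; exact h1

/-- Nonvanishing is needed because integer powers add only for nonzero bases. -/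
theorem frozenMonomials_subset {s t : Seed I K} (h0 : ∀ i ∈ t.frozen, t.var i ≠ 0)
    (h : ∀ i ∈ s.frozen, s.var i ∈ t.frozenMonomials) : s.frozenMonomials ⊆ t.frozenMonomials :=
  fun _ hx => frozenMonomials_induction (p := (· ∈ t.frozenMonomials)) (frozenMonomials_one_mem t)
    (fun _ _ => frozenMonomials_mul_mem h0)
    (fun i hi => ⟨h i hi, by simpa using frozenMonomials_zpow_mem (h i hi) (-1)⟩) hx

variable [DecidableEq I]

theorem mutateList_cons (s : Seed I K) (k : I) (l : List I) :
    s.mutateList (k :: l) = (s.mutate k).mutateList l := rfl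

theorem mutateList_frozen (s : Seed I K) (l : List I) : (s.mutateList l).frozen = s.frozen := by
  induction l generalizing s with
  | nil => rfl
  | cons k l ih => exact ih (s.mutate k)

theorem mutateList_var_of_frozen {s : Seed I K} {l : List I} (hl : s.MutableList l) {i : I}
    (hi : i ∈ s.frozen) : (s.mutateList l).var i = s.var i := by
  induction l generalizing s with
  | nil => rfl
  | cons k l ih =>
    have hk : i ≠ k := fun h => hl k List.mem_cons_self (h ▸ hi)
    exact (ih (s := s.mutate k) (fun j hj => hl j (List.mem_cons_of_mem _ hj)) hi).trans
      (mutate_var_of_ne s hk)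

theorem frozenMonomials_var_mem {s : Seed I K} {i : I} (hi : i ∈ s.frozen) :
    s.var i ∈ s.frozenMonomials := by
  refine ⟨Pi.single i 1, fun j hj => Pi.single_eq_of_ne (fun h => hj (by rwa [h])) _, ?_⟩
  rw [Finset.prod_eq_single i]
  · simp
  · intro j _ hj; simp [hj]
  · simp

end General

section Algebraic

/-- A finite family which generates a field of the same transcendence degree is algebraically
independent. -/
theorem algebraicIndependent_of_card_le_trdeg {I K : Type} [Fintype I] [Field K] [Algebra ℂ K]
    (x : I → K) (h : IntermediateField.adjoin ℂ (Set.range x) = ⊤)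
    (hc : (Fintype.card I : Cardinal) ≤ Algebra.trdeg ℂ K) : AlgebraicIndependent ℂ x := by
  -- Field generation makes `K` algebraic over the generated algebra; a family of that kind with at
  -- most `trdeg` members is a transcendence basis.
  have : Algebra.IsAlgebraic (Algebra.adjoin ℂ (Set.range x)) K := by
    refine ⟨fun y => ?_⟩
    have hy : y ∈ IntermediateField.adjoin ℂ (Set.range x) := h ▸ IntermediateField.mem_top
    refine IntermediateField.adjoin_induction ℂ
      (p := fun y _ => IsAlgebraic (Algebra.adjoin ℂ (Set.range x)) y) ?_ ?_ ?_ ?_ ?_ hy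
    · exact fun y hy => isAlgebraic_algebraMap
        (⟨y, Algebra.subset_adjoin hy⟩ : Algebra.adjoin ℂ (Set.range x))
    · exact fun r => isAlgebraic_algebraMap (algebraMap ℂ (Algebra.adjoin ℂ (Set.range x)) r)
    · exact fun _ _ _ _ h1 h2 => h1.add h2
    · exact fun _ _ h => h.inv
    · exact fun _ _ _ _ h1 h2 => h1.mul h2
  exact (Algebra.IsAlgebraic.isTranscendenceBasis_of_le_trdeg_of_finite ℂ x (by simpa using hc)).1

variable {I K : Type} [Fintype I] [DecidableEq I] [Field K]
  {A : Type*} [CommRing A] [Algebra ℂ A] [Algebra ℂ K] [Algebra A K] {s t : Seed I K}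

theorem IsClusterStructure.frozen_ne_zero (hs : s.IsClusterStructure A) {i : I}
    (hi : i ∈ s.frozen) : s.var i ≠ 0 := by
  obtain ⟨f, hf, h⟩ := hs.frozen_unit i hi
  rw [← h]
  exact (hf.map (algebraMap A K)).ne_zero

/-- A seed which is quasi-equivalent to a seed of a cluster structure defines a cluster
structure. -/
theorem IsClusterStructure.of_clusterQuasiEquiv (hs : s.IsClusterStructure A)
    (h : t.ClusterQuasiEquiv s) : t.IsClusterStructure A := by
  have hnil : t.MutableList [] := fun k hk => absurd hk List.not_mem_nil
  have hfr : t.frozen = s.frozen := (h [] hnil).frozen_eq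
  have hmut := mutableList_iff hfr
  have hmon0 : t.frozenMonomials = s.frozenMonomials := (h [] hnil).monomials
  -- frozen monomials do not change under mutation
  have hmon : ∀ {u : Seed I K} {l : List I}, u.MutableList l →
      (u.mutateList l).frozenMonomials = u.frozenMonomials := by
    intro u l hl
    ext x
    refine exists_congr fun n => ?_
    rw [mutateList_frozen]
    refine and_congr_right fun hn => ?_
    rw [Finset.prod_congr rfl fun i _ => ?_]
    by_cases hi : i ∈ u.frozen
    · rw [mutateList_var_of_frozen hl hi]
    · rw [hn i hi, zpow_zero, zpow_zero]
  have hs0 : ∀ i ∈ s.frozen, s.var i ≠ 0 := fun i hi => hs.frozen_ne_zero hi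
  have hunit : ∀ x ∈ s.frozenMonomials, ∃ f : A, IsUnit f ∧ algebraMap A K f = x := by
    intro x hx
    refine frozenMonomials_induction (p := fun x => ∃ f : A, IsUnit f ∧ algebraMap A K f = x)
      ⟨1, isUnit_one, map_one _⟩ ?_ ?_ hx
    · rintro _ _ ⟨f, hf, rfl⟩ ⟨g, hg, rfl⟩
      exact ⟨f * g, hf.mul hg, map_mul _ _ _⟩
    · intro i hi
      obtain ⟨f, hf, hf'⟩ := hs.frozen_unit i hi
      refine ⟨⟨f, hf, hf'⟩, ?_⟩
      obtain ⟨u, rfl⟩ := hf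
      refine ⟨(u⁻¹ : Aˣ), u⁻¹.isUnit, ?_⟩
      rw [← hf', eq_comm, inv_eq_iff_eq_inv, eq_comm]
      exact inv_eq_of_mul_eq_one_left (by rw [← map_mul, Units.mul_inv, map_one])
  have hne : ∀ x ∈ s.frozenMonomials, x ≠ 0 := by
    intro x hx
    obtain ⟨f, hf, rfl⟩ := hunit x hx
    exact (hf.map (algebraMap A K)).ne_zero
  have hinv : ∀ x ∈ s.frozenMonomials, x⁻¹ ∈ s.frozenMonomials := fun x hx => by
    simpa using frozenMonomials_zpow_mem hx (-1)
  -- In every seed, corresponding variables, mutable or frozen, differ by frozen monomials. All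
  -- remaining conditions follow from this and from the invertibility of those monomials.
  have hvar_t : ∀ l, t.MutableList l → ∀ i, ∃ M ∈ s.frozenMonomials,
      (t.mutateList l).var i = M * (s.mutateList l).var i := by
    intro l hl i
    by_cases hi : i ∈ t.frozen
    · refine ⟨t.var i * (s.var i)⁻¹, frozenMonomials_mul_mem hs0
        (hmon0 ▸ frozenMonomials_var_mem hi) (hinv _ (frozenMonomials_var_mem (hfr ▸ hi))), ?_⟩
      rw [mutateList_var_of_frozen hl hi, mutateList_var_of_frozen ((hmut l).1 hl) (hfr ▸ hi),
        inv_mul_cancel_right₀ (hs0 i (hfr ▸ hi))]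
    · obtain ⟨M, hM, h'⟩ := (h l hl).proportional i (by rwa [mutateList_frozen])
      exact ⟨M, by rwa [hmon hl, hmon0] at hM, h'⟩
  have hvar_s : ∀ l, t.MutableList l → ∀ i, ∃ M ∈ s.frozenMonomials,
      (s.mutateList l).var i = M * (t.mutateList l).var i := by
    intro l hl i
    obtain ⟨M, hM, h'⟩ := hvar_t l hl i
    exact ⟨M⁻¹, hinv M hM, by rw [h', inv_mul_cancel_left₀ (hne M hM)]⟩
  have hgen : ∀ l, t.MutableList l →
      IntermediateField.adjoin ℂ (Set.range (t.mutateList l).var) = ⊤ := by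
    intro l hl
    rw [← top_le_iff, ← hs.generates_field l ((hmut l).1 hl), IntermediateField.adjoin_le_iff]
    rintro _ ⟨i, rfl⟩
    obtain ⟨M, hM, h'⟩ := hvar_s l hl i
    have hmem : ∀ i, (t.mutateList l).var i ∈
        IntermediateField.adjoin ℂ (Set.range (t.mutateList l).var) := fun i =>
      IntermediateField.subset_adjoin _ _ ⟨i, rfl⟩
    rw [← hmon0, ← hmon hl] at hM
    rw [SetLike.mem_coe, h']
    refine mul_mem (frozenMonomials_induction
      (p := (· ∈ IntermediateField.adjoin ℂ (Set.range (t.mutateList l).var)))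
      (one_mem _) (fun _ _ => mul_mem) (fun i _ => ⟨hmem i, inv_mem (hmem i)⟩) hM) (hmem i)
  -- Independence is obtained by counting: the variables of `s` already show that the transcendence
  -- degree is large enough.
  have htriv : (Fintype.card I : Cardinal) ≤ Algebra.trdeg ℂ K := by
    have := (hs.independent [] ((hmut []).1 hnil)).cardinalMk_le_trdeg
    simpa using this
  refine ⟨fun l hl => algebraicIndependent_of_card_le_trdeg _ (hgen l hl) htriv, hgen, ?_, ?_, ?_,
    ?_⟩
  · intro l hl i
    obtain ⟨M, hM, h'⟩ := hvar_t l hl i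
    obtain ⟨f, -, hf⟩ := hunit M hM
    obtain ⟨g, hg⟩ := hs.regular l ((hmut l).1 hl) i
    exact ⟨f * g, by rw [map_mul, hf, hg, h']⟩
  · intro i hi
    exact hunit _ (hmon0 ▸ frozenMonomials_var_mem hi)
  · intro l hl f
    refine Algebra.adjoin_le ?_ (hs.chart l ((hmut l).1 hl) f)
    have hmem : ∀ i, (t.mutateList l).var i ∈ Algebra.adjoin ℂ
        (Set.range (t.mutateList l).var ∪ Set.range fun i => ((t.mutateList l).var i)⁻¹) :=
      fun i => Algebra.subset_adjoin (Or.inl ⟨i, rfl⟩)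
    have hmem' : ∀ i, ((t.mutateList l).var i)⁻¹ ∈ Algebra.adjoin ℂ
        (Set.range (t.mutateList l).var ∪ Set.range fun i => ((t.mutateList l).var i)⁻¹) :=
      fun i => Algebra.subset_adjoin (Or.inr ⟨i, rfl⟩)
    have hM : ∀ M ∈ s.frozenMonomials, M ∈ Algebra.adjoin ℂ
        (Set.range (t.mutateList l).var ∪ Set.range fun i => ((t.mutateList l).var i)⁻¹) := by
      intro M hM
      rw [← hmon0, ← hmon hl] at hM
      exact frozenMonomials_induction (p := (· ∈ Algebra.adjoin ℂ
        (Set.range (t.mutateList l).var ∪ Set.range fun i => ((t.mutateList l).var i)⁻¹)))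
        (one_mem _) (fun _ _ => mul_mem) (fun i _ => ⟨hmem i, hmem' i⟩) hM
    rintro _ (⟨i, rfl⟩ | ⟨i, rfl⟩)
    · obtain ⟨M, hM', h'⟩ := hvar_s l hl i
      rw [SetLike.mem_coe, h']
      exact mul_mem (hM M hM') (hmem i)
    · obtain ⟨M, hM', h'⟩ := hvar_s l hl i
      simp only [SetLike.mem_coe, h', mul_inv]
      exact mul_mem (hM _ (hinv M hM')) (hmem' i)
  · intro f
    refine Algebra.adjoin_le ?_ (hs.generated f)
    have hM : ∀ M ∈ s.frozenMonomials, M ∈ Algebra.adjoin ℂ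
        ({x | ∃ l, t.MutableList l ∧ ∃ i, x = (t.mutateList l).var i} ∪
          {x | ∃ i ∈ t.frozen, x = (t.var i)⁻¹}) := by
      intro M hM
      rw [← hmon0] at hM
      exact frozenMonomials_induction (p := (· ∈ Algebra.adjoin ℂ
        ({x | ∃ l, t.MutableList l ∧ ∃ i, x = (t.mutateList l).var i} ∪
          {x | ∃ i ∈ t.frozen, x = (t.var i)⁻¹})))
        (one_mem _) (fun _ _ => mul_mem)
        (fun i hi => ⟨Algebra.subset_adjoin (Or.inl ⟨[], hnil, i, rfl⟩),
          Algebra.subset_adjoin (Or.inr ⟨i, hi, rfl⟩)⟩) hM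
    rintro _ (⟨l, hl, i, rfl⟩ | ⟨i, hi, rfl⟩)
    · obtain ⟨M, hM', h'⟩ := hvar_s l ((hmut l).2 hl) i
      rw [SetLike.mem_coe, h']
      exact mul_mem (hM M hM') (Algebra.subset_adjoin (Or.inl ⟨l, (hmut l).2 hl, i, rfl⟩))
    · exact hM _ (hinv _ (frozenMonomials_var_mem hi))

end Algebraic

/-! ### Transport of cluster structures along ring isomorphisms. -/

section Transport

variable {I : Type*} {A B : Type*} [CommRing A] [IsDomain A]
  [Algebra ℂ A] [CommRing B] [IsDomain B] [Algebra ℂ B]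

theorem transport_symm_transport (φ : A ≃ₐ[ℂ] B) (s : Seed I (FractionRing A)) :
    (s.transport φ).transport φ.symm = s := by
  refine ext' ?_ rfl rfl
  funext i
  exact AlgEquiv.symm_apply_apply
    (IsFractionRing.algEquivOfAlgEquiv φ : FractionRing A ≃ₐ[ℂ] FractionRing B) (s.var i)

variable [Fintype I] [DecidableEq I]

/-- Cluster structures can be transported along isomorphisms. -/
theorem IsClusterStructure.transport {s : Seed I (FractionRing A)}
    (hs : s.IsClusterStructure A) (φ : A ≃ₐ[ℂ] B) : (s.transport φ).IsClusterStructure B := by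
  let F : FractionRing A ≃ₐ[ℂ] FractionRing B := IsFractionRing.algEquivOfAlgEquiv φ
  have hF : ∀ f, F (algebraMap A _ f) = algebraMap B _ (φ f) :=
    IsFractionRing.algEquivOfAlgEquiv_algebraMap φ
  have hvar : ∀ l i, ((s.transport φ).mutateList l).var i = F ((s.mutateList l).var i) := by
    intro l i
    rw [Seed.transport, mutateList_map]
    rfl
  have hrange : ∀ l, Set.range ((s.transport φ).mutateList l).var =
      F '' Set.range (s.mutateList l).var := by
    intro l
    rw [← Set.range_comp]
    exact congrArg Set.range (funext (hvar l))
  have key : ∀ (S : Set (FractionRing A)) (T : Set (FractionRing B)), (∀ x ∈ S, F x ∈ T) →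
      (∀ f, algebraMap A _ f ∈ Algebra.adjoin ℂ S) → ∀ f, algebraMap B _ f ∈
        Algebra.adjoin ℂ T := by
    intro S T hST h f
    have h1 : F (algebraMap A _ (φ.symm f)) ∈
        (Algebra.adjoin ℂ S).map (F : FractionRing A →ₐ[ℂ] FractionRing B) :=
      ⟨_, h (φ.symm f), rfl⟩
    rw [hF, AlgEquiv.apply_symm_apply, AlgHom.map_adjoin] at h1
    refine Algebra.adjoin_mono ?_ h1
    rintro _ ⟨x, hx, rfl⟩
    exact hST x hx
  refine ⟨?_, ?_, ?_, ?_, ?_, ?_⟩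
  · intro l hl
    have := (hs.independent l hl).map' (f := (F : FractionRing A →ₐ[ℂ] FractionRing B)) F.injective
    rw [show ((s.transport φ).mutateList l).var = F ∘ (s.mutateList l).var from funext (hvar l)]
    exact this
  · intro l hl
    rw [hrange]
    have := IntermediateField.adjoin_map ℂ (Set.range (s.mutateList l).var)
      (F : FractionRing A →ₐ[ℂ] FractionRing B)
    rw [hs.generates_field l hl] at this
    refine this.symm.trans ?_
    rw [← AlgHom.fieldRange_eq_map]
    exact AlgHom.fieldRange_eq_top.2 F.surjective
  · intro l hl i
    obtain ⟨f, hf⟩ := hs.regular l hl i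
    exact ⟨φ f, by rw [hvar, ← hf, hF]⟩
  · intro i hi
    obtain ⟨f, hu, hf⟩ := hs.frozen_unit i hi
    exact ⟨φ f, hu.map φ, by rw [← hF, hf]; rfl⟩
  · intro l hl
    refine key _ _ ?_ (hs.chart l hl)
    rintro _ (⟨i, rfl⟩ | ⟨i, rfl⟩)
    · exact Or.inl ⟨i, hvar l i⟩
    · exact Or.inr ⟨i, by simp only [hvar, map_inv₀]⟩
  · refine key _ _ ?_ hs.generated
    rintro _ (⟨l, hl, i, rfl⟩ | ⟨i, hi, rfl⟩)
    · exact Or.inl ⟨l, hl, i, (hvar l i).symm⟩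
    · exact Or.inr ⟨i, hi, map_inv₀ F _⟩

end Transport

end Seed

/-! ### Comparison of the glued seed with the product seed. -/

section PairOfTriangulations

variable {I J K : Type*} [Field K] {a b i : ℕ}

/-- The union of the seeds of two triangulations. -/
noncomputable def pairSeed (zA : Fin a → K) (zB : Fin b → K) (edgeA : I → ℕ × ℕ)
    (edgeB : J → ℕ × ℕ) : Seed (I ⊕ J) K :=
  (triangulationSeed zA edgeA).sum (triangulationSeed zB edgeB)

/-- The seed of a glued triangulation with the variable of the common diagonal frozen. -/
noncomputable def glueSeed (i : ℕ) (zC : Fin (a + b - 1) → K) (edgeA : I → ℕ × ℕ)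
    (edgeB : J → ℕ × ℕ) : Seed (I ⊕ J) K :=
  (triangulationSeed zC (glueEdges a i edgeA edgeB)).freeze
    {l | glueEdges a i edgeA edgeB l = (i, i + a)}

/-- The relations between the Plücker coordinates of the polygon and those of its two parts. -/
structure IsGlued (i : ℕ) (zA : Fin a → K) (zB : Fin b → K) (zC : Fin (a + b - 1) → K) :
    Prop where
  ne_zero_A : ∀ p q, 1 ≤ p → p < q → q ≤ a + 1 → plucker zA p q ≠ 0
  ne_zero_B : ∀ p q, 1 ≤ p → p < q → q ≤ b + 1 → plucker zB p q ≠ 0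
  plucker_A : ∀ p q, 1 ≤ p → p < q → q ≤ a + 1 →
    plucker zC (vertexA i p) (vertexA i q) = plucker zA p q
  plucker_B : ∀ p q, 1 ≤ p → p < q → q ≤ b + 1 →
    plucker zC (vertexB a i p) (vertexB a i q) =
      plucker zA 1 (a + 1) ^ (gluePower i p + gluePower i q + glueShear i) * plucker zB p q

variable {zA : Fin a → K} {zB : Fin b → K} {zC : Fin (a + b - 1) → K}
  {edgeA : I → ℕ × ℕ} {edgeB : J → ℕ × ℕ}

theorem glueEdges_inl_eq_cut_iff (ha : 2 ≤ a) (hA : IsTriangulation (a + 1) edgeA)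
    (l : I) : glueEdges a i edgeA edgeB (Sum.inl l) = (i, i + a) ↔ edgeA l = (1, a + 1) := by
  rcases h : edgeA l with ⟨p, q⟩
  have := hA.bounds (by omega) h
  rw [glueEdges_inl h, Prod.mk.injEq, Prod.mk.injEq]
  simp only [vertexA]; omega

theorem glueEdges_inr_ne_cut (ha : 2 ≤ a) (hb : 2 ≤ b)
    (hB : IsTriangulation (b + 1) edgeB) (l : J) :
    glueEdges a i edgeA edgeB (Sum.inr l) ≠ (i, i + a) := by
  rcases h : edgeB l with ⟨p, q⟩
  have := hB.bounds (by omega) h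
  have h1 := vertexB_cases (a := a) (i := i) (by omega) p
  have h2 := vertexB_cases (a := a) (i := i) (by omega) q
  rw [glueEdges_inr h, ne_eq, Prod.mk.injEq]
  omega

theorem glueEdges_inl_ne_outer (hi : 1 ≤ i) (ha : 2 ≤ a) (hb : 2 ≤ b)
    (hA : IsTriangulation (a + 1) edgeA) (l : I) :
    glueEdges a i edgeA edgeB (Sum.inl l) ≠ (1, a + b - 1 + 1) := by
  rcases h : edgeA l with ⟨p, q⟩
  have := hA.bounds (by omega) h
  rw [glueEdges_inl h, ne_eq, Prod.mk.injEq]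
  simp only [vertexA]; omega

theorem glueEdges_inr_eq_outer_iff (hi : 1 ≤ i) (ha : 2 ≤ a) (hb : 2 ≤ b) (hib : i ≤ b)
    (hB : IsTriangulation (b + 1) edgeB) (l : J) :
    glueEdges a i edgeA edgeB (Sum.inr l) = (1, a + b - 1 + 1) ↔ edgeB l = (1, b + 1) := by
  rcases h : edgeB l with ⟨p, q⟩
  have := hB.bounds (by omega) h
  have h1 := vertexB_cases (a := a) (i := i) (by omega) p
  have h2 := vertexB_cases (a := a) (i := i) (by omega) q
  rw [glueEdges_inr h, Prod.mk.injEq, Prod.mk.injEq]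
  omega

theorem inl_mem_pairSeed_frozen {l : I} :
    Sum.inl l ∈ (pairSeed zA zB edgeA edgeB).frozen ↔ edgeA l = (1, a + 1) := by
  simp [pairSeed, Seed.sum, triangulationSeed]

theorem inr_mem_pairSeed_frozen {l : J} :
    Sum.inr l ∈ (pairSeed zA zB edgeA edgeB).frozen ↔ edgeB l = (1, b + 1) := by
  simp [pairSeed, Seed.sum, triangulationSeed]

theorem glueSeed_frozen (hi : 1 ≤ i) (ha : 2 ≤ a) (hb : 2 ≤ b) (hib : i ≤ b)
    (hA : IsTriangulation (a + 1) edgeA) (hB : IsTriangulation (b + 1) edgeB) :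
    (glueSeed i zC edgeA edgeB).frozen = (pairSeed zA zB edgeA edgeB).frozen := by
  ext l
  rcases l with l | l
  · rw [inl_mem_pairSeed_frozen, ← glueEdges_inl_eq_cut_iff (edgeB := edgeB) ha hA]
    exact or_iff_right (glueEdges_inl_ne_outer hi ha hb hA l)
  · rw [inr_mem_pairSeed_frozen, ← glueEdges_inr_eq_outer_iff (edgeA := edgeA) hi ha hb hib hB]
    exact or_iff_left (glueEdges_inr_ne_cut ha hb hB l)

theorem pairSeed_var_inl {l : I} {p q : ℕ} (h : edgeA l = (p, q)) :
    (pairSeed zA zB edgeA edgeB).var (Sum.inl l) = plucker zA p q := by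
  simp [pairSeed, Seed.sum, triangulationSeed, h]

theorem pairSeed_var_inr {l : J} {p q : ℕ} (h : edgeB l = (p, q)) :
    (pairSeed zA zB edgeA edgeB).var (Sum.inr l) = plucker zB p q := by
  simp [pairSeed, Seed.sum, triangulationSeed, h]

theorem glueSeed_var_inl (D : IsGlued i zA zB zC) (ha : 2 ≤ a) (hA : IsTriangulation (a + 1) edgeA)
    (l : I) : (glueSeed i zC edgeA edgeB).var (Sum.inl l) =
      (pairSeed zA zB edgeA edgeB).var (Sum.inl l) := by
  rcases h : edgeA l with ⟨p, q⟩
  have hb := hA.bounds (by omega) h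
  rw [pairSeed_var_inl h, ← D.plucker_A p q hb.1 (by omega) hb.2.2]
  simp [glueSeed, Seed.freeze, triangulationSeed, glueEdges, h]

theorem glueSeed_var_inr (D : IsGlued i zA zB zC) (hb : 2 ≤ b) (hB : IsTriangulation (b + 1) edgeB)
    (l : J) : ∃ n : ℤ, (glueSeed i zC edgeA edgeB).var (Sum.inr l) =
      plucker zA 1 (a + 1) ^ n * (pairSeed zA zB edgeA edgeB).var (Sum.inr l) := by
  rcases h : edgeB l with ⟨p, q⟩
  have h' := hB.bounds (by omega) h
  refine ⟨gluePower i p + gluePower i q + glueShear i, ?_⟩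
  rw [pairSeed_var_inr h, ← D.plucker_B p q h'.1 (by omega) h'.2.2]
  simp [glueSeed, Seed.freeze, triangulationSeed, glueEdges, h]

theorem IsFlip.ne_outer [DecidableEq I] {n : ℕ} {edge edge' : I → ℕ × ℕ} {l : I} (h : IsFlip n edge l edge') :
    edge l ≠ (1, n) := by
  obtain ⟨w, x, y, z, hQ, h⟩ := h
  have q0 := hQ.one_le; have q1 := hQ.lt₁; have q2 := hQ.lt₂; have q3 := hQ.lt₃; have q4 := hQ.le
  rcases h with ⟨h, -⟩ | ⟨h, -⟩ <;> rw [h, ne_eq, Prod.mk.injEq] <;> omega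

section QuasiEquivalence

variable [Fintype I] [Fintype J]

theorem glueSeed_exchangeRatio_inl (D : IsGlued i zA zB zC) (hi : 1 ≤ i) (ha : 2 ≤ a) (hb : 2 ≤ b)
    (hib : i ≤ b) (hA : IsTriangulation (a + 1) edgeA) (hB : IsTriangulation (b + 1) edgeB) {l : I}
    (hl : edgeA l ≠ (1, a + 1)) : (glueSeed i zC edgeA edgeB).exchangeRatio (Sum.inl l) =
      (pairSeed zA zB edgeA edgeB).exchangeRatio (Sum.inl l) := by
  have hT := isTriangulation_glueEdges ha hb hi hib hA hB
  have e : a + b - 1 + 1 = a + b := by omega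
  obtain ⟨w, x, y, z, hQ, h⟩ := hA.exists_quad (by omega) hl
  have hQ' := hQ.glueEdges_A (edgeB := edgeB) hi hib
  rw [← e] at hT hQ'
  have q0 := hQ.one_le; have q1 := hQ.lt₁; have q2 := hQ.lt₂; have q3 := hQ.lt₃; have q4 := hQ.le
  rw [glueSeed, pairSeed, Seed.exchangeRatio_freeze, Seed.exchangeRatio_sum_inl,
    Seed.exchangeRatio, Seed.exchangeRatio]
  have r := D.plucker_A
  rcases h with h | h
  · have e1 := hQ.exchange_left (z := zA) hA ha h
    have e2 := hQ'.exchange_left (z := zC) hT (by omega)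
      (glueEdges_inl (a := a) (i := i) (edgeB := edgeB) h)
    rw [e1.1, e1.2, e2.1, e2.2, r w x (by omega) (by omega) (by omega),
      r y z (by omega) (by omega) (by omega), r x y (by omega) (by omega) (by omega),
      r w z (by omega) (by omega) (by omega)]
  · have e1 := hQ.exchange_right (z := zA) hA ha h
    have e2 := hQ'.exchange_right (z := zC) hT (by omega)
      (glueEdges_inl (a := a) (i := i) (edgeB := edgeB) h)
    rw [e1.1, e1.2, e2.1, e2.2, r w x (by omega) (by omega) (by omega),
      r y z (by omega) (by omega) (by omega), r x y (by omega) (by omega) (by omega),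
      r w z (by omega) (by omega) (by omega)]

/-- Both terms of the exchange relation are products over opposite sides and involve every vertex of
the quadrilateral once, so they acquire the same power of `Δ_{ij}`. -/
theorem glueSeed_exchangeRatio_inr (D : IsGlued i zA zB zC) (hi : 1 ≤ i) (ha : 2 ≤ a) (hb : 2 ≤ b)
    (hib : i ≤ b) (hA : IsTriangulation (a + 1) edgeA) (hB : IsTriangulation (b + 1) edgeB) {l : J}
    (hl : edgeB l ≠ (1, b + 1)) : (glueSeed i zC edgeA edgeB).exchangeRatio (Sum.inr l) =
      (pairSeed zA zB edgeA edgeB).exchangeRatio (Sum.inr l) := by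
  have hT := isTriangulation_glueEdges ha hb hi hib hA hB
  have e : a + b - 1 + 1 = a + b := by omega
  obtain ⟨w, x, y, z, hQ, h⟩ := hB.exists_quad (by omega) hl
  have hQ' := hQ.glueEdges_B hA (by omega) hi
  rw [← e] at hT hQ'
  have q0 := hQ.one_le; have q1 := hQ.lt₁; have q2 := hQ.lt₂; have q3 := hQ.lt₃; have q4 := hQ.le
  rw [glueSeed, pairSeed, Seed.exchangeRatio_freeze, Seed.exchangeRatio_sum_inr,
    Seed.exchangeRatio, Seed.exchangeRatio]
  have r := D.plucker_B
  have hd := D.ne_zero_A 1 (a + 1) le_rfl (by omega) le_rfl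
  have n1 := D.ne_zero_B w x (by omega) (by omega) (by omega)
  have n2 := D.ne_zero_B x y (by omega) (by omega) (by omega)
  have n3 := D.ne_zero_B y z (by omega) (by omega) (by omega)
  have n4 := D.ne_zero_B w z (by omega) (by omega) (by omega)
  have hz := fun n : ℤ => zpow_ne_zero n hd
  have key : plucker zC (vertexB a i w) (vertexB a i x) * plucker zC (vertexB a i y)
      (vertexB a i z) * (plucker zB x y * plucker zB w z) = plucker zB w x * plucker zB y z *
      (plucker zC (vertexB a i x) (vertexB a i y) * plucker zC (vertexB a i w) (vertexB a i z)) := by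
    rw [r w x (by omega) (by omega) (by omega),
      r y z (by omega) (by omega) (by omega), r x y (by omega) (by omega) (by omega),
      r w z (by omega) (by omega) (by omega)]
    simp only [zpow_add₀ hd]
    ring
  have m1 : ∀ p q, 1 ≤ p → p < q → q ≤ b + 1 →
      plucker zC (vertexB a i p) (vertexB a i q) ≠ 0 := by
    intro p q h1 h2 h3
    rw [r p q h1 h2 h3]
    exact mul_ne_zero (hz _) (D.ne_zero_B p q h1 h2 h3)
  have m2 := m1 x y (by omega) (by omega) (by omega)
  have m3 := m1 y z (by omega) (by omega) (by omega)
  have m4 := m1 w z (by omega) (by omega) (by omega)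
  have m5 := m1 w x (by omega) (by omega) (by omega)
  rcases h with h | h
  · have e1 := hQ.exchange_left (z := zB) hB hb h
    have e2 := hQ'.exchange_left (z := zC) hT (by omega)
      (glueEdges_inr (a := a) (i := i) (edgeA := edgeA) h)
    rw [e1.1, e1.2, e2.1, e2.2, div_eq_div_iff (mul_ne_zero m2 m4) (mul_ne_zero n2 n4)]
    exact key
  · have e1 := hQ.exchange_right (z := zB) hB hb h
    have e2 := hQ'.exchange_right (z := zC) hT (by omega)
      (glueEdges_inr (a := a) (i := i) (edgeA := edgeA) h)
    rw [e1.1, e1.2, e2.1, e2.2, div_eq_div_iff (mul_ne_zero m3 m5) (mul_ne_zero n3 n1)]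
    linear_combination -key

variable [DecidableEq I] [DecidableEq J]

theorem glueSeed_quasiEquiv (D : IsGlued i zA zB zC) (hi : 1 ≤ i) (ha : 2 ≤ a) (hb : 2 ≤ b)
    (hib : i ≤ b) (hA : IsTriangulation (a + 1) edgeA) (hB : IsTriangulation (b + 1) edgeB) :
    (glueSeed i zC edgeA edgeB).QuasiEquiv (pairSeed zA zB edgeA edgeB) := by
  have hfr := glueSeed_frozen (zA := zA) (zB := zB) (zC := zC) hi ha hb hib hA hB
  have hd := D.ne_zero_A 1 (a + 1) le_rfl (by omega) le_rfl
  have hp0 : ∀ l, (pairSeed zA zB edgeA edgeB).var l ≠ 0 := by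
    rintro (l | l)
    · have := hA.bounds (by omega) (Prod.mk.eta (p := edgeA l)).symm
      exact D.ne_zero_A _ _ this.1 (by omega) this.2.2
    · have := hB.bounds (by omega) (Prod.mk.eta (p := edgeB l)).symm
      exact D.ne_zero_B _ _ this.1 (by omega) this.2.2
  have hg0 : ∀ l, (glueSeed i zC edgeA edgeB).var l ≠ 0 := by
    rintro (l | l)
    · rw [glueSeed_var_inl D ha hA]; exact hp0 _
    · obtain ⟨n, hn⟩ := glueSeed_var_inr (edgeA := edgeA) D hb hB l
      rw [hn]
      exact mul_ne_zero (zpow_ne_zero n hd) (hp0 _)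
  obtain ⟨l₀, hl₀⟩ := hA.outer
  have hl₀' : Sum.inl l₀ ∈ (pairSeed zA zB edgeA edgeB).frozen := inl_mem_pairSeed_frozen.2 hl₀
  have hdp : ∀ n : ℤ, plucker zA 1 (a + 1) ^ n ∈ (pairSeed zA zB edgeA edgeB).frozenMonomials := by
    intro n
    rw [← pairSeed_var_inl (zB := zB) (edgeB := edgeB) hl₀]
    exact Seed.frozenMonomials_zpow_mem (Seed.frozenMonomials_var_mem hl₀') n
  have hdg : ∀ n : ℤ, plucker zA 1 (a + 1) ^ n ∈ (glueSeed i zC edgeA edgeB).frozenMonomials := by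
    intro n
    rw [← pairSeed_var_inl (zB := zB) (edgeB := edgeB) hl₀, ← glueSeed_var_inl D ha hA]
    exact Seed.frozenMonomials_zpow_mem (Seed.frozenMonomials_var_mem (hfr ▸ hl₀')) n
  refine ⟨hfr, ?_, ?_, ?_⟩
  -- Only the outer variable of the second part changes, by a power of `Δ_{ij}`, which is itself
  -- frozen in both seeds.
  · refine Set.Subset.antisymm (Seed.frozenMonomials_subset (fun l _ => hp0 l) ?_)
      (Seed.frozenMonomials_subset (fun l _ => hg0 l) ?_)
    · rintro (l | l) hl
      · rw [glueSeed_var_inl D ha hA]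
        exact Seed.frozenMonomials_var_mem (hfr ▸ hl)
      · obtain ⟨n, hn⟩ := glueSeed_var_inr (edgeA := edgeA) D hb hB l
        rw [hn]
        exact Seed.frozenMonomials_mul_mem (fun l _ => hp0 l) (hdp n)
          (Seed.frozenMonomials_var_mem (hfr ▸ hl))
    · rintro (l | l) hl
      · rw [← glueSeed_var_inl D ha hA]
        exact Seed.frozenMonomials_var_mem (hfr ▸ hl)
      · obtain ⟨n, hn⟩ := glueSeed_var_inr (edgeA := edgeA) D hb hB l
        have : (pairSeed zA zB edgeA edgeB).var (Sum.inr l) =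
            plucker zA 1 (a + 1) ^ (-n) * (glueSeed i zC edgeA edgeB).var (Sum.inr l) := by
          rw [hn, ← mul_assoc, ← zpow_add₀ hd, neg_add_cancel, zpow_zero, one_mul]
        rw [this]
        exact Seed.frozenMonomials_mul_mem (fun l _ => hg0 l) (hdg _)
          (Seed.frozenMonomials_var_mem (hfr ▸ hl))
  · rintro (l | l) -
    · exact ⟨1, Seed.frozenMonomials_one_mem _, by rw [one_mul, glueSeed_var_inl D ha hA]⟩
    · obtain ⟨n, hn⟩ := glueSeed_var_inr (edgeA := edgeA) D hb hB l
      exact ⟨_, hdg n, hn⟩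
  · rintro (l | l) hl
    · rw [hfr, inl_mem_pairSeed_frozen] at hl
      exact glueSeed_exchangeRatio_inl D hi ha hb hib hA hB hl
    · rw [hfr, inr_mem_pairSeed_frozen] at hl
      exact glueSeed_exchangeRatio_inr D hi ha hb hib hA hB hl

end QuasiEquivalence

/-! ### Parallel mutations of the two seeds. -/

section Mutation

variable [Fintype I] [DecidableEq I] [Fintype J] [DecidableEq J]

theorem pairSeed_mutate_inl (hzA : ∀ p q, 1 ≤ p → p < q → q ≤ a + 1 → plucker zA p q ≠ 0)
    (ha : 2 ≤ a) (hA : IsTriangulation (a + 1) edgeA) {l : I} {edgeA' : I → ℕ × ℕ}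
    (hF : IsFlip (a + 1) edgeA l edgeA') :
    (pairSeed zA zB edgeA edgeB).mutate (Sum.inl l) = pairSeed zA zB edgeA' edgeB := by
  have hb := hA.bounds (by omega) (Prod.mk.eta (p := edgeA l)).symm
  rw [pairSeed, Seed.mutate_sum_inl,
    triangulationSeed_mutate hA ha hF (hzA _ _ hb.1 (by omega) hb.2.2)]
  rfl

theorem pairSeed_mutate_inr (hzB : ∀ p q, 1 ≤ p → p < q → q ≤ b + 1 → plucker zB p q ≠ 0)
    (hb : 2 ≤ b) (hB : IsTriangulation (b + 1) edgeB) {l : J} {edgeB' : J → ℕ × ℕ}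
    (hF : IsFlip (b + 1) edgeB l edgeB') :
    (pairSeed zA zB edgeA edgeB).mutate (Sum.inr l) = pairSeed zA zB edgeA edgeB' := by
  have hb' := hB.bounds (by omega) (Prod.mk.eta (p := edgeB l)).symm
  rw [pairSeed, Seed.mutate_sum_inr,
    triangulationSeed_mutate hB hb hF (hzB _ _ hb'.1 (by omega) hb'.2.2)]
  rfl

theorem glueSeed_mutate (ha : 2 ≤ a) (hb : 2 ≤ b) (hi : 1 ≤ i) (hib : i ≤ b)
    (hA : IsTriangulation (a + 1) edgeA) (hB : IsTriangulation (b + 1) edgeB) {l : I ⊕ J}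
    {edgeA' : I → ℕ × ℕ} {edgeB' : J → ℕ × ℕ}
    (hA' : IsTriangulation (a + 1) edgeA') (hB' : IsTriangulation (b + 1) edgeB')
    (hout : ∀ l, edgeA' l = (1, a + 1) ↔ edgeA l = (1, a + 1))
    (hF : IsFlip (a + b) (glueEdges a i edgeA edgeB) l (glueEdges a i edgeA' edgeB'))
    (h0 : (glueSeed i zC edgeA edgeB).var l ≠ 0) :
    (glueSeed i zC edgeA edgeB).mutate l = glueSeed i zC edgeA' edgeB' := by
  have e : a + b - 1 + 1 = a + b := by omega
  have hT := isTriangulation_glueEdges ha hb hi hib hA hB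
  rw [← e] at hT hF
  rw [glueSeed, Seed.mutate_freeze, triangulationSeed_mutate hT (by omega) hF h0, glueSeed]
  -- The declared frozen label is the outer edge of the first part, which no flip moves.
  congr 1
  ext m
  rcases m with m | m
  · exact (glueEdges_inl_eq_cut_iff ha hA m).trans
      ((hout m).symm.trans (glueEdges_inl_eq_cut_iff ha hA' m).symm)
  · exact iff_of_false (glueEdges_inr_ne_cut ha hb hB m) (glueEdges_inr_ne_cut ha hb hB' m)

/-- Mutations of the seeds of a pair of triangulations are seeds of pairs of triangulations. -/
theorem exists_mutateList_eq (D : IsGlued i zA zB zC) (ha : 2 ≤ a) (hb : 2 ≤ b) (hi : 1 ≤ i)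
    (hib : i ≤ b) (hA : IsTriangulation (a + 1) edgeA) (hB : IsTriangulation (b + 1) edgeB)
    (l : List (I ⊕ J)) (hl : (pairSeed zA zB edgeA edgeB).MutableList l) :
    ∃ edgeA' edgeB', IsTriangulation (a + 1) edgeA' ∧ IsTriangulation (b + 1) edgeB' ∧
      (pairSeed zA zB edgeA edgeB).mutateList l = pairSeed zA zB edgeA' edgeB' ∧
      (glueSeed i zC edgeA edgeB).mutateList l = glueSeed i zC edgeA' edgeB' := by
  induction l generalizing edgeA edgeB with
  | nil => exact ⟨edgeA, edgeB, hA, hB, rfl, rfl⟩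
  | cons k l ih =>
    have hk := hl k List.mem_cons_self
    have hl' := fun j hj => hl j (List.mem_cons_of_mem _ hj)
    have hd := D.ne_zero_A 1 (a + 1) le_rfl (by omega) le_rfl
    rcases k with k | k
    · rw [inl_mem_pairSeed_frozen] at hk
      obtain ⟨edgeA', hF⟩ := hA.exists_flip (by omega) hk
      have hA' := hA.flip hF
      have m1 := pairSeed_mutate_inl (zB := zB) (edgeB := edgeB) D.ne_zero_A ha hA hF
      have m2 := glueSeed_mutate (zC := zC) ha hb hi hib hA hB hA' hB hF.eq_outer_iff
        (hF.glueEdges_A hi hib) (by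
          have hb := hA.bounds (by omega) (Prod.mk.eta (p := edgeA k)).symm
          rw [glueSeed_var_inl D ha hA]
          exact D.ne_zero_A _ _ hb.1 (by omega) hb.2.2)
      obtain ⟨eA, eB, h1, h2, h3, h4⟩ := ih hA' hB (by
        rwa [← m1])
      exact ⟨eA, eB, h1, h2, by rw [Seed.mutateList_cons, m1, h3],
        by rw [Seed.mutateList_cons, m2, h4]⟩
    · rw [inr_mem_pairSeed_frozen] at hk
      obtain ⟨edgeB', hF⟩ := hB.exists_flip (by omega) hk
      have hB' := hB.flip hF
      have m1 := pairSeed_mutate_inr (zA := zA) (edgeA := edgeA) D.ne_zero_B hb hB hF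
      have m2 := glueSeed_mutate (zC := zC) ha hb hi hib hA hB hA hB' (fun _ => Iff.rfl)
        (hF.glueEdges_B hA (by omega) hi) (by
          have hb' := hB.bounds (by omega) (Prod.mk.eta (p := edgeB k)).symm
          obtain ⟨n, hn⟩ := glueSeed_var_inr (edgeA := edgeA) D hb hB k
          rw [hn]
          exact mul_ne_zero (zpow_ne_zero n hd) (D.ne_zero_B _ _ hb'.1 (by omega) hb'.2.2))
      obtain ⟨eA, eB, h1, h2, h3, h4⟩ := ih hA hB' (by
        rwa [← m1])
      exact ⟨eA, eB, h1, h2, by rw [Seed.mutateList_cons, m1, h3],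
        by rw [Seed.mutateList_cons, m2, h4]⟩

theorem glueSeed_clusterQuasiEquiv (D : IsGlued i zA zB zC) (ha : 2 ≤ a) (hb : 2 ≤ b) (hi : 1 ≤ i)
    (hib : i ≤ b) (hA : IsTriangulation (a + 1) edgeA) (hB : IsTriangulation (b + 1) edgeB) :
    (glueSeed i zC edgeA edgeB).ClusterQuasiEquiv (pairSeed zA zB edgeA edgeB) := by
  intro l hl
  rw [Seed.mutableList_iff (glueSeed_frozen (zA := zA) (zB := zB) hi ha hb hib hA hB)] at hl
  obtain ⟨eA, eB, h1, h2, h3, h4⟩ := exists_mutateList_eq D ha hb hi hib hA hB l hl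
  rw [h3, h4]
  exact glueSeed_quasiEquiv D hi ha hb hib h1 h2

/-- This turns a flip sequence reaching a given diagonal into mutations, exhibiting its Plücker
coordinate as a cluster variable. -/
theorem pairSeed_mutateList_inl (hzA : ∀ p q, 1 ≤ p → p < q → q ≤ a + 1 → plucker zA p q ≠ 0)
    (ha : 2 ≤ a) (hA : IsTriangulation (a + 1) edgeA) {ls : List I} {edgeA' : I → ℕ × ℕ}
    (hF : FlipSequence (a + 1) ls edgeA edgeA') :
    (pairSeed zA zB edgeA edgeB).MutableList (ls.map Sum.inl) ∧
      (pairSeed zA zB edgeA edgeB).mutateList (ls.map Sum.inl) = pairSeed zA zB edgeA' edgeB := by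
  induction hF with
  | nil => exact ⟨fun k hk => absurd hk List.not_mem_nil, rfl⟩
  | cons h _ ih =>
    have m := pairSeed_mutate_inl (zB := zB) (edgeB := edgeB) hzA ha hA h
    obtain ⟨h1, h2⟩ := ih (hA.flip h)
    rw [List.map_cons, Seed.mutateList_cons, m]
    refine ⟨fun k hk => ?_, h2⟩
    rcases List.mem_cons.1 hk with rfl | hk
    · rw [inl_mem_pairSeed_frozen]; exact h.ne_outer
    · have := h1 k hk
      rwa [← m] at this

theorem pairSeed_mutateList_inr (hzB : ∀ p q, 1 ≤ p → p < q → q ≤ b + 1 → plucker zB p q ≠ 0)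
    (hb : 2 ≤ b) (hB : IsTriangulation (b + 1) edgeB) {ls : List J} {edgeB' : J → ℕ × ℕ}
    (hF : FlipSequence (b + 1) ls edgeB edgeB') :
    (pairSeed zA zB edgeA edgeB).MutableList (ls.map Sum.inr) ∧
      (pairSeed zA zB edgeA edgeB).mutateList (ls.map Sum.inr) = pairSeed zA zB edgeA edgeB' := by
  induction hF with
  | nil => exact ⟨fun k hk => absurd hk List.not_mem_nil, rfl⟩
  | cons h _ ih =>
    have m := pairSeed_mutate_inr (zA := zA) (edgeA := edgeA) hzB hb hB h
    obtain ⟨h1, h2⟩ := ih (hB.flip h)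
    rw [List.map_cons, Seed.mutateList_cons, m]
    refine ⟨fun k hk => ?_, h2⟩
    rcases List.mem_cons.1 hk with rfl | hk
    · rw [inr_mem_pairSeed_frozen]; exact h.ne_outer
    · have := h1 k hk
      rwa [← m] at this

end Mutation

end PairOfTriangulations

/-! ### Plücker coordinates as rational functions on the product. -/

section ProductCluster

variable {a b i : ℕ}

theorem plucker_productCoordA_apply (p q : ℕ) (x : braidVariety a × braidVariety b) :
    (plucker (productCoordA a b) p q).1 x = plucker x.1.1 p q :=
  (plucker_map (evalAt (productRing a b) x).toRingHom (productCoordA a b) p q).symm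

theorem plucker_productCoordB_apply (p q : ℕ) (x : braidVariety a × braidVariety b) :
    (plucker (productCoordB a b) p q).1 x = plucker x.2.1 p q :=
  (plucker_map (evalAt (productRing a b) x).toRingHom (productCoordB a b) p q).symm

/-- The invertible regular function `Δ_{1,a+1}` of the first factor. -/
noncomputable def frozenUnitA (ha : 1 ≤ a) : (productRing a b)ˣ where
  val := plucker (productCoordA a b) 1 (a + 1)
  inv := ⟨_, inv_pluckerA_mem ha⟩
  val_inv := ext_evalAt fun x => (congrArg (· * (plucker x.1.1 1 (a + 1))⁻¹)
    (plucker_productCoordA_apply 1 (a + 1) x)).trans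
      (mul_inv_cancel₀ (plucker_one_last_ne_zero ha x.1.2))
  inv_val := ext_evalAt fun x => (congrArg ((plucker x.1.1 1 (a + 1))⁻¹ * ·)
    (plucker_productCoordA_apply 1 (a + 1) x)).trans
      (inv_mul_cancel₀ (plucker_one_last_ne_zero ha x.1.2))

/-- The invertible regular function `Δ_{1,b+1}` of the second factor. -/
noncomputable def frozenUnitB (hb : 1 ≤ b) : (productRing a b)ˣ where
  val := plucker (productCoordB a b) 1 (b + 1)
  inv := ⟨_, inv_pluckerB_mem hb⟩
  val_inv := ext_evalAt fun x => (congrArg (· * (plucker x.2.1 1 (b + 1))⁻¹)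
    (plucker_productCoordB_apply 1 (b + 1) x)).trans
      (mul_inv_cancel₀ (plucker_one_last_ne_zero hb x.2.2))
  inv_val := ext_evalAt fun x => (congrArg ((plucker x.2.1 1 (b + 1))⁻¹ * ·)
    (plucker_productCoordB_apply 1 (b + 1) x)).trans
      (inv_mul_cancel₀ (plucker_one_last_ne_zero hb x.2.2))

variable [IsDomain (productRing a b)]

/-- The coordinates of the first factor as rational functions on the product. -/
noncomputable def rationalCoordA (a b : ℕ) [IsDomain (productRing a b)] (l : Fin a) :
    FractionRing (productRing a b) :=
  algebraMap _ _ (productCoordA a b l)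

/-- The coordinates of the second factor as rational functions on the product. -/
noncomputable def rationalCoordB (a b : ℕ) [IsDomain (productRing a b)] (l : Fin b) :
    FractionRing (productRing a b) :=
  algebraMap _ _ (productCoordB a b l)

theorem plucker_rationalCoordA (p q : ℕ) : plucker (rationalCoordA a b) p q =
    algebraMap _ _ (plucker (productCoordA a b) p q) :=
  plucker_map (algebraMap (productRing a b) (FractionRing (productRing a b))) _ p q

theorem plucker_rationalCoordB (p q : ℕ) : plucker (rationalCoordB a b) p q =
    algebraMap _ _ (plucker (productCoordB a b) p q) :=
  plucker_map (algebraMap (productRing a b) (FractionRing (productRing a b))) _ p q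

/-- Evaluation at a point where `Δ_{pq} = q - p` shows that the regular function is nonzero. -/
theorem plucker_rationalCoordA_ne_zero (ha : 1 ≤ a) (hb : 1 ≤ b) {p q : ℕ} (hp : 1 ≤ p)
    (hpq : p < q) (hq : q ≤ a + 1) : plucker (rationalCoordA a b) p q ≠ 0 := by
  obtain ⟨x, hx, hx'⟩ := exists_mem_braidVariety_plucker a ha
  obtain ⟨y, hy, -⟩ := exists_mem_braidVariety_plucker b hb
  rw [plucker_rationalCoordA, ne_eq, IsFractionRing.to_map_eq_zero_iff]
  intro h
  have h1 := plucker_productCoordA_apply p q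
    ((⟨x, hx⟩, ⟨y, hy⟩) : braidVariety a × braidVariety b)
  rw [h, hx' p q hp (by omega) (by omega) hq] at h1
  exact sub_ne_zero.2 (by exact_mod_cast hpq.ne') h1.symm

theorem plucker_rationalCoordB_ne_zero (ha : 1 ≤ a) (hb : 1 ≤ b) {p q : ℕ} (hp : 1 ≤ p)
    (hpq : p < q) (hq : q ≤ b + 1) : plucker (rationalCoordB a b) p q ≠ 0 := by
  obtain ⟨x, hx, -⟩ := exists_mem_braidVariety_plucker a ha
  obtain ⟨y, hy, hy'⟩ := exists_mem_braidVariety_plucker b hb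
  rw [plucker_rationalCoordB, ne_eq, IsFractionRing.to_map_eq_zero_iff]
  intro h
  have h1 := plucker_productCoordB_apply p q
    ((⟨x, hx⟩, ⟨y, hy⟩) : braidVariety a × braidVariety b)
  rw [h, hy' p q hp (by omega) (by omega) hq] at h1
  exact sub_ne_zero.2 (by exact_mod_cast hpq.ne') h1.symm

/-- The Plücker coordinates on `{Δ_{ij} ≠ 0}` as rational functions on the product. -/
theorem isGlued_rationalCoord (ha : 1 ≤ a) (hb : 1 ≤ b) (hi : 1 ≤ i) (hib : i ≤ b) :
    IsGlued i (rationalCoordA a b) (rationalCoordB a b)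
      (fun l => algebraMap _ (FractionRing (productRing a b))
        (gluePullback ha hb hi hib (cutLocusCoord (a + b - 1) i (i + a) l))) := by
  set c := fun l => gluePullback ha hb hi hib (cutLocusCoord (a + b - 1) i (i + a) l) with hc
  have hC : ∀ p q, plucker (fun l => algebraMap _ (FractionRing (productRing a b)) (c l)) p q =
      algebraMap _ _ (plucker c p q) := fun p q =>
    plucker_map (algebraMap (productRing a b) (FractionRing (productRing a b))) _ p q
  have hC' : ∀ p q x, (plucker c p q).1 x = plucker (glue a b i x.1.1 x.2.1) p q := fun p q x =>
    (plucker_map (evalAt (productRing a b) x).toRingHom c p q).symm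
  -- Integer powers of the frozen variable are represented by powers of a unit of the ring, so the
  -- gluing identities can be checked pointwise.
  have hu : ∀ n : ℤ, plucker (rationalCoordA a b) 1 (a + 1) ^ n =
      algebraMap _ _ ((frozenUnitA (b := b) ha ^ n : (productRing a b)ˣ) : productRing a b) := by
    intro n
    rw [plucker_rationalCoordA]
    have := map_zpow (Units.map (algebraMap (productRing a b)
      (FractionRing (productRing a b))).toMonoidHom) (frozenUnitA (b := b) ha) n
    have := congrArg Units.val this
    rw [Units.val_zpow_eq_zpow_val] at this
    exact this.symm
  have hu' : ∀ (n : ℤ) x, ((frozenUnitA (b := b) ha ^ n : (productRing a b)ˣ) :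
      productRing a b).1 x = plucker x.1.1 1 (a + 1) ^ n := by
    intro n x
    have := map_zpow (Units.map (evalAt (productRing a b) x).toRingHom.toMonoidHom)
      (frozenUnitA (b := b) ha) n
    have := congrArg Units.val this
    rw [Units.val_zpow_eq_zpow_val] at this
    rw [← plucker_productCoordA_apply]
    exact this
  refine ⟨fun p q => plucker_rationalCoordA_ne_zero ha hb,
    fun p q => plucker_rationalCoordB_ne_zero ha hb, fun p q hp hpq hq => ?_,
    fun p q hp hpq hq => ?_⟩
  · rw [hC, plucker_rationalCoordA]
    congr 1
    refine ext_evalAt fun x => ?_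
    rw [hC', plucker_productCoordA_apply]
    exact plucker_glue_A ha hi hib x.1.2 hp (by omega) (by omega) hq
  · rw [hC, plucker_rationalCoordB, hu, ← map_mul]
    congr 1
    refine ext_evalAt fun x => ?_
    rw [hC']
    refine Eq.trans ?_ (congrArg₂ (· * ·) (hu' _ x) (plucker_productCoordB_apply p q x)).symm
    exact plucker_glue_B ha hi hib x.1.2 hp (by omega) (by omega) hq

/-- The regular functions on the product are polynomials in the Plücker coordinates and the inverses
of the frozen ones. -/
theorem algebraMap_productRing_mem (ha : 1 ≤ a) (hb : 1 ≤ b)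
    (S : Subalgebra ℂ (FractionRing (productRing a b)))
    (hA : ∀ p q, 1 ≤ p → p < q → q ≤ a + 1 → plucker (rationalCoordA a b) p q ∈ S)
    (hA' : (plucker (rationalCoordA a b) 1 (a + 1))⁻¹ ∈ S)
    (hB : ∀ p q, 1 ≤ p → p < q → q ≤ b + 1 → plucker (rationalCoordB a b) p q ∈ S)
    (hB' : (plucker (rationalCoordB a b) 1 (b + 1))⁻¹ ∈ S) (f : productRing a b) :
    algebraMap _ (FractionRing (productRing a b)) f ∈ S := by
  have coord : ∀ {k : ℕ} (hk : 1 ≤ k) (z : Fin k → FractionRing (productRing a b)),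
      vec z (k + 1) 0 = 0 → (∀ p q, 1 ≤ p → p < q → q ≤ k + 1 → plucker z p q ∈ S) →
      plucker z 1 (k + 1) ≠ 0 → (plucker z 1 (k + 1))⁻¹ ∈ S → ∀ l, z l ∈ S := by
    rintro k hk z h0 hS hne hS' ⟨l, hl⟩
    cases l with
    | zero =>
      have h := coord_zero_mul_plucker hk z h0
      rw [show z ⟨0, hl⟩ = plucker z 2 (k + 1) * (plucker z 1 (k + 1))⁻¹ by
        rw [← h, mul_inv_cancel_right₀ hne]]
      refine S.mul_mem ?_ hS'
      -- For `k = 1` the numerator is `Δ₂₂ = 0` rather than a minor of two distinct vertices.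
      rcases hk.eq_or_lt with rfl | hk
      · simp [plucker, det₂, mul_comm]
      · exact hS _ _ (by omega) (by omega) le_rfl
    | succ l =>
      rw [coord_succ_eq_plucker z l hl]
      exact hS _ _ (by omega) (by omega) (by omega)
  have hcA : ∀ l, rationalCoordA a b l ∈ S := by
    refine coord ha _ ?_ hA (plucker_rationalCoordA_ne_zero ha hb le_rfl (by omega) le_rfl) hA'
    have h0 : vec (productCoordA a b) (a + 1) 0 = 0 := ext_evalAt fun x =>
      (vec_map (evalAt (productRing a b) x).toRingHom (productCoordA a b) (a + 1) 0).symm.trans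
        ((mem_braidVariety_iff _).1 x.1.2)
    exact (vec_map (algebraMap (productRing a b) (FractionRing (productRing a b)))
      (productCoordA a b) (a + 1) 0).trans (by rw [h0, map_zero])
  have hcB : ∀ l, rationalCoordB a b l ∈ S := by
    refine coord hb _ ?_ hB (plucker_rationalCoordB_ne_zero ha hb le_rfl (by omega) le_rfl) hB'
    have h0 : vec (productCoordB a b) (b + 1) 0 = 0 := ext_evalAt fun x =>
      (vec_map (evalAt (productRing a b) x).toRingHom (productCoordB a b) (b + 1) 0).symm.trans
        ((mem_braidVariety_iff _).1 x.2.2)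
    exact (vec_map (algebraMap (productRing a b) (FractionRing (productRing a b)))
      (productCoordB a b) (b + 1) 0).trans (by rw [h0, map_zero])
  obtain ⟨f, hf⟩ := f
  refine Algebra.adjoin_induction
    (p := fun f hf => algebraMap (productRing a b) (FractionRing (productRing a b)) ⟨f, hf⟩ ∈ S)
    ?_ ?_ ?_ ?_ hf
  · rintro f (⟨l, rfl⟩ | ⟨l, rfl⟩)
    · exact hcA l
    · exact hcB l
  · exact fun r => S.algebraMap_mem r
  · exact fun f g hf hg h1 h2 => (map_add (algebraMap (productRing a b)
      (FractionRing (productRing a b))) ⟨f, hf⟩ ⟨g, hg⟩) ▸ S.add_mem h1 h2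
  · exact fun f g hf hg h1 h2 => (map_mul (algebraMap (productRing a b)
      (FractionRing (productRing a b))) ⟨f, hf⟩ ⟨g, hg⟩) ▸ S.mul_mem h1 h2

end ProductCluster

/-! ### The cluster structure of the product. -/

section ClusterStructure

variable {a b i : ℕ} [IsDomain (productRing a b)]
variable {I J : Type} [Fintype I] [Fintype J]
  {edgeA : I → ℕ × ℕ} {edgeB : J → ℕ × ℕ}

/-- All regular functions are Laurent polynomials in the variables of the seed of a pair of
triangulations. -/
theorem pairSeed_chart (ha : 2 ≤ a) (hb : 2 ≤ b) (hA : IsTriangulation (a + 1) edgeA)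
    (hB : IsTriangulation (b + 1) edgeB) (f : productRing a b) :
    algebraMap _ (FractionRing (productRing a b)) f ∈ Algebra.adjoin ℂ
      (Set.range (pairSeed (rationalCoordA a b) (rationalCoordB a b) edgeA edgeB).var ∪
        Set.range fun i =>
          ((pairSeed (rationalCoordA a b) (rationalCoordB a b) edgeA edgeB).var i)⁻¹) := by
  set s := pairSeed (rationalCoordA a b) (rationalCoordB a b) edgeA edgeB with hs
  have hv : ∀ l, s.var l ∈ Algebra.adjoin ℂ (Set.range s.var ∪ Set.range fun i => (s.var i)⁻¹) :=
    fun l => Algebra.subset_adjoin (Or.inl ⟨l, rfl⟩)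
  have hv' : ∀ l, (s.var l)⁻¹ ∈
      Algebra.adjoin ℂ (Set.range s.var ∪ Set.range fun i => (s.var i)⁻¹) :=
    fun l => Algebra.subset_adjoin (Or.inr ⟨l, rfl⟩)
  obtain ⟨lA, hlA⟩ := hA.outer
  obtain ⟨lB, hlB⟩ := hB.outer
  refine algebraMap_productRing_mem (by omega) (by omega) _ (fun p q => ?_) ?_ (fun p q => ?_) ?_ f
  · refine hA.plucker_mem ha _ (fun l => ?_) (fun l => hv (Sum.inl l)) (fun l => hv' (Sum.inl l))
    have h := hA.bounds (by omega) (Prod.mk.eta (p := edgeA l)).symm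
    exact plucker_rationalCoordA_ne_zero (by omega) (by omega) h.1 (by omega) h.2.2
  · rw [← pairSeed_var_inl (zB := rationalCoordB a b) (edgeB := edgeB) hlA]
    exact hv' _
  · refine hB.plucker_mem hb _ (fun l => ?_) (fun l => hv (Sum.inr l)) (fun l => hv' (Sum.inr l))
    have h := hB.bounds (by omega) (Prod.mk.eta (p := edgeB l)).symm
    exact plucker_rationalCoordB_ne_zero (by omega) (by omega) h.1 (by omega) h.2.2
  · rw [← pairSeed_var_inr (zA := rationalCoordA a b) (edgeA := edgeA) hlB]
    exact hv' _

theorem pairSeed_adjoin_eq_top (ha : 2 ≤ a) (hb : 2 ≤ b) (hA : IsTriangulation (a + 1) edgeA)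
    (hB : IsTriangulation (b + 1) edgeB) : IntermediateField.adjoin ℂ
      (Set.range (pairSeed (rationalCoordA a b) (rationalCoordB a b) edgeA edgeB).var) = ⊤ := by
  set s := pairSeed (rationalCoordA a b) (rationalCoordB a b) edgeA edgeB with hs
  have key : ∀ f : productRing a b, algebraMap _ (FractionRing (productRing a b)) f ∈
      IntermediateField.adjoin ℂ (Set.range s.var) := by
    intro f
    have hle : Algebra.adjoin ℂ (Set.range s.var ∪ Set.range fun i => (s.var i)⁻¹) ≤
        (IntermediateField.adjoin ℂ (Set.range s.var)).toSubalgebra := by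
      refine Algebra.adjoin_le ?_
      rintro _ (⟨l, rfl⟩ | ⟨l, rfl⟩)
      · exact IntermediateField.subset_adjoin _ _ ⟨l, rfl⟩
      · exact IntermediateField.inv_mem _ (IntermediateField.subset_adjoin _ _ ⟨l, rfl⟩)
    exact hle (pairSeed_chart ha hb hA hB f)
  -- Every rational function is a quotient of regular ones, and these are Laurent polynomials in the
  -- variables.
  refine eq_top_iff.2 fun x _ => ?_
  obtain ⟨f, g, -, rfl⟩ := IsFractionRing.div_surjective (A := productRing a b) x
  exact div_mem (key f) (key g)

variable [DecidableEq I] [DecidableEq J]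

/-- The product seed defines a cluster structure. -/
theorem productSeed_isClusterStructure (ha : 2 ≤ a) (hb : 2 ≤ b)
    (hA : IsTriangulation (a + 1) edgeA) (hB : IsTriangulation (b + 1) edgeB) :
    (productSeed a b edgeA edgeB).IsClusterStructure (productRing a b) := by
  -- The product seed does not depend on the cut; `i = 1` serves only to apply the joint statement
  -- on mutations.
  have D := isGlued_rationalCoord (a := a) (b := b) (i := 1) (by omega) (by omega) le_rfl (by omega)
  have hp : productSeed a b edgeA edgeB =
    pairSeed (rationalCoordA a b) (rationalCoordB a b) edgeA edgeB := rfl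
  rw [hp]
  have hmut := fun l hl => exists_mutateList_eq D ha hb le_rfl (by omega) hA hB l hl
  have hgen : ∀ l, (pairSeed (rationalCoordA a b) (rationalCoordB a b) edgeA edgeB).MutableList l →
      IntermediateField.adjoin ℂ (Set.range
        ((pairSeed (rationalCoordA a b) (rationalCoordB a b) edgeA edgeB).mutateList l).var) =
          ⊤ := by
    intro l hl
    obtain ⟨eA, eB, h1, h2, h3, -⟩ := hmut l hl
    rw [h3]
    exact pairSeed_adjoin_eq_top ha hb h1 h2
  obtain ⟨lA, hlA⟩ := hA.outer
  obtain ⟨lB, hlB⟩ := hB.outer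
  refine ⟨fun l hl => Seed.algebraicIndependent_of_card_le_trdeg _ (hgen l hl) ?_, hgen, ?_, ?_, ?_, ?_⟩
  -- There are `(a - 1) + (b - 1)` variables, as many as free coordinates on the product.
  · rw [Fintype.card_sum, hA.card_eq (by omega), hB.card_eq (by omega)]
    exact (le_trdeg_productRing ha hb :)
  · intro l hl m
    obtain ⟨eA, eB, h1, h2, h3, -⟩ := hmut l hl
    rw [h3]
    rcases m with m | m
    · exact ⟨_, (plucker_rationalCoordA _ _).symm⟩
    · exact ⟨_, (plucker_rationalCoordB _ _).symm⟩
  · rintro (l | l) hl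
    · rw [inl_mem_pairSeed_frozen] at hl
      rw [pairSeed_var_inl hl, plucker_rationalCoordA]
      exact ⟨_, (frozenUnitA (by omega)).isUnit, rfl⟩
    · rw [inr_mem_pairSeed_frozen] at hl
      rw [pairSeed_var_inr hl, plucker_rationalCoordB]
      exact ⟨_, (frozenUnitB (by omega)).isUnit, rfl⟩
  · intro l hl f
    obtain ⟨eA, eB, h1, h2, h3, -⟩ := hmut l hl
    rw [h3]
    exact pairSeed_chart ha hb h1 h2 f
  · refine algebraMap_productRing_mem (by omega) (by omega) _ (fun p q h1 h2 h3 => ?_) ?_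
      (fun p q h1 h2 h3 => ?_) ?_
    -- Flips reach every diagonal, so each Plücker coordinate of the factor is a cluster variable,
    -- or 1 for a side.
    · obtain ⟨ls, edge', hF, rfl | ⟨m, hm⟩⟩ := hA.exists_flipSequence (by omega) h1 h2 h3
      · rw [plucker_consecutive _ p h1 (by omega)]
        exact one_mem _
      · obtain ⟨m1, m2⟩ := pairSeed_mutateList_inl (zB := rationalCoordB a b) (edgeB := edgeB)
          D.ne_zero_A ha hA hF
        refine Algebra.subset_adjoin (Or.inl ⟨_, m1, Sum.inl m, ?_⟩)
        rw [m2, pairSeed_var_inl hm]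
    · refine Algebra.subset_adjoin (Or.inr ⟨Sum.inl lA, inl_mem_pairSeed_frozen.2 hlA, ?_⟩)
      rw [pairSeed_var_inl hlA]
    · obtain ⟨ls, edge', hF, rfl | ⟨m, hm⟩⟩ := hB.exists_flipSequence (by omega) h1 h2 h3
      · rw [plucker_consecutive _ p h1 (by omega)]
        exact one_mem _
      · obtain ⟨m1, m2⟩ := pairSeed_mutateList_inr (zA := rationalCoordA a b) (edgeA := edgeA)
          D.ne_zero_B hb hB hF
        refine Algebra.subset_adjoin (Or.inl ⟨_, m1, Sum.inr m, ?_⟩)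
        rw [m2, pairSeed_var_inr hm]
    · refine Algebra.subset_adjoin (Or.inr ⟨Sum.inr lB, inr_mem_pairSeed_frozen.2 hlB, ?_⟩)
      rw [pairSeed_var_inr hlB]

end ClusterStructure

/-! ### The pullback of the cut seed. -/

section Transport

variable {a b i : ℕ} {I J : Type*}

theorem cutSeed_transport [IsDomain (productRing a b)]
    [IsDomain (cutLocusRing (a + b - 1) i (i + a))]
    (φ : cutLocusRing (a + b - 1) i (i + a) ≃ₐ[ℂ] productRing a b) (edgeA : I → ℕ × ℕ)
    (edgeB : J → ℕ × ℕ) : (cutSeed a b i edgeA edgeB).transport φ = glueSeed i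
      (fun l => algebraMap _ (FractionRing (productRing a b))
        (φ (cutLocusCoord (a + b - 1) i (i + a) l))) edgeA edgeB := by
  refine Seed.ext' ?_ rfl rfl
  funext l
  let F : FractionRing (cutLocusRing (a + b - 1) i (i + a)) ≃ₐ[ℂ] FractionRing (productRing a b) :=
    IsFractionRing.algEquivOfAlgEquiv φ
  have hF : ∀ f, F (algebraMap _ _ f) = algebraMap _ _ (φ f) :=
    IsFractionRing.algEquivOfAlgEquiv_algebraMap φ
  have h := plucker_map (F : _ →+* FractionRing (productRing a b))
    (fun l => algebraMap _ (FractionRing (cutLocusRing (a + b - 1) i (i + a)))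
      (cutLocusCoord (a + b - 1) i (i + a) l))
    (glueEdges a i edgeA edgeB l).1 (glueEdges a i edgeA edgeB l).2
  refine h.symm.trans ?_
  simp only [RingHom.coe_coe, hF]
  rfl

end Transport

end TwoStrand

/-! ### The theorem on diagonal cuts. -/

theorem mainTheorem5 (a b i : ℕ) (ha : 2 ≤ a) (hb : 2 ≤ b) (hi : 1 ≤ i) (hib : i ≤ b) :
    ∃ Φ : (TwoStrand.braidVariety a × TwoStrand.braidVariety b) ≃
        TwoStrand.cutLocus (a + b - 1) i (i + a),
      (∀ x y, (Φ (x, y) : Fin (a + b - 1) → ℂ) = TwoStrand.glue a b i x y) ∧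
      (∀ z, ((Φ.symm z).1 : Fin a → ℂ) = TwoStrand.cutA a b i z ∧
        ((Φ.symm z).2 : Fin b → ℂ) = TwoStrand.cutB a b i z) ∧
      ∃ (_ : IsDomain (TwoStrand.cutLocusRing (a + b - 1) i (i + a)))
        (_ : IsDomain (TwoStrand.productRing a b))
        (pullback : TwoStrand.cutLocusRing (a + b - 1) i (i + a) ≃ₐ[ℂ] TwoStrand.productRing a b),
        (∀ f p, (pullback f).1 p = f.1 (Φ p)) ∧
        ∀ (I J : Type) [Fintype I] [DecidableEq I] [Fintype J] [DecidableEq J]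
          (edgeA : I → ℕ × ℕ) (edgeB : J → ℕ × ℕ),
          TwoStrand.IsTriangulation (a + 1) edgeA → TwoStrand.IsTriangulation (b + 1) edgeB →
          TwoStrand.IsTriangulation (a + b) (TwoStrand.glueEdges a i edgeA edgeB) ∧
          (TwoStrand.cutSeed a b i edgeA edgeB).IsClusterStructure
            (TwoStrand.cutLocusRing (a + b - 1) i (i + a)) ∧
          (TwoStrand.productSeed a b edgeA edgeB).IsClusterStructure
            (TwoStrand.productRing a b) ∧
          ((TwoStrand.cutSeed a b i edgeA edgeB).transport pullback).IsClusterStructure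
            (TwoStrand.productRing a b) ∧
          ((TwoStrand.cutSeed a b i edgeA edgeB).transport pullback).ClusterQuasiEquiv
            (TwoStrand.productSeed a b edgeA edgeB) := by
  have ha' : 1 ≤ a := by omega
  have hb' : 1 ≤ b := by omega
  have hP : IsDomain (TwoStrand.productRing a b) := TwoStrand.isDomain_productRing ha hb
  -- Irreducibility of `{Δ_{ij} ≠ 0}` is inherited from the product through the isomorphism of
  -- rings.
  have hC : IsDomain (TwoStrand.cutLocusRing (a + b - 1) i (i + a)) :=
    (TwoStrand.gluePullback ha' hb' hi hib).toMulEquiv.isDomain _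
  refine ⟨TwoStrand.glueEquiv ha' hb' hi hib, fun x y => rfl, fun z => ⟨rfl, rfl⟩, hC, hP,
    TwoStrand.gluePullback ha' hb' hi hib, fun f p => rfl, ?_⟩
  intro I J _ _ _ _ edgeA edgeB hA hB
  have hquasi : ((TwoStrand.cutSeed a b i edgeA edgeB).transport
      (TwoStrand.gluePullback ha' hb' hi hib)).ClusterQuasiEquiv
        (TwoStrand.productSeed a b edgeA edgeB) := by
    rw [TwoStrand.cutSeed_transport]
    exact TwoStrand.glueSeed_clusterQuasiEquiv
      (TwoStrand.isGlued_rationalCoord ha' hb' hi hib) ha hb hi hib hA hB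
  have hprod := TwoStrand.productSeed_isClusterStructure ha hb hA hB
  have hpull := hprod.of_clusterQuasiEquiv hquasi
  refine ⟨TwoStrand.isTriangulation_glueEdges ha hb hi hib hA hB, ?_, hprod, hpull, hquasi⟩
  -- The structure on `{Δ_{ij} ≠ 0}` comes last: it is the pulled-back structure, transported by the
  -- inverse isomorphism.
  have := hpull.transport (TwoStrand.gluePullback ha' hb' hi hib).symm
  rwa [TwoStrand.Seed.transport_symm_transport] at this
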